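/- Let $K$ be an algebraically closed field of characteristic $0$. For a Lie algebra $\mathfrak g$ over $K$ put $\mathfrak g^0=\mathfrak g$, $\mathfrak g^k=[\mathfrak g^{k-1},\mathfrak g]$; $\mathfrak g$ is filiform of dimension $n$ if $\dim\mathfrak g=n$ and $n-1$ is the least $p$ with $\mathfrak g^{p}=0$. For $n\ge 12$ let $\mathfrak A^2_n(K)$ be the class of filiform Lie algebras of dimension $n$ such that (b) there is no subspace $U\supseteq\mathfrak g^1$ of codimension one with $[U,\mathfrak g^1]\subseteq\mathfrak g^4$; (c) if $n$ is even, $\mathfrak g^{(n-4)/2}$ is abelian; and such that $[\mathfrak g^1,\mathfrak g^1]\not\subseteq\mathfrak g^6$. Let $\mathcal I_n$ be the set of pairs $(k,s)$ of integers with $2\le k\le \lfloor n/2\rfloor$, $2k+1\le s\le n$, together with $(n/2,n)$ if $n$ is even. A basis $(e_1,\dots,e_n)$ of $\mathfrak g$ is adapted, with structure constants $\alpha=(\alpha_{k,s})_{(k,s)\in\mathcal I_n}\in K^{\mathcal I_n}$, if (with $e_i=0$ for $i>n$) $[e_1,e_i]=e_{i+1}$ for $2\le i\le n$ and $[e_i,e_j]=\sum_{(k,s)\in\mathcal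 I_n}\alpha_{k,s}\,\psi_{k,s}(e_i\wedge e_j)$ for $2\le i<j\le n$, where $\psi_{k,s}(e_i\wedge e_j)=(-1)^{k-i}\binom{j-k-1}{k-i}e_{s+(j-k-1)-(k-i)}$ if $i\le k<j$ and $0$ otherwise (in particular $[e_k,e_{k+1}]=\sum_s\alpha_{k,s}e_s$). Let $H^2(\mathfrak g,K)=Z^2(\mathfrak g,K)/B^2(\mathfrak g,K)$ be Lie algebra cohomology with trivial coefficients and $b_2(\mathfrak g)=\dim H^2(\mathfrak g,K)$. A $2$-cocycle is affine if it is nonzero on $\mathfrak z(\mathfrak g)\wedge\mathfrak g$, and a class in $H^2(\mathfrak g,K)$ is affine if all its representatives are affine. Relative to an adapted basis let $\omega_1,\omega_2\in\mathrm{Hom}(\Lambda^2\mathfrak g,K)$ be the forms whose only nonzero values on the $e_i\wedge e_j$, $i<j$, are $\omega_1(e_2\wedge e_3)=1$, respectively $\omega_2(e_2\wedge e_5)=1$ and $\omega_2(e_3\wedge e_4)=-1$. **Theorem.** Let $n\ge 13$. There is a polynomial condition $P_n\equiv 0$ in the structure constants, given by a single polynomial $P_n\in K[\alpha_{k,s}:(k,s)\in\mathcal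 I_n]$ if $n\ne 15$ and by two such polynomials (which have to vanish simultaneously) if $n=15$, depending only on $n$ and $K$, such that for every $\mathfrak g\in\mathfrak A^2_n(K)$ and every adapted basis of $\mathfrak g$, with structure constants $\alpha$, the forms $\omega_1,\omega_2$ are $2$-cocycles and - if $P_n(\alpha)=0$, then there is an affine class $[\omega]$ with $H^2(\mathfrak g,K)=\mathrm{span}\{[\omega_1],[\omega_2],[\omega]\}$; - otherwise $H^2(\mathfrak g,K)=\mathrm{span}\{[\omega_1],[\omega_2]\}$ and $b_2(\mathfrak g)=2$. -/

import Mathlib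

open LieModule LieModule.Cohomology

noncomputable section

namespace FiliformH2

/-! ### Filiform Lie algebras and the class `𝔄²ₙ(K)` -/

section Classes

variable (K : Type*) [Field K] (𝔤 : Type*) [LieRing 𝔤] [LieAlgebra K 𝔤]

/-- The term `𝔤^k` of the lower central series: `𝔤^0 = 𝔤`, `𝔤^k = [𝔤^(k-1), 𝔤]`. -/
abbrev lcs (k : ℕ) : LieSubmodule K 𝔤 𝔤 := lowerCentralSeries K 𝔤 𝔤 k

/-- `p` is the nilindex of `𝔤`: `𝔤^p = 0` and `𝔤^q ≠ 0` for `q < p`. -/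
def IsNilindex (p : ℕ) : Prop := lcs K 𝔤 p = ⊥ ∧ ∀ q < p, lcs K 𝔤 q ≠ ⊥

/-- Filiform Lie algebra of dimension `n`: nilpotent of nilindex `n - 1`. -/
structure IsFiliform (n : ℕ) : Prop where
  finite : Module.Finite K 𝔤
  finrank_eq : Module.finrank K 𝔤 = n
  nilindex : IsNilindex K 𝔤 (n - 1)

/-- Property (a): there is a one-codimensional subspace `U ⊇ 𝔤^1` with `[U, 𝔤^1] ⊆ 𝔤^4`. -/
def PropA : Prop :=
  ∃ U : Submodule K 𝔤, Module.finrank K (𝔤 ⧸ U) = 1 ∧ (lcs K 𝔤 1).toSubmodule ≤ U ∧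
    ∀ x ∈ U, ∀ y ∈ lcs K 𝔤 1, ⁅x, y⁆ ∈ lcs K 𝔤 4

/-- Property (b): there is no such subspace. -/
def PropB : Prop := ¬ PropA K 𝔤

/-- Property (c): if the dimension `n` is even, then `𝔤^((n-4)/2)` is abelian. -/
def PropC (n : ℕ) : Prop :=
  Even n → ∀ x ∈ lcs K 𝔤 ((n - 4) / 2), ∀ y ∈ lcs K 𝔤 ((n - 4) / 2), ⁅x, y⁆ = 0

/-- Property (d): `[𝔤^1, 𝔤^1] ⊆ 𝔤^6`. -/
def PropD : Prop := ∀ x ∈ lcs K 𝔤 1, ∀ y ∈ lcs K 𝔤 1, ⁅x, y⁆ ∈ lcs K 𝔤 6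

/-- The class `𝔄²ₙ(K)`: filiform of dimension `n ≥ 12`, with (b) and (c), but not (d). -/
structure ClassA2 (n : ℕ) : Prop where
  le : 12 ≤ n
  filiform : IsFiliform K 𝔤 n
  propB : PropB K 𝔤
  propC : PropC K 𝔤 n
  not_propD : ¬ PropD K 𝔤

end Classes

/-! ### Adapted bases -/

/-- The index set `𝓘ₙ`: the pairs `(k, s)` with `2 ≤ k ≤ [n/2]` and `2k + 1 ≤ s ≤ n`, together
with `(n/2, n)` if `n` is even. -/
def index (n : ℕ) : Finset (ℕ × ℕ) :=
  ((Finset.Icc 2 (n / 2) ×ˢ Finset.Icc 1 n).filter fun q => 2 * q.1 + 1 ≤ q.2) ∪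
    (if Even n then {(n / 2, n)} else ∅)

section Adapted

variable {K : Type*} [Field K] {𝔤 : Type*} [LieRing 𝔤] [LieAlgebra K 𝔤] {n : ℕ}

/-- The basis vector `e_i`, numbered from `1` to `n`; it is `0` for all other `i`. -/
def vec (e : Module.Basis (Fin n) K 𝔤) (i : ℕ) : 𝔤 :=
  if h : 1 ≤ i ∧ i ≤ n then e ⟨i - 1, by omega⟩ else 0

/-- The coordinate function of `e_i`, numbered from `1` to `n`; it is `0` for all other `i`. -/
def coord (e : Module.Basis (Fin n) K 𝔤) (i : ℕ) : 𝔤 →ₗ[K] K :=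
  if h : 1 ≤ i ∧ i ≤ n then e.coord ⟨i - 1, by omega⟩ else 0

/-- The value `ψ_{k,s}(e_i ∧ e_j)`, for `2 ≤ i < j ≤ n`, of the 2-cocycle `ψ_{k,s}` of the standard
graded filiform algebra `L(n)`. There `(ad e₁)^m e_s = e_{s+m}` (which is `0` if `s + m > n`).
If the natural-number subtraction in the exponent truncates, the binomial coefficient is `0`. -/
def psi (e : Module.Basis (Fin n) K 𝔤) (k s i j : ℕ) : 𝔤 :=
  if i ≤ k ∧ k < j then
    ((-1 : K) ^ (k - i) * ((j - k - 1).choose (k - i) : K)) • vec e (s + ((j - k - 1) - (k - i)))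
  else 0

/-- `e` is an adapted basis with structure constants `α_{k,s}`, `(k,s) ∈ 𝓘ₙ`: the brackets are
those of `L(n)` plus those of the cocycle `ψ = ∑ α_{k,s} ψ_{k,s}`, where `ψ(e₁ ∧ e_i) = 0`. -/
structure IsAdapted (e : Module.Basis (Fin n) K 𝔤) (α : index n → K) : Prop where
  lie_one : ∀ i, 2 ≤ i → i ≤ n → ⁅vec e 1, vec e i⁆ = vec e (i + 1)
  lie : ∀ i j, 2 ≤ i → i < j → j ≤ n →
    ⁅vec e i, vec e j⁆ = ∑ q : index n, α q • psi e q.1.1 q.1.2 i j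

end Adapted

/-! ### Second cohomology with trivial coefficients -/

section SubQuot

variable {K : Type*} [Field K] {V : Type*} [AddCommGroup V] [Module K V]

/-- The quotient space `Z / B` for subspaces `B ⊆ Z` of a vector space. -/
def SubQuot (Z B : Submodule K V) : Type _ := Z ⧸ B.submoduleOf Z

instance (Z B : Submodule K V) : AddCommGroup (SubQuot Z B) :=
  inferInstanceAs (AddCommGroup (Z ⧸ B.submoduleOf Z))

instance (Z B : Submodule K V) : Module K (SubQuot Z B) :=
  inferInstanceAs (Module K (Z ⧸ B.submoduleOf Z))

/-- The residue class of an element of `Z`. -/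
def SubQuot.mk {Z B : Submodule K V} (z : Z) : SubQuot Z B :=
  (Submodule.Quotient.mk z : Z ⧸ B.submoduleOf Z)

end SubQuot

section Cohomology

variable (K : Type*) [Field K] (𝔤 : Type*) [LieRing 𝔤] [LieAlgebra K 𝔤]

/-- The bilinear forms on `𝔤`, with values in the trivial module `K`. -/
abbrev Bil : Type _ := 𝔤 →ₗ[K] 𝔤 →ₗ[K] TrivialLieModule K 𝔤 K

/-- The 2-cocycles `Z²(𝔤, K)`, as a space of (alternating) bilinear forms. -/
def Z2 : Submodule K (Bil K 𝔤) :=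
  (twoCocycle K 𝔤 (TrivialLieModule K 𝔤 K)).map (twoCochain K 𝔤 (TrivialLieModule K 𝔤 K)).subtype

/-- The 2-coboundaries `B²(𝔤, K)`, as a space of (alternating) bilinear forms. -/
def B2 : Submodule K (Bil K 𝔤) :=
  (LinearMap.range (d₁₂ K 𝔤 (TrivialLieModule K 𝔤 K))).map
    (twoCochain K 𝔤 (TrivialLieModule K 𝔤 K)).subtype

/-- `H²(𝔤, K) = Z²(𝔤, K) / B²(𝔤, K)`. -/
abbrev H2 : Type _ := SubQuot (Z2 K 𝔤) (B2 K 𝔤)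

/-- The second Betti number `b₂(𝔤) = dim H²(𝔤, K)`. -/
def b2 : ℕ := Module.finrank K (H2 K 𝔤)

variable {K 𝔤}

/-- The cohomology class `[ω]` of a 2-cocycle. -/
def cls (ω : Z2 K 𝔤) : H2 K 𝔤 := SubQuot.mk ω

/-- A 2-cocycle is affine if it is nonzero on `𝔷(𝔤) ∧ 𝔤`. -/
def IsAffine (ω : Z2 K 𝔤) : Prop := ∃ z ∈ LieAlgebra.center K 𝔤, ∃ y : 𝔤, ω.1 z y ≠ 0

/-- A cohomology class is affine if every representative is affine. -/
def IsAffineClass (c : H2 K 𝔤) : Prop := ∀ ω : Z2 K 𝔤, cls ω = c → IsAffine ω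

variable {n : ℕ}

/-- The alternating bilinear form `ω_ℓ ∈ Hom(Λ²𝔤, K)`, whose nonzero values on pairs `e_i ∧ e_j` with
`i < j` are `ω_ℓ(e_k ∧ e_{2ℓ+3-k}) = (-1)^k` for `2 ≤ k ≤ [(2ℓ+3)/2]`. -/
def omega (e : Module.Basis (Fin n) K 𝔤) (l : ℕ) : Bil K 𝔤 :=
  (∑ k ∈ Finset.Icc 2 ((2 * l + 3) / 2), (-1 : K) ^ k •
    ((LinearMap.mul K K).compl₁₂ (coord e k) (coord e (2 * l + 3 - k)) -
      (LinearMap.mul K K).compl₁₂ (coord e (2 * l + 3 - k)) (coord e k))).compr₂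
    (TrivialLieModule.equiv K 𝔤 K).symm.toLinearMap

end Cohomology

end FiliformH2

end

open LieModule LieModule.Cohomology

noncomputable section

namespace FiliformH2

section Flag

variable {K : Type*} [Field K] {𝔤 : Type*} [LieRing 𝔤] [LieAlgebra K 𝔤] {n : ℕ}

/-- The span of the basis vectors `e_j` with `j ≥ i`. -/
def flag (e : Module.Basis (Fin n) K 𝔤) (i : ℕ) : Submodule K 𝔤 :=
  Submodule.span K (vec e '' Set.Ici i)

variable (e : Module.Basis (Fin n) K 𝔤)

lemma vec_succ (i : Fin n) : vec e (i + 1) = e i := by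
  have := i.2
  rw [vec, dif_pos (by omega)]
  congr 1

lemma vec_eq_zero {i : ℕ} (h : n < i) : vec e i = 0 := dif_neg (by omega)

lemma vec_mem_flag {i j : ℕ} (h : i ≤ j) : vec e j ∈ flag e i :=
  Submodule.subset_span ⟨j, h, rfl⟩

lemma flag_anti {i j : ℕ} (h : i ≤ j) : flag e j ≤ flag e i :=
  Submodule.span_mono (Set.image_mono (Set.Ici_subset_Ici.2 h))

lemma flag_one : flag e 1 = ⊤ := by
  rw [eq_top_iff, ← e.span_eq, Submodule.span_le]
  rintro _ ⟨i, rfl⟩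
  rw [← vec_succ]
  exact vec_mem_flag e (by omega)

lemma mem_flag_one (x : 𝔤) : x ∈ flag e 1 := by rw [flag_one]; trivial

lemma flag_le_of {i : ℕ} {S : Submodule K 𝔤} (h : ∀ j, i ≤ j → vec e j ∈ S) : flag e i ≤ S := by
  rw [flag, Submodule.span_le]
  rintro _ ⟨j, hj, rfl⟩
  exact h j hj

lemma flag_eq_bot {i : ℕ} (h : n < i) : flag e i = ⊥ :=
  le_bot_iff.1 (flag_le_of e fun j hj => by rw [vec_eq_zero e (by omega)]; simp)

lemma eq_zero_of_mem_flag {i : ℕ} (h : n < i) {y : 𝔤} (hy : y ∈ flag e i) : y = 0 := by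
  rw [flag_eq_bot e h] at hy
  simpa using hy

lemma exists_sub_smul_vec_mem {i : ℕ} {y : 𝔤} (hy : y ∈ flag e i) :
    ∃ c : K, y - c • vec e i ∈ flag e (i + 1) := by
  induction hy using Submodule.span_induction with
  | mem y hy =>
    obtain ⟨j, hj, rfl⟩ := hy
    rcases (show i ≤ j from hj).eq_or_lt with rfl | h
    · exact ⟨1, by simp⟩
    · exact ⟨0, by simpa using vec_mem_flag e h⟩
  | zero => exact ⟨0, by simp⟩
  | add x y _ _ hx hy =>
    obtain ⟨a, ha⟩ := hx
    obtain ⟨b, hb⟩ := hy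
    refine ⟨a + b, ?_⟩
    convert add_mem ha hb using 1
    module
  | smul r x _ hx =>
    obtain ⟨a, ha⟩ := hx
    refine ⟨r * a, ?_⟩
    convert Submodule.smul_mem _ r ha using 1
    module

lemma coord_vec {i j : ℕ} (hi : 1 ≤ i) (hn : i ≤ n) :
    coord e i (vec e j) = if j = i then 1 else 0 := by
  rw [coord, dif_pos ⟨hi, hn⟩, vec]
  split_ifs with h1 h2 h2
  · subst h2; simp
  · simp [Finsupp.single_apply]; omega
  · omega
  · simp

lemma coord_eq_zero_of_mem_flag {i j : ℕ} (h : i < j) {y : 𝔤} (hy : y ∈ flag e j) :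
    coord e i y = 0 := by
  by_cases hi : 1 ≤ i ∧ i ≤ n
  · have : flag e j ≤ LinearMap.ker (coord e i) := flag_le_of e fun k hk => by
      rw [LinearMap.mem_ker, coord_vec e hi.1 hi.2, if_neg (by omega)]
    exact this hy
  · simp [coord, dif_neg hi]

lemma eq_sum_coord (y : 𝔤) : y = ∑ s ∈ Finset.Icc 1 n, coord e s y • vec e s := by
  conv_lhs => rw [← e.sum_repr y]
  rw [← Finset.Ico_add_one_right_eq_Icc, Finset.sum_Ico_eq_sum_range,
    ← Fin.sum_univ_eq_sum_range (fun i => coord e (1 + i) y • vec e (1 + i))]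
  refine Finset.sum_congr rfl fun i _ => ?_
  have := i.2
  rw [add_comm 1, vec_succ, coord, dif_pos (by omega)]
  simp

end Flag

section Forms

variable {K : Type*} [Field K] {𝔤 : Type*} [LieRing 𝔤] [LieAlgebra K 𝔤] {n : ℕ}

/-- The differential of a bilinear form, for trivial coefficients. -/
def delta (B : 𝔤 →ₗ[K] 𝔤 →ₗ[K] K) (x y z : 𝔤) : K := B ⁅x, y⁆ z + B ⁅y, z⁆ x + B ⁅z, x⁆ y

/-- The bilinear form with matrix `b` in a basis. -/
def formOf (e : Module.Basis (Fin n) K 𝔤) (b : ℕ → ℕ → K) : 𝔤 →ₗ[K] 𝔤 →ₗ[K] K :=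
  e.constr K fun i => e.constr K fun j => b (i + 1) (j + 1)

section delta

variable (B C : 𝔤 →ₗ[K] 𝔤 →ₗ[K] K) (x x' y z t : 𝔤) (c : K)

lemma delta_add₁ : delta B (x + x') y z = delta B x y z + delta B x' y z := by
  simp only [delta, add_lie, lie_add, map_add, LinearMap.add_apply]; ring

lemma delta_smul₁ : delta B (c • x) y z = c * delta B x y z := by
  simp only [delta, smul_lie, lie_smul, map_smul, LinearMap.smul_apply, smul_eq_mul]; ring

lemma delta_rotate : delta B x y z = delta B y z x := by
  simp only [delta]; ring

lemma delta_smul₂ : delta B y (c • x) z = c * delta B y x z := by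
  rw [delta_rotate, delta_smul₁, ← delta_rotate B y x z]

lemma delta_smul₃ : delta B y z (c • x) = c * delta B y z x := by
  rw [← delta_rotate B (c • x), delta_smul₁, delta_rotate B x]

lemma delta_zero₁ : delta B 0 y z = 0 := by simp [delta]

lemma delta_zero₂ : delta B x 0 z = 0 := by simp [delta]

lemma delta_zero₃ : delta B x y 0 = 0 := by simp [delta]

lemma delta_sub₁ : delta B (x - x') y z = delta B x y z - delta B x' y z := by
  simp only [delta, sub_lie, lie_sub, map_sub, LinearMap.sub_apply]; ring

lemma delta_form_add : delta (B + C) x y z = delta B x y z + delta C x y z := by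
  simp only [delta, LinearMap.add_apply]; ring

lemma delta_form_sub : delta (B - C) x y z = delta B x y z - delta C x y z := by
  simp only [delta, LinearMap.sub_apply]; ring

lemma delta_form_smul : delta (c • B) x y z = c * delta B x y z := by
  simp only [delta, LinearMap.smul_apply, smul_eq_mul]; ring

lemma delta_swap : delta B y x z = - delta B x y z := by
  simp only [delta, ← lie_skew x y, ← lie_skew z x, ← lie_skew y z, map_neg, LinearMap.neg_apply]
  ring

lemma delta_swap' : delta B x z y = - delta B x y z := by
  rw [delta_rotate, delta_swap, delta_rotate B x, delta_rotate B y]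

variable {B} in
/-- `d ∘ d = 0` on bilinear forms, in degree four. -/
lemma delta_delta (hB : ∀ x y, B x y = - B y x) :
    delta B ⁅x, y⁆ z t - delta B ⁅x, z⁆ y t + delta B ⁅x, t⁆ y z + delta B ⁅y, z⁆ x t
      - delta B ⁅y, t⁆ x z + delta B ⁅z, t⁆ x y = 0 := by
  have jac : ∀ a b c d : 𝔤, B ⁅⁅a, b⁆, c⁆ d + B ⁅⁅b, c⁆, a⁆ d + B ⁅⁅c, a⁆, b⁆ d = 0 := by
    intro a b c d
    rw [← LinearMap.add_apply, ← LinearMap.add_apply, ← map_add, ← map_add]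
    have : ⁅⁅a, b⁆, c⁆ + ⁅⁅b, c⁆, a⁆ + ⁅⁅c, a⁆, b⁆ = 0 := by
      have := lie_jacobi a b c
      rw [← lie_skew ⁅a, b⁆, ← lie_skew ⁅b, c⁆, ← lie_skew ⁅c, a⁆, ← neg_eq_zero, ← this]
      abel
    rw [this, map_zero, LinearMap.zero_apply]
  have sk : ∀ a b c d : 𝔤, B ⁅a, ⁅b, c⁆⁆ d = - B ⁅⁅b, c⁆, a⁆ d := by
    intro a b c d
    rw [← lie_skew, map_neg, LinearMap.neg_apply]
  have sk2 : ∀ a b c d : 𝔤, B ⁅⁅b, a⁆, c⁆ d = - B ⁅⁅a, b⁆, c⁆ d := by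
    intro a b c d
    rw [← lie_skew b a, neg_lie, map_neg, LinearMap.neg_apply]
  simp only [delta, sk]
  have h1 := jac x y z t
  have h2 := jac x y t z
  have h3 := jac x z t y
  have h4 := jac y z t x
  rw [sk2 x z] at h1
  rw [sk2 x t] at h2 h3
  rw [sk2 y t] at h4
  have e1 := hB ⁅z, t⁆ ⁅x, y⁆
  have e2 := hB ⁅y, t⁆ ⁅x, z⁆
  have e3 := hB ⁅x, t⁆ ⁅y, z⁆
  linear_combination h1 - h2 + h3 - h4 + e1 - e2 + e3

end delta

section basis

variable (e : Module.Basis (Fin n) K 𝔤)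

lemma formOf_vec (b : ℕ → ℕ → K) {i j : ℕ} (hi : 1 ≤ i) (hin : i ≤ n) (hj : 1 ≤ j) (hjn : j ≤ n) :
    formOf e b (vec e i) (vec e j) = b i j := by
  obtain ⟨i, rfl⟩ := Nat.exists_eq_add_of_le' hi
  obtain ⟨j, rfl⟩ := Nat.exists_eq_add_of_le' hj
  rw [vec_succ e ⟨i, by omega⟩, vec_succ e ⟨j, by omega⟩, formOf, Module.Basis.constr_basis,
    Module.Basis.constr_basis]

lemma form_ext {B C : 𝔤 →ₗ[K] 𝔤 →ₗ[K] K}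
    (h : ∀ i j, 1 ≤ i → i ≤ n → 1 ≤ j → j ≤ n → B (vec e i) (vec e j) = C (vec e i) (vec e j)) :
    B = C := by
  refine e.ext fun i => e.ext fun j => ?_
  have h1 := i.2
  have h2 := j.2
  rw [← vec_succ, ← vec_succ]
  exact h _ _ (by omega) (by omega) (by omega) (by omega)

lemma formOf_add_smul (b b' : ℕ → ℕ → K) (c : K) :
    formOf e (fun i j => b i j + c * b' i j) = formOf e b + c • formOf e b' := by
  refine form_ext e fun i j h1 h2 h3 h4 => ?_
  simp [formOf_vec e _ h1 h2 h3 h4]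

lemma formOf_skew {b : ℕ → ℕ → K} (hb : ∀ i j, b i j = - b j i) (x y : 𝔤) :
    formOf e b x y = - formOf e b y x := by
  have : formOf e b = - (formOf e b).flip := by
    refine form_ext e fun i j h1 h2 h3 h4 => ?_
    simp [formOf_vec e _ h1 h2 h3 h4, formOf_vec e _ h3 h4 h1 h2, ← hb i j]
  conv_lhs => rw [this]
  simp

lemma form_eq_zero_of_flag {B : 𝔤 →ₗ[K] 𝔤 →ₗ[K] K} {N i j : ℕ}
    (h : ∀ i j, 1 ≤ i → i ≤ n → 1 ≤ j → j ≤ n → N ≤ i + j → B (vec e i) (vec e j) = 0)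
    (hij : N ≤ i + j) {y z : 𝔤} (hy : y ∈ flag e i) (hz : z ∈ flag e j) : B y z = 0 := by
  have key : ∀ p q, i ≤ p → j ≤ q → B (vec e p) (vec e q) = 0 := by
    intro p q hp hq
    by_cases h1 : 1 ≤ p ∧ p ≤ n
    · by_cases h2 : 1 ≤ q ∧ q ≤ n
      · exact h p q h1.1 h1.2 h2.1 h2.2 (by omega)
      · simp [vec, dif_neg h2]
    · simp [vec, dif_neg h1]
  have h1 : ∀ p, i ≤ p → B (vec e p) z = 0 := fun p hp =>
    (flag_le_of e (S := LinearMap.ker (B (vec e p))) fun q hq => key p q hp hq) hz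
  exact (flag_le_of e (S := LinearMap.ker (B.flip z)) fun p hp => h1 p hp) hy

/-- `delta B` with two arguments fixed. -/
def deltaLin (B : 𝔤 →ₗ[K] 𝔤 →ₗ[K] K) (y z : 𝔤) : 𝔤 →ₗ[K] K where
  toFun x := delta B x y z
  map_add' x x' := delta_add₁ B x x' y z
  map_smul' c x := delta_smul₁ B x y z c

lemma delta_eq_zero_of_flag {B : 𝔤 →ₗ[K] 𝔤 →ₗ[K] K} {N i j k : ℕ}
    (h : ∀ i j k, 1 ≤ i → i ≤ n → 1 ≤ j → j ≤ n → 1 ≤ k → k ≤ n → N ≤ i + j + k →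
      delta B (vec e i) (vec e j) (vec e k) = 0)
    (hijk : N ≤ i + j + k) {x y z : 𝔤} (hx : x ∈ flag e i) (hy : y ∈ flag e j)
    (hz : z ∈ flag e k) : delta B x y z = 0 := by
  have key : ∀ p q r, i ≤ p → j ≤ q → k ≤ r → delta B (vec e p) (vec e q) (vec e r) = 0 := by
    intro p q r hp hq hr
    by_cases h1 : 1 ≤ p ∧ p ≤ n
    · by_cases h2 : 1 ≤ q ∧ q ≤ n
      · by_cases h3 : 1 ≤ r ∧ r ≤ n
        · exact h p q r h1.1 h1.2 h2.1 h2.2 h3.1 h3.2 (by omega)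
        · rw [show vec e r = 0 from dif_neg h3, delta_zero₃]
      · rw [show vec e q = 0 from dif_neg h2, delta_zero₂]
    · rw [vec, dif_neg h1, delta_zero₁]
  have h1 : ∀ q r, j ≤ q → k ≤ r → delta B x (vec e q) (vec e r) = 0 := fun q r hq hr =>
    (flag_le_of e (S := LinearMap.ker (deltaLin B (vec e q) (vec e r)))
      fun p hp => key p q r hp hq hr) hx
  have h2 : ∀ r, k ≤ r → delta B x y (vec e r) = 0 := fun r hr => by
    rw [delta_rotate]
    refine (flag_le_of e (S := LinearMap.ker (deltaLin B (vec e r) x)) fun q hq => ?_) hy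
    change delta B _ _ _ = 0
    rw [← delta_rotate]
    exact h1 q r hq hr
  rw [← delta_rotate]
  refine (flag_le_of e (S := LinearMap.ker (deltaLin B x y)) fun r hr => ?_) hz
  change delta B _ _ _ = 0
  rw [delta_rotate]
  exact h2 r hr

end basis

end Forms

/-- An odd sequence with the recursion of an `ad e₁`-invariant form vanishes as soon as one further
condition holds. -/
lemma eq_zero_of_shift_invariant {K : Type*} [Field K] [CharZero K] {M : ℕ} {f : ℕ → K}
    (hodd : ∀ i, 2 ≤ i → i + 2 ≤ M → f (M - i) = - f i)
    (hrec : ∀ i j, 2 ≤ i → 2 ≤ j → i + j + 1 = M → ((i : K) - 1) * f (i + 1) + (j - 1) * f i = 0)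
    (h : Even M ∨ (∃ i, 2 ≤ i ∧ i + 2 ≤ M ∧ f i = 0) ∨
      ∃ k, 4 ≤ k ∧ Even k ∧ k + 5 = M ∧ f 5 + (k - 3) * f (k + 3) + (2 - k) * f (k + 2) = 0)
    {i : ℕ} (hi : 2 ≤ i) (hiM : i + 2 ≤ M) : f i = 0 := by
  have iff2 : ∀ d, d + 4 ≤ M → (f (d + 2) = 0 ↔ f 2 = 0) := by
    intro d
    induction d with
    | zero => simp
    | succ d ih =>
      intro hd
      rw [← ih (by omega)]
      have hr := hrec (d + 2) (M - 3 - d) (by omega) (by omega) (by omega)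
      have h1 : ((d + 2 : ℕ) : K) - 1 ≠ 0 := by
        push_cast; intro h0
        exact Nat.cast_add_one_ne_zero (R := K) d (by linear_combination h0)
      have h2 : ((M - 3 - d : ℕ) : K) - 1 ≠ 0 := by
        obtain ⟨t, ht⟩ : ∃ t, M - 3 - d = t + 2 := ⟨M - 3 - d - 2, by omega⟩
        rw [ht]
        push_cast; intro h0
        exact Nat.cast_add_one_ne_zero (R := K) t (by linear_combination h0)
      rw [show d + 1 + 2 = d + 2 + 1 by ring]
      constructor
      · intro h0; rw [h0, mul_zero, zero_add] at hr; exact (mul_eq_zero.1 hr).resolve_left h2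
      · intro h0; rw [h0, mul_zero, add_zero] at hr; exact (mul_eq_zero.1 hr).resolve_left h1
  have all : ∀ i, 2 ≤ i → i + 2 ≤ M → (f i = 0 ↔ f 2 = 0) := by
    intro i hi hiM
    have := iff2 (i - 2) (by omega)
    rwa [Nat.sub_add_cancel hi] at this
  rw [all i hi hiM]
  rcases h with h | ⟨i0, h1, h2, h3⟩ | ⟨k, hk, hke, hkM, h⟩
  · obtain ⟨m, hm⟩ := h
    have h0 := hodd m (by omega) (by omega)
    rw [show M - m = m by omega] at h0
    exact (all m (by omega) (by omega)).1 (self_eq_neg.1 h0)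
  · exact (all i0 h1 h2).1 h3
  · have closed : ∀ d, d + 4 ≤ M →
        f (d + 2) * (d.factorial : K) * ((M - 4 - d).factorial : K)
          = (-1) ^ d * (f 2 * ((M - 4).factorial : K)) := by
      intro d
      induction d with
      | zero => simp
      | succ d ih =>
        intro hd
        have h1 := ih (by omega)
        obtain ⟨t, ht⟩ : ∃ t, M - 4 - d = t + 1 := ⟨M - 4 - d - 1, by omega⟩
        have hr := hrec (d + 2) (t + 2) (by omega) (by omega) (by omega)
        rw [show M - 4 - (d + 1) = t by omega, Nat.factorial_succ]
        rw [ht, Nat.factorial_succ] at h1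
        rw [show d + 1 + 2 = d + 2 + 1 by ring, pow_succ]
        push_cast at hr h1 ⊢
        linear_combination (-1) * h1 + (d.factorial : K) * t.factorial * hr
    obtain ⟨m, rfl⟩ := Nat.exists_eq_add_of_le hk
    have c1 := closed 3 (by omega)
    have c2 := closed (m + 5) (by omega)
    have c3 := closed (m + 4) (by omega)
    rw [show M - 4 - 3 = m + 2 by omega, show M - 4 = m + 5 by omega] at c1
    rw [show M - 4 - (m + 5) = 0 by omega, show M - 4 = m + 5 by omega] at c2
    rw [show M - 4 - (m + 4) = 1 by omega, show M - 4 = m + 5 by omega] at c3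
    have hm : Even m := by simpa [Nat.even_add, show Even 4 by decide] using hke
    have p4 : ((-1 : K)) ^ (m + 4) = 1 := (hm.add (by decide)).neg_one_pow
    have p5 : ((-1 : K)) ^ (m + 5) = -1 := by rw [pow_succ, p4]; ring
    rw [p5] at c2
    rw [p4] at c3
    simp only [show 3 + 2 = 5 by rfl, show m + 5 + 2 = 4 + m + 3 by ring,
      show m + 4 + 2 = 4 + m + 2 by ring] at c1 c2 c3
    have f5 : ((m + 5).factorial : K) = (m + 5) * (m + 4) * (m + 3) * (m + 2).factorial := by
      rw [Nat.factorial_succ, Nat.factorial_succ, Nat.factorial_succ]; push_cast; ring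
    have f4 : ((m + 4).factorial : K) = (m + 4) * (m + 3) * (m + 2).factorial := by
      rw [Nat.factorial_succ, Nat.factorial_succ]; push_cast; ring
    have hne : ((m + 2).factorial : K) ≠ 0 := by exact_mod_cast Nat.factorial_ne_zero _
    rw [f5] at c1 c2 c3
    rw [f4] at c3
    simp only [Nat.factorial_zero, Nat.factorial_one, show Nat.factorial 3 = 6 by rfl] at c1 c2 c3
    push_cast at c1 c2 c3
    have hm4 : (m : K) + 4 ≠ 0 := by exact_mod_cast (by omega : m + 4 ≠ 0)
    have hm3 : (m : K) + 3 ≠ 0 := by exact_mod_cast (by omega : m + 3 ≠ 0)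
    have hm5 : (m : K) + 5 ≠ 0 := by exact_mod_cast (by omega : m + 5 ≠ 0)
    have d1 : f 5 * 6 = -(f 2 * ((m + 5) * (m + 4) * (m + 3))) := by
      apply mul_right_cancel₀ hne; linear_combination c1
    have d2 : f (4 + m + 3) = - f 2 := by
      have : (m + 5) * (m + 4) * (m + 3) * ((m + 2).factorial : K) ≠ 0 := by positivity
      apply mul_right_cancel₀ this; linear_combination c2
    have d3 : f (4 + m + 2) = (m + 5) * f 2 := by
      have : (m + 4) * (m + 3) * ((m + 2).factorial : K) ≠ 0 := by positivity
      apply mul_right_cancel₀ this; linear_combination c3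
    push_cast at h
    rw [d2, d3] at h
    have : f 2 * (((m + 5) * (m + 4) * (m + 3) + 6 * (m + 1) + 6 * (m + 2) * (m + 5) : ℕ) : K)
        = 0 := by
      push_cast; linear_combination -6 * h + d1
    exact (mul_eq_zero.1 this).resolve_right (Nat.cast_ne_zero.2 (by positivity))

section Witt

variable {K : Type*} [Field K] {𝔤 : Type*} [LieRing 𝔤] [LieAlgebra K 𝔤] {n : ℕ}

/-- The spans `flag e i` filter the Lie algebra. -/
def LieFlag (e : Module.Basis (Fin n) K 𝔤) : Prop :=
  ∀ i j, 1 ≤ i → 1 ≤ j → ∀ x ∈ flag e i, ∀ y ∈ flag e j, ⁅x, y⁆ ∈ flag e (i + j)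

/-- A sequence adapted to the filtration `flag e`, on which `x₁` acts as in the Witt algebra. -/
structure AdSeq (e : Module.Basis (Fin n) K 𝔤) (x : ℕ → 𝔤) : Prop where
  mem : ∀ i, x i ∈ flag e i
  top : ∀ i, 1 ≤ i → ∀ y ∈ flag e i, ∃ c : K, y - c • x i ∈ flag e (i + 1)
  ad : ∀ i, 2 ≤ i → ⁅x 1, x i⁆ = ((i : K) - 1) • x (i + 1)

/-- The brackets of the `x_i` are those of the Witt algebra, up to terms which are higher by `W`. -/
structure WittSeq (e : Module.Basis (Fin n) K 𝔤) (W : ℕ) (x : ℕ → 𝔤) : Prop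
    extends AdSeq e x where
  err : ∀ i j, 2 ≤ i → 2 ≤ j → ⁅x i, x j⁆ - ((j : K) - i) • x (i + j) ∈ flag e (i + j + W)

/-- `φ` collects the leading coefficients of the brackets of the `x_i`. -/
def IsLead (e : Module.Basis (Fin n) K 𝔤) (x : ℕ → 𝔤) (φ : ℕ → ℕ → K) : Prop :=
  ∀ i j, 2 ≤ i → 2 ≤ j → ⁅x i, x j⁆ - φ i j • x (i + j) ∈ flag e (i + j + 1)

/-- `φ` collects the coefficients of the deviation from the Witt algebra in degree `w`. -/
def IsSymb (e : Module.Basis (Fin n) K 𝔤) (w : ℕ) (x : ℕ → 𝔤) (φ : ℕ → ℕ → K) : Prop :=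
  ∀ i j, 2 ≤ i → 2 ≤ j →
    ⁅x i, x j⁆ - ((j : K) - i) • x (i + j) - φ i j • x (i + j + w) ∈ flag e (i + j + w + 1)

lemma mkQ_eq_iff {S : Submodule K 𝔤} {x y : 𝔤} : S.mkQ x = S.mkQ y ↔ x - y ∈ S := by
  rw [Submodule.mkQ_apply, Submodule.mkQ_apply, Submodule.Quotient.eq]

lemma mkQ_eq_zero_iff {S : Submodule K 𝔤} {x : 𝔤} : S.mkQ x = 0 ↔ x ∈ S := by
  rw [Submodule.mkQ_apply, Submodule.Quotient.mk_eq_zero]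

lemma lie_jacobi' (x y z : 𝔤) : ⁅⁅x, y⁆, z⁆ + ⁅⁅y, z⁆, x⁆ + ⁅⁅z, x⁆, y⁆ = 0 := by
  have := lie_jacobi x y z
  rw [← lie_skew ⁅x, y⁆, ← lie_skew ⁅y, z⁆, ← lie_skew ⁅z, x⁆, ← neg_eq_zero, ← this]
  abel

variable {e : Module.Basis (Fin n) K 𝔤} {x : ℕ → 𝔤} {w : ℕ} {φ : ℕ → ℕ → K}

namespace AdSeq

lemma eq_zero_of_lt (hx : AdSeq e x) {i : ℕ} (h : n < i) : x i = 0 :=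
  eq_zero_of_mem_flag e h (hx.mem i)

lemma mem_of_le (hx : AdSeq e x) {i j : ℕ} (h : i ≤ j) : x j ∈ flag e i :=
  flag_anti e h (hx.mem j)

lemma notMem (hx : AdSeq e x) {m : ℕ} (h1 : 1 ≤ m) (hm : m ≤ n) : x m ∉ flag e (m + 1) := by
  intro h
  obtain ⟨c, hc⟩ := hx.top m h1 _ (vec_mem_flag e le_rfl)
  have h2 : vec e m ∈ flag e (m + 1) := by
    have := add_mem hc (Submodule.smul_mem _ c h)
    simpa using this
  have h3 := coord_eq_zero_of_mem_flag e (Nat.lt_succ_self m) h2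
  rw [coord_vec e h1 hm, if_pos rfl] at h3
  exact one_ne_zero h3

lemma coeff_eq_zero (hx : AdSeq e x) {m : ℕ} (h1 : 1 ≤ m) (hm : m ≤ n) {c : K}
    (h : c • x m ∈ flag e (m + 1)) : c = 0 := by
  by_contra hc
  exact hx.notMem h1 hm ((Submodule.smul_mem_iff _ hc).1 h)

lemma exists_lead (hx : AdSeq e x) (hF : LieFlag e) : ∃ φ, IsLead e x φ := by
  have : ∀ i j, ∃ c : K, 2 ≤ i → 2 ≤ j → ⁅x i, x j⁆ - c • x (i + j) ∈ flag e (i + j + 1) := by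
    intro i j
    by_cases h : 2 ≤ i ∧ 2 ≤ j
    · obtain ⟨c, hc⟩ := hx.top (i + j) (by omega) _
        (hF i j (by omega) (by omega) _ (hx.mem i) _ (hx.mem j))
      exact ⟨c, fun _ _ => hc⟩
    · exact ⟨0, fun h1 h2 => absurd ⟨h1, h2⟩ h⟩
  choose φ hφ using this
  exact ⟨φ, hφ⟩

end AdSeq

lemma WittSeq.exists_symb (hx : WittSeq e w x) : ∃ φ, IsSymb e w x φ := by
  have : ∀ i j, ∃ c : K, 2 ≤ i → 2 ≤ j →
      ⁅x i, x j⁆ - ((j : K) - i) • x (i + j) - c • x (i + j + w) ∈ flag e (i + j + w + 1) := by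
    intro i j
    by_cases h : 2 ≤ i ∧ 2 ≤ j
    · obtain ⟨c, hc⟩ := hx.top (i + j + w) (by omega) _ (hx.err i j h.1 h.2)
      exact ⟨c, fun _ _ => hc⟩
    · exact ⟨0, fun h1 h2 => absurd ⟨h1, h2⟩ h⟩
  choose φ hφ using this
  exact ⟨φ, hφ⟩

namespace IsLead

variable (hφ : IsLead e x φ) (hx : AdSeq e x) (hF : LieFlag e)
include hφ hx

omit hx in
lemma mkQ {i j m : ℕ} (hi : 2 ≤ i) (hj : 2 ≤ j) (hm : i + j = m) :
    (flag e (m + 1)).mkQ ⁅x i, x j⁆ = φ i j • (flag e (m + 1)).mkQ (x m) := by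
  subst hm
  rw [← map_smul, mkQ_eq_iff]
  exact hφ i j hi hj

lemma skew {i j : ℕ} (hi : 2 ≤ i) (hj : 2 ≤ j) (hn : i + j ≤ n) : φ j i = - φ i j := by
  have h1 := hφ.mkQ hi hj rfl
  have h2 := hφ.mkQ hj hi (add_comm j i)
  rw [← lie_skew, map_neg] at h2
  have : φ j i + φ i j = 0 := by
    apply hx.coeff_eq_zero (m := i + j) (by omega) hn
    rw [← mkQ_eq_zero_iff, map_smul]
    linear_combination (norm := module) - h1 - h2
  linear_combination this

include hF in
lemma shift {i j : ℕ} (hi : 2 ≤ i) (hj : 2 ≤ j) (hn : i + j + 1 ≤ n) :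
    ((i : K) - 1) * φ (i + 1) j + (j - 1) * φ i (j + 1) = (i + j - 1) * φ i j := by
  have h1 := hφ.mkQ (i := i + 1) (m := i + j + 1) (by omega) hj (by omega)
  have h2 := hφ.mkQ (j := j + 1) (m := i + j + 1) hi (by omega) (by omega)
  have h3 : (flag e (i + j + 1 + 1)).mkQ ⁅x 1, ⁅x i, x j⁆⁆
      = (φ i j * (i + j - 1)) • (flag e (i + j + 1 + 1)).mkQ (x (i + j + 1)) := by
    rw [← map_smul, mkQ_eq_iff]
    have := hF 1 (i + j + 1) le_rfl (by omega) _ (hx.mem 1) _ (hφ i j hi hj)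
    rw [lie_sub, lie_smul, hx.ad _ (by omega), smul_smul] at this
    push_cast at this
    convert this using 2
    ring
  have h4 : ⁅x 1, ⁅x i, x j⁆⁆ = ((i : K) - 1) • ⁅x (i + 1), x j⁆ + ((j : K) - 1) • ⁅x i, x (j + 1)⁆ := by
    rw [leibniz_lie, hx.ad i hi, hx.ad j hj, smul_lie, lie_smul]
  rw [h4, map_add, map_smul, map_smul, h1, h2] at h3
  rw [← sub_eq_zero]
  apply hx.coeff_eq_zero (m := i + j + 1) (by omega) hn
  rw [← mkQ_eq_zero_iff, map_smul]
  linear_combination (norm := module) h3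

include hF in
lemma mkQ_lie_lie {i j k m : ℕ} (hi : 2 ≤ i) (hj : 2 ≤ j) (hk : 2 ≤ k) (hm : i + j + k = m) :
    (flag e (m + 1)).mkQ ⁅⁅x i, x j⁆, x k⁆
      = (φ i j * φ (i + j) k) • (flag e (m + 1)).mkQ (x m) := by
  have h1 := hφ.mkQ (i := i + j) (by omega) hk hm
  have h2 := hF (i + j + 1) k (by omega) (by omega) _ (hφ i j hi hj) _ (hx.mem k)
  rw [show i + j + 1 + k = m + 1 by omega, sub_lie, ← mkQ_eq_iff, smul_lie, map_smul, h1,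
    smul_smul] at h2
  exact h2

include hF in
lemma jacobi {i j k : ℕ} (hi : 2 ≤ i) (hj : 2 ≤ j) (hk : 2 ≤ k) (hn : i + j + k ≤ n) :
    φ i j * φ (i + j) k + φ j k * φ (j + k) i + φ k i * φ (k + i) j = 0 := by
  apply hx.coeff_eq_zero (m := i + j + k) (by omega) hn
  rw [← mkQ_eq_zero_iff, map_smul, add_smul, add_smul, ← hφ.mkQ_lie_lie hx hF hi hj hk rfl,
    ← hφ.mkQ_lie_lie hx hF hj hk hi (by omega), ← hφ.mkQ_lie_lie hx hF hk hi hj (by omega),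
    ← map_add, ← map_add, lie_jacobi', map_zero]

end IsLead

namespace IsSymb

variable (hφ : IsSymb e w x φ) (hx : AdSeq e x) (hF : LieFlag e)
include hφ hx

omit hx in
lemma mkQ {i j m : ℕ} (hi : 2 ≤ i) (hj : 2 ≤ j) (hm : i + j = m) :
    (flag e (m + w + 1)).mkQ ⁅x i, x j⁆ = ((j : K) - i) • (flag e (m + w + 1)).mkQ (x m)
      + φ i j • (flag e (m + w + 1)).mkQ (x (m + w)) := by
  subst hm
  rw [← map_smul, ← map_smul, ← map_add, mkQ_eq_iff, ← sub_sub]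
  exact hφ i j hi hj

lemma skew {i j : ℕ} (hi : 2 ≤ i) (hj : 2 ≤ j) (hn : i + j + w ≤ n) : φ j i = - φ i j := by
  have h1 := hφ.mkQ hi hj rfl
  have h2 := hφ.mkQ hj hi (add_comm j i)
  rw [← lie_skew, map_neg] at h2
  have : φ j i + φ i j = 0 := by
    apply hx.coeff_eq_zero (m := i + j + w) (by omega) hn
    rw [← mkQ_eq_zero_iff, map_smul]
    linear_combination (norm := module) - h1 - h2
  linear_combination this

include hF in
lemma shift {i j : ℕ} (hi : 2 ≤ i) (hj : 2 ≤ j) (hn : i + j + 1 + w ≤ n) :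
    ((i : K) - 1) * φ (i + 1) j + (j - 1) * φ i (j + 1) = (i + j + w - 1) * φ i j := by
  have h1 := hφ.mkQ (i := i + 1) (m := i + j + 1) (by omega) hj (by omega)
  have h2 := hφ.mkQ (j := j + 1) (m := i + j + 1) hi (by omega) (by omega)
  have h3 : (flag e (i + j + 1 + w + 1)).mkQ ⁅x 1, ⁅x i, x j⁆⁆
      = (((j : K) - i) * (i + j - 1)) • (flag e (i + j + 1 + w + 1)).mkQ (x (i + j + 1))
        + (φ i j * (i + j + w - 1)) • (flag e (i + j + 1 + w + 1)).mkQ (x (i + j + 1 + w)) := by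
    rw [← map_smul, ← map_smul, ← map_add, mkQ_eq_iff]
    have := hF 1 (i + j + w + 1) le_rfl (by omega) _ (hx.mem 1) _ (hφ i j hi hj)
    rw [lie_sub, lie_sub, lie_smul, lie_smul, hx.ad _ (by omega), hx.ad _ (by omega), smul_smul,
      smul_smul, sub_sub] at this
    push_cast at this
    rw [show i + j + 1 + w = i + j + w + 1 by ring, show i + j + w + 1 + 1 = 1 + (i + j + w + 1) by ring]
    rw [show 1 + (i + j + w + 1) = i + j + w + 1 + 1 by ring] at this ⊢
    exact this
  have h4 : ⁅x 1, ⁅x i, x j⁆⁆ = ((i : K) - 1) • ⁅x (i + 1), x j⁆ + ((j : K) - 1) • ⁅x i, x (j + 1)⁆ := by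
    rw [leibniz_lie, hx.ad i hi, hx.ad j hj, smul_lie, lie_smul]
  rw [h4, map_add, map_smul, map_smul, h1, h2] at h3
  rw [← sub_eq_zero]
  apply hx.coeff_eq_zero (m := i + j + 1 + w) (by omega) hn
  rw [← mkQ_eq_zero_iff, map_smul]
  push_cast at h3
  linear_combination (norm := module) h3

include hF in
lemma mkQ_lie_lie (hw : 1 ≤ w) {i j k m : ℕ} (hi : 2 ≤ i) (hj : 2 ≤ j) (hk : 2 ≤ k)
    (hm : i + j + k = m) :
    (flag e (m + w + 1)).mkQ ⁅⁅x i, x j⁆, x k⁆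
      = (((j : K) - i) * (k - (i + j))) • (flag e (m + w + 1)).mkQ (x m) +
        (((j : K) - i) * φ (i + j) k + φ i j * (k - (i + j + w))) •
          (flag e (m + w + 1)).mkQ (x (m + w)) := by
  have h1 := hφ.mkQ (i := i + j) (by omega) hk hm
  have h2 := hF (i + j + w + 1) k (by omega) (by omega) _ (hφ i j hi hj) _ (hx.mem k)
  have h3 : (flag e (m + w + 1)).mkQ ⁅x (i + j + w), x k⁆
      = ((k : K) - (i + j + w)) • (flag e (m + w + 1)).mkQ (x (m + w)) := by
    have h4 := hφ (i + j + w) k (by omega) hk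
    rw [show i + j + w + k = m + w by omega] at h4
    have h5 : φ (i + j + w) k • x (m + w + w) ∈ flag e (m + w + 1) :=
      Submodule.smul_mem _ _ (hx.mem_of_le (by omega))
    rw [← map_smul, mkQ_eq_iff]
    have h6 := add_mem (flag_anti e (show m + w + 1 ≤ m + w + w + 1 by omega) h4) h5
    push_cast at h6
    simpa using h6
  rw [show i + j + w + 1 + k = m + w + 1 by omega, sub_lie, sub_lie, sub_sub, ← mkQ_eq_iff,
    smul_lie, smul_lie, map_add, map_smul, map_smul, h1, h3] at h2
  rw [h2]
  push_cast
  module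

include hF in
lemma jacobi (hw : 1 ≤ w) {i j k : ℕ} (hi : 2 ≤ i) (hj : 2 ≤ j) (hk : 2 ≤ k)
    (hn : i + j + k + w ≤ n) :
    ((j : K) - i) * φ (i + j) k + φ i j * (k - (i + j + w)) +
      (((k : K) - j) * φ (j + k) i + φ j k * (i - (j + k + w))) +
      (((i : K) - k) * φ (k + i) j + φ k i * (j - (k + i + w))) = 0 := by
  apply hx.coeff_eq_zero (m := i + j + k + w) (by omega) hn
  rw [← mkQ_eq_zero_iff, map_smul]
  have h1 := hφ.mkQ_lie_lie hx hF hw hi hj hk rfl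
  have h2 := hφ.mkQ_lie_lie hx hF hw hj hk hi (m := i + j + k) (by omega)
  have h3 := hφ.mkQ_lie_lie hx hF hw hk hi hj (m := i + j + k) (by omega)
  have h4 := congrArg (flag e (i + j + k + w + 1)).mkQ (lie_jacobi' (x i) (x j) (x k))
  rw [map_add, map_add, map_zero] at h4
  linear_combination (norm := module) h4 - h1 - h2 - h3

end IsSymb

/-- A cochain with the symmetries of the degree `w` part of a bracket vanishes as soon as it vanishes
in the two degrees of `H²`. -/
lemma eq_zero_of_cocycle [CharZero K] {ψ : ℕ → ℕ → K} {N : ℕ} (c : ℕ → ℕ → K)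
    (hskew : ∀ i j, 2 ≤ i → 2 ≤ j → i + j ≤ N → ψ j i = - ψ i j)
    (hshift : ∀ i j, 2 ≤ i → 2 ≤ j → i + j + 1 ≤ N →
      ((i : K) - 1) * ψ (i + 1) j + (j - 1) * ψ i (j + 1) = c i j * ψ i j)
    (hjac : ∀ k, 4 ≤ k → Even k → k + 5 ≤ N →
      (∀ i j, 2 ≤ i → 2 ≤ j → i + j < k + 5 → ψ i j = 0) →
      ψ 5 k + (k - 3) * ψ (k + 3) 2 + (2 - k) * ψ (k + 2) 3 = 0)
    (h23 : ψ 2 3 = 0) (h34 : ψ 3 4 = 0) {i j : ℕ} (hi : 2 ≤ i) (hj : 2 ≤ j) (hN : i + j ≤ N) :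
    ψ i j = 0 := by
  suffices H : ∀ M, M ≤ N → ∀ i j, 2 ≤ i → 2 ≤ j → i + j = M → ψ i j = 0 from
    H _ hN i j hi hj rfl
  intro M
  induction M using Nat.strong_induction_on with
  | _ M ih =>
    intro hM i j hi hj hij
    have low : ∀ i j, 2 ≤ i → 2 ≤ j → i + j < M → ψ i j = 0 := fun i j h1 h2 h3 =>
      ih _ h3 (by omega) i j h1 h2 rfl
    have := eq_zero_of_shift_invariant (M := M) (f := fun i => ψ i (M - i)) (i := i) ?_ ?_ ?_ hi
      (by omega)
    · simpa [show M - i = j by omega] using this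
    · intro p h1 h2
      rw [show M - (M - p) = p by omega]
      exact hskew p (M - p) h1 (by omega) (by omega)
    · intro p q h1 h2 h3
      rw [show M - (p + 1) = q by omega, show M - p = q + 1 by omega,
        hshift p q h1 h2 (by omega), low p q h1 h2 (by omega), mul_zero]
    · rcases Nat.even_or_odd M with h | h
      · exact Or.inl h
      · right
        obtain ⟨t, ht⟩ := h
        rcases lt_or_ge M 9 with h9 | h9
        · left
          rcases (show M = 5 ∨ M = 7 by omega) with rfl | rfl
          · exact ⟨2, by norm_num, by norm_num, h23⟩
          · exact ⟨3, by norm_num, by norm_num, h34⟩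
        · right
          refine ⟨M - 5, by omega, ⟨t - 2, by omega⟩, by omega, ?_⟩
          have := hjac (M - 5) (by omega) ⟨t - 2, by omega⟩ (by omega)
            (fun i j h1 h2 h3 => low i j h1 h2 (by omega))
          simpa [show M - (M - 5 + 3) = 2 by omega, show M - (M - 5 + 2) = 3 by omega] using this

end Witt

section Coefficients

variable {K : Type*} [Field K] [CharZero K] {φ : ℕ → ℕ → K}

/-- The leading coefficients of a graded filiform Lie algebra with the two structure constants
`1` and `φ 3 4 ≠ 0` are those of the Witt algebra. -/
lemma lead_coeff (hk : ∀ i j : ℕ, 2 ≤ i → 2 ≤ j → i + j ≤ 12 → φ j i = - φ i j)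
    (hs : ∀ i j : ℕ, 2 ≤ i → 2 ≤ j → i + j + 1 ≤ 12 →
      ((i : K) - 1) * φ (i + 1) j + (j - 1) * φ i (j + 1) = (i + j - 1) * φ i j)
    (hj : ∀ i j k : ℕ, 2 ≤ i → 2 ≤ j → 2 ≤ k → i + j + k ≤ 12 →
      φ i j * φ (i + j) k + φ j k * φ (j + k) i + φ k i * φ (k + i) j = 0)
    (h23 : φ 2 3 = 1) (h34 : φ 3 4 ≠ 0) : φ 3 4 = 1 := by
  have z3 : φ 3 3 = 0 := self_eq_neg.1 (hk 3 3 (by norm_num) (by norm_num) (by norm_num))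
  have z4 : φ 4 4 = 0 := self_eq_neg.1 (hk 4 4 (by norm_num) (by norm_num) (by norm_num))
  have z5 : φ 5 5 = 0 := self_eq_neg.1 (hk 5 5 (by norm_num) (by norm_num) (by norm_num))
  have z6 : φ 6 6 = 0 := self_eq_neg.1 (hk 6 6 (by norm_num) (by norm_num) (by norm_num))
  have h2_4 : φ 2 4 = 2 := by
    linear_combination (hs 2 3 (by norm_num) (by norm_num) (by norm_num) + (4) * h23 - 1 * z3) / 2
  have h2_5 : φ 2 5 = 10/3 - 1/3 * φ 3 4 := by
    linear_combination (hs 2 4 (by norm_num) (by norm_num) (by norm_num) + (5) * h2_4) / 3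
  have h3_5 : φ 3 5 = 2 * φ 3 4 := by
    linear_combination (hs 3 4 (by norm_num) (by norm_num) (by norm_num) - 2 * z4) / 3
  have h2_6 : φ 2 6 = 5 - φ 3 4 := by
    linear_combination (hs 2 5 (by norm_num) (by norm_num) (by norm_num) + (6) * h2_5 - 1 * h3_5) / 4
  have h3_6 : φ 3 6 = 7/2 * φ 3 4 - 1/2 * φ 4 5 := by
    linear_combination (hs 3 5 (by norm_num) (by norm_num) (by norm_num) + (7) * h3_5) / 4
  have h2_7 : φ 2 7 = 7 - 21/10 * φ 3 4 + 1/10 * φ 4 5 := by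
    linear_combination (hs 2 6 (by norm_num) (by norm_num) (by norm_num) + (7) * h2_6 - 1 * h3_6) / 5
  have h4_6 : φ 4 6 = 2 * φ 4 5 := by
    linear_combination (hs 4 5 (by norm_num) (by norm_num) (by norm_num) - 3 * z5) / 4
  have h3_7 : φ 3 7 = 28/5 * φ 3 4 - 8/5 * φ 4 5 := by
    linear_combination (hs 3 6 (by norm_num) (by norm_num) (by norm_num) + (8) * h3_6 - 2 * h4_6) / 5
  have h2_8 : φ 2 8 = 28/3 - 56/15 * φ 3 4 + 2/5 * φ 4 5 := by
    linear_combination (hs 2 7 (by norm_num) (by norm_num) (by norm_num) + (8) * h2_7 - 1 * h3_7) / 6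
  have h4_7 : φ 4 7 = 18/5 * φ 4 5 - 3/5 * φ 5 6 := by
    linear_combination (hs 4 6 (by norm_num) (by norm_num) (by norm_num) + (9) * h4_6) / 5
  have h3_8 : φ 3 8 = 42/5 * φ 3 4 - 18/5 * φ 4 5 + 1/5 * φ 5 6 := by
    linear_combination (hs 3 7 (by norm_num) (by norm_num) (by norm_num) + (9) * h3_7 - 2 * h4_7) / 6
  have h2_9 : φ 2 9 = 12 - 6 * φ 3 4 + 36/35 * φ 4 5 - 1/35 * φ 5 6 := by
    linear_combination (hs 2 8 (by norm_num) (by norm_num) (by norm_num) + (9) * h2_8 - 1 * h3_8) / 7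
  have h5_7 : φ 5 7 = 2 * φ 5 6 := by
    linear_combination (hs 5 6 (by norm_num) (by norm_num) (by norm_num) - 4 * z6) / 5
  have h4_8 : φ 4 8 = 6 * φ 4 5 - 2 * φ 5 6 := by
    linear_combination (hs 4 7 (by norm_num) (by norm_num) (by norm_num) + (10) * h4_7 - 3 * h5_7) / 6
  have h3_9 : φ 3 9 = 12 * φ 3 4 - 48/7 * φ 4 5 + 6/7 * φ 5 6 := by
    linear_combination (hs 3 8 (by norm_num) (by norm_num) (by norm_num) + (10) * h3_8 - 2 * h4_8) / 7
  have h2_10 : φ 2 10 = 15 - 9 * φ 3 4 + 15/7 * φ 4 5 - 1/7 * φ 5 6 := by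
    linear_combination (hs 2 9 (by norm_num) (by norm_num) (by norm_num) + (10) * h2_9 - 1 * h3_9) / 8
  have j1 := hj 2 3 4 (by norm_num) (by norm_num) (by norm_num) (by norm_num)
  rw [hk 4 5 (by norm_num) (by norm_num) (by norm_num),
    hk 2 7 (by norm_num) (by norm_num) (by norm_num),
    hk 3 6 (by norm_num) (by norm_num) (by norm_num),
    hk 2 4 (by norm_num) (by norm_num) (by norm_num),
    h2_7, h3_6, h23, h2_4] at j1
  have j2 := hj 2 3 6 (by norm_num) (by norm_num) (by norm_num) (by norm_num)
  rw [hk 2 9 (by norm_num) (by norm_num) (by norm_num),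
    hk 3 8 (by norm_num) (by norm_num) (by norm_num),
    hk 2 6 (by norm_num) (by norm_num) (by norm_num),
    h2_9, h3_8, h23, h3_6, h2_6] at j2
  have j3 := hj 3 4 5 (by norm_num) (by norm_num) (by norm_num) (by norm_num)
  rw [hk 5 7 (by norm_num) (by norm_num) (by norm_num),
    hk 3 9 (by norm_num) (by norm_num) (by norm_num),
    hk 4 8 (by norm_num) (by norm_num) (by norm_num),
    hk 3 5 (by norm_num) (by norm_num) (by norm_num),
    h5_7, h3_9, h4_8, h3_5] at j3
  generalize φ 3 4 = b at *
  generalize φ 4 5 = u at *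
  generalize φ 5 6 = v at *
  have e1 : u * (b + 20) = 21 * b ^ 2 := by linear_combination -10 * j1
  have e3 : v * (7 * b + u) = 8 * u ^ 2 := by linear_combination -(7 / 6) * j3
  have e2 : 5 * v = u * (6 * b - u) := by
    linear_combination (1 / 28) * (70 * j2 + e3 + 42 * e1)
  have hu : u ≠ 0 := by
    rintro rfl
    exact h34 (by simpa using e1)
  have e4 : (6 * b - u) * (7 * b + u) = 40 * u := by
    apply mul_left_cancel₀ hu
    linear_combination 5 * e3 - (7 * b + u) * e2
  have e5 : u = b := by
    apply mul_left_cancel₀ hu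
    linear_combination -e4 - 2 * e1
  subst e5
  apply mul_left_cancel₀ hu
  linear_combination -(1 / 20) * e1

lemma symb_coeff {w : K} (hk : ∀ i j : ℕ, 2 ≤ i → 2 ≤ j → i + j ≤ 12 → φ j i = - φ i j)
    (hs : ∀ i j : ℕ, 2 ≤ i → 2 ≤ j → i + j + 1 ≤ 12 →
      ((i : K) - 1) * φ (i + 1) j + (j - 1) * φ i (j + 1) = (i + j + w - 1) * φ i j)
    (hj : ∀ i j k : ℕ, 2 ≤ i → 2 ≤ j → 2 ≤ k → i + j + k ≤ 12 →
      ((j : K) - i) * φ (i + j) k + φ i j * (k - (i + j + w)) +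
      (((k : K) - j) * φ (j + k) i + φ j k * (i - (j + k + w))) +
      (((i : K) - k) * φ (k + i) j + φ k i * (j - (k + i + w))) = 0)
    (h23 : φ 2 3 = 0) : (w - 1) * (w ^ 4 + 11 * w ^ 3 + 64 * w ^ 2 + 108 * w + 288) * φ 3 4 = 0 := by
  have z3 : φ 3 3 = 0 := self_eq_neg.1 (hk 3 3 (by norm_num) (by norm_num) (by norm_num))
  have z4 : φ 4 4 = 0 := self_eq_neg.1 (hk 4 4 (by norm_num) (by norm_num) (by norm_num))
  have z5 : φ 5 5 = 0 := self_eq_neg.1 (hk 5 5 (by norm_num) (by norm_num) (by norm_num))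
  have z6 : φ 6 6 = 0 := self_eq_neg.1 (hk 6 6 (by norm_num) (by norm_num) (by norm_num))
  have h2_4 : φ 2 4 = 0 := by
    linear_combination (hs 2 3 (by norm_num) (by norm_num) (by norm_num) + (4 + w) * h23 - 1 * z3) / 2
  have h2_5 : φ 2 5 = -1/3 * φ 3 4 := by
    linear_combination (hs 2 4 (by norm_num) (by norm_num) (by norm_num) + (5 + w) * h2_4) / 3
  have h3_5 : φ 3 5 = 2 * φ 3 4 + 1/3 * φ 3 4 * w := by
    linear_combination (hs 3 4 (by norm_num) (by norm_num) (by norm_num) - 2 * z4) / 3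
  have h2_6 : φ 2 6 = -φ 3 4 - 1/6 * φ 3 4 * w := by
    linear_combination (hs 2 5 (by norm_num) (by norm_num) (by norm_num) + (6 + w) * h2_5 - 1 * h3_5) / 4
  have h3_6 : φ 3 6 = 7/2 * φ 3 4 + 13/12 * φ 3 4 * w + 1/12 * φ 3 4 * w ^ 2 - 1/2 * φ 4 5 := by
    linear_combination (hs 3 5 (by norm_num) (by norm_num) (by norm_num) + (7 + w) * h3_5) / 4
  have h2_7 : φ 2 7 = -21/10 * φ 3 4 - 13/20 * φ 3 4 * w - 1/20 * φ 3 4 * w ^ 2 + 1/10 * φ 4 5 := by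
    linear_combination (hs 2 6 (by norm_num) (by norm_num) (by norm_num) + (7 + w) * h2_6 - 1 * h3_6) / 5
  have h4_6 : φ 4 6 = 2 * φ 4 5 + 1/4 * φ 4 5 * w := by
    linear_combination (hs 4 5 (by norm_num) (by norm_num) (by norm_num) - 3 * z5) / 4
  have h3_7 : φ 3 7 = 28/5 * φ 3 4 + 73/30 * φ 3 4 * w + 7/20 * φ 3 4 * w ^ 2 + 1/60 * φ 3 4 * w ^ 3 - 8/5 * φ 4 5 - 1/5 * φ 4 5 * w := by
    linear_combination (hs 3 6 (by norm_num) (by norm_num) (by norm_num) + (8 + w) * h3_6 - 2 * h4_6) / 5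
  have h2_8 : φ 2 8 = -56/15 * φ 3 4 - 73/45 * φ 3 4 * w - 7/30 * φ 3 4 * w ^ 2 - 1/90 * φ 3 4 * w ^ 3 + 2/5 * φ 4 5 + 1/20 * φ 4 5 * w := by
    linear_combination (hs 2 7 (by norm_num) (by norm_num) (by norm_num) + (8 + w) * h2_7 - 1 * h3_7) / 6
  have h4_7 : φ 4 7 = 18/5 * φ 4 5 + 17/20 * φ 4 5 * w + 1/20 * φ 4 5 * w ^ 2 - 3/5 * φ 5 6 := by
    linear_combination (hs 4 6 (by norm_num) (by norm_num) (by norm_num) + (9 + w) * h4_6) / 5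
  have h3_8 : φ 3 8 = 42/5 * φ 3 4 + 55/12 * φ 3 4 * w + 67/72 * φ 3 4 * w ^ 2 + 1/12 * φ 3 4 * w ^ 3 + 1/360 * φ 3 4 * w ^ 4 - 18/5 * φ 4 5 - 17/20 * φ 4 5 * w - 1/20 * φ 4 5 * w ^ 2 + 1/5 * φ 5 6 := by
    linear_combination (hs 3 7 (by norm_num) (by norm_num) (by norm_num) + (9 + w) * h3_7 - 2 * h4_7) / 6
  have h2_9 : φ 2 9 = -6 * φ 3 4 - 275/84 * φ 3 4 * w - 335/504 * φ 3 4 * w ^ 2 - 5/84 * φ 3 4 * w ^ 3 - 1/504 * φ 3 4 * w ^ 4 + 36/35 * φ 4 5 + 17/70 * φ 4 5 * w + 1/70 * φ 4 5 * w ^ 2 - 1/35 * φ 5 6 := by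
    linear_combination (hs 2 8 (by norm_num) (by norm_num) (by norm_num) + (9 + w) * h2_8 - 1 * h3_8) / 7
  have h5_7 : φ 5 7 = 2 * φ 5 6 + 1/5 * φ 5 6 * w := by
    linear_combination (hs 5 6 (by norm_num) (by norm_num) (by norm_num) - 4 * z6) / 5
  have h4_8 : φ 4 8 = 6 * φ 4 5 + 121/60 * φ 4 5 * w + 9/40 * φ 4 5 * w ^ 2 + 1/120 * φ 4 5 * w ^ 3 - 2 * φ 5 6 - 1/5 * φ 5 6 * w := by
    linear_combination (hs 4 7 (by norm_num) (by norm_num) (by norm_num) + (10 + w) * h4_7 - 3 * h5_7) / 6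
  have h3_9 : φ 3 9 = 12 * φ 3 4 + 1627/210 * φ 3 4 * w + 125/63 * φ 3 4 * w ^ 2 + 127/504 * φ 3 4 * w ^ 3 + 1/63 * φ 3 4 * w ^ 4 + 1/2520 * φ 3 4 * w ^ 5 - 48/7 * φ 4 5 - 242/105 * φ 4 5 * w - 9/35 * φ 4 5 * w ^ 2 - 1/105 * φ 4 5 * w ^ 3 + 6/7 * φ 5 6 + 3/35 * φ 5 6 * w := by
    linear_combination (hs 3 8 (by norm_num) (by norm_num) (by norm_num) + (10 + w) * h3_8 - 2 * h4_8) / 7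
  have h2_10 : φ 2 10 = -9 * φ 3 4 - 1627/280 * φ 3 4 * w - 125/84 * φ 3 4 * w ^ 2 - 127/672 * φ 3 4 * w ^ 3 - 1/84 * φ 3 4 * w ^ 4 - 1/3360 * φ 3 4 * w ^ 5 + 15/7 * φ 4 5 + 121/168 * φ 4 5 * w + 9/112 * φ 4 5 * w ^ 2 + 1/336 * φ 4 5 * w ^ 3 - 1/7 * φ 5 6 - 1/70 * φ 5 6 * w := by
    linear_combination (hs 2 9 (by norm_num) (by norm_num) (by norm_num) + (10 + w) * h2_9 - 1 * h3_9) / 8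
  have j1 := hj 2 3 4 (by norm_num) (by norm_num) (by norm_num) (by norm_num)
  rw [hk 4 5 (by norm_num) (by norm_num) (by norm_num),
    hk 2 7 (by norm_num) (by norm_num) (by norm_num),
    hk 3 6 (by norm_num) (by norm_num) (by norm_num),
    hk 2 4 (by norm_num) (by norm_num) (by norm_num),
    h2_7, h3_6, h23, h2_4] at j1
  have j2 := hj 2 3 6 (by norm_num) (by norm_num) (by norm_num) (by norm_num)
  rw [hk 2 9 (by norm_num) (by norm_num) (by norm_num),
    hk 3 8 (by norm_num) (by norm_num) (by norm_num),
    hk 2 6 (by norm_num) (by norm_num) (by norm_num),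
    h2_9, h3_8, h23, h3_6, h2_6] at j2
  have j3 := hj 3 4 5 (by norm_num) (by norm_num) (by norm_num) (by norm_num)
  rw [hk 5 7 (by norm_num) (by norm_num) (by norm_num),
    hk 3 9 (by norm_num) (by norm_num) (by norm_num),
    hk 4 8 (by norm_num) (by norm_num) (by norm_num),
    hk 3 5 (by norm_num) (by norm_num) (by norm_num),
    h5_7, h3_9, h4_8, h3_5] at j3
  linear_combination 420 * ((-21 / 10) * (66 / 35) * j3 + (24 / 35) * (w + 10) * (-21 / 10) * j2
    - ((5400 + 2242 * w + 297 * w ^ 2 + 11 * w ^ 3) / 420 * (66 / 35)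
      - (24 / 35) * (w + 10) * (979 + 254 * w + 17 * w ^ 2) / 70) * j1)

lemma symb_coeff_one {w : K} (hw : w = 1) (hk : ∀ i j : ℕ, 2 ≤ i → 2 ≤ j → i + j ≤ 15 → φ j i = - φ i j)
    (hs : ∀ i j : ℕ, 2 ≤ i → 2 ≤ j → i + j + 1 ≤ 15 →
      ((i : K) - 1) * φ (i + 1) j + (j - 1) * φ i (j + 1) = (i + j + w - 1) * φ i j)
    (hj : ∀ i j k : ℕ, 2 ≤ i → 2 ≤ j → 2 ≤ k → i + j + k ≤ 15 →
      ((j : K) - i) * φ (i + j) k + φ i j * (k - (i + j + w)) +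
      (((k : K) - j) * φ (j + k) i + φ j k * (i - (j + k + w))) +
      (((i : K) - k) * φ (k + i) j + φ k i * (j - (k + i + w))) = 0)
    (h23 : φ 2 3 = 0) : φ 3 4 = 0 := by
  subst hw
  have z3 : φ 3 3 = 0 := self_eq_neg.1 (hk 3 3 (by norm_num) (by norm_num) (by norm_num))
  have z4 : φ 4 4 = 0 := self_eq_neg.1 (hk 4 4 (by norm_num) (by norm_num) (by norm_num))
  have z5 : φ 5 5 = 0 := self_eq_neg.1 (hk 5 5 (by norm_num) (by norm_num) (by norm_num))
  have z6 : φ 6 6 = 0 := self_eq_neg.1 (hk 6 6 (by norm_num) (by norm_num) (by norm_num))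
  have z7 : φ 7 7 = 0 := self_eq_neg.1 (hk 7 7 (by norm_num) (by norm_num) (by norm_num))
  have h2_4 : φ 2 4 = 0 := by
    linear_combination (hs 2 3 (by norm_num) (by norm_num) (by norm_num) + (4 + 1) * h23 - 1 * z3) / 2
  have h2_5 : φ 2 5 = -1/3 * φ 3 4 := by
    linear_combination (hs 2 4 (by norm_num) (by norm_num) (by norm_num) + (5 + 1) * h2_4) / 3
  have h3_5 : φ 3 5 = 7/3 * φ 3 4 := by
    linear_combination (hs 3 4 (by norm_num) (by norm_num) (by norm_num) - 2 * z4) / 3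
  have h2_6 : φ 2 6 = -7/6 * φ 3 4 := by
    linear_combination (hs 2 5 (by norm_num) (by norm_num) (by norm_num) + (6 + 1) * h2_5 - 1 * h3_5) / 4
  have h3_6 : φ 3 6 = 14/3 * φ 3 4 - 1/2 * φ 4 5 := by
    linear_combination (hs 3 5 (by norm_num) (by norm_num) (by norm_num) + (7 + 1) * h3_5) / 4
  have h2_7 : φ 2 7 = -14/5 * φ 3 4 + 1/10 * φ 4 5 := by
    linear_combination (hs 2 6 (by norm_num) (by norm_num) (by norm_num) + (7 + 1) * h2_6 - 1 * h3_6) / 5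
  have h4_6 : φ 4 6 = 9/4 * φ 4 5 := by
    linear_combination (hs 4 5 (by norm_num) (by norm_num) (by norm_num) - 3 * z5) / 4
  have h3_7 : φ 3 7 = 42/5 * φ 3 4 - 9/5 * φ 4 5 := by
    linear_combination (hs 3 6 (by norm_num) (by norm_num) (by norm_num) + (8 + 1) * h3_6 - 2 * h4_6) / 5
  have h2_8 : φ 2 8 = -28/5 * φ 3 4 + 9/20 * φ 4 5 := by
    linear_combination (hs 2 7 (by norm_num) (by norm_num) (by norm_num) + (8 + 1) * h2_7 - 1 * h3_7) / 6
  have h4_7 : φ 4 7 = 9/2 * φ 4 5 - 3/5 * φ 5 6 := by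
    linear_combination (hs 4 6 (by norm_num) (by norm_num) (by norm_num) + (9 + 1) * h4_6) / 5
  have h3_8 : φ 3 8 = 14 * φ 3 4 - 9/2 * φ 4 5 + 1/5 * φ 5 6 := by
    linear_combination (hs 3 7 (by norm_num) (by norm_num) (by norm_num) + (9 + 1) * h3_7 - 2 * h4_7) / 6
  have h2_9 : φ 2 9 = -10 * φ 3 4 + 9/7 * φ 4 5 - 1/35 * φ 5 6 := by
    linear_combination (hs 2 8 (by norm_num) (by norm_num) (by norm_num) + (9 + 1) * h2_8 - 1 * h3_8) / 7
  have h5_7 : φ 5 7 = 11/5 * φ 5 6 := by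
    linear_combination (hs 5 6 (by norm_num) (by norm_num) (by norm_num) - 4 * z6) / 5
  have h4_8 : φ 4 8 = 33/4 * φ 4 5 - 11/5 * φ 5 6 := by
    linear_combination (hs 4 7 (by norm_num) (by norm_num) (by norm_num) + (10 + 1) * h4_7 - 3 * h5_7) / 6
  have h3_9 : φ 3 9 = 22 * φ 3 4 - 66/7 * φ 4 5 + 33/35 * φ 5 6 := by
    linear_combination (hs 3 8 (by norm_num) (by norm_num) (by norm_num) + (10 + 1) * h3_8 - 2 * h4_8) / 7
  have h2_10 : φ 2 10 = -33/2 * φ 3 4 + 165/56 * φ 4 5 - 11/70 * φ 5 6 := by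
    linear_combination (hs 2 9 (by norm_num) (by norm_num) (by norm_num) + (10 + 1) * h2_9 - 1 * h3_9) / 8
  have h5_8 : φ 5 8 = 22/5 * φ 5 6 - 2/3 * φ 6 7 := by
    linear_combination (hs 5 7 (by norm_num) (by norm_num) (by norm_num) + (11 + 1) * h5_7) / 6
  have h4_9 : φ 4 9 = 99/7 * φ 4 5 - 198/35 * φ 5 6 + 2/7 * φ 6 7 := by
    linear_combination (hs 4 8 (by norm_num) (by norm_num) (by norm_num) + (11 + 1) * h4_8 - 3 * h5_8) / 7
  have h3_10 : φ 3 10 = 33 * φ 3 4 - 495/28 * φ 4 5 + 99/35 * φ 5 6 - 1/14 * φ 6 7 := by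
    linear_combination (hs 3 9 (by norm_num) (by norm_num) (by norm_num) + (11 + 1) * h3_9 - 2 * h4_9) / 8
  have h2_11 : φ 2 11 = -77/3 * φ 3 4 + 165/28 * φ 4 5 - 11/21 * φ 5 6 + 1/126 * φ 6 7 := by
    linear_combination (hs 2 10 (by norm_num) (by norm_num) (by norm_num) + (11 + 1) * h2_10 - 1 * h3_10) / 9
  have h6_8 : φ 6 8 = 13/6 * φ 6 7 := by
    linear_combination (hs 6 7 (by norm_num) (by norm_num) (by norm_num) - 5 * z7) / 6
  have h5_9 : φ 5 9 = 286/35 * φ 5 6 - 52/21 * φ 6 7 := by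
    linear_combination (hs 5 8 (by norm_num) (by norm_num) (by norm_num) + (12 + 1) * h5_8 - 4 * h6_8) / 7
  have h4_10 : φ 4 10 = 1287/56 * φ 4 5 - 429/35 * φ 5 6 + 39/28 * φ 6 7 := by
    linear_combination (hs 4 9 (by norm_num) (by norm_num) (by norm_num) + (12 + 1) * h4_9 - 3 * h5_9) / 8
  have h3_11 : φ 3 11 = 143/3 * φ 3 4 - 429/14 * φ 4 5 + 143/21 * φ 5 6 - 26/63 * φ 6 7 := by
    linear_combination (hs 3 10 (by norm_num) (by norm_num) (by norm_num) + (12 + 1) * h3_10 - 2 * h4_10) / 9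
  have h2_12 : φ 2 12 = -572/15 * φ 3 4 + 429/40 * φ 4 5 - 143/105 * φ 5 6 + 13/252 * φ 6 7 := by
    linear_combination (hs 2 11 (by norm_num) (by norm_num) (by norm_num) + (12 + 1) * h2_11 - 1 * h3_11) / 10
  have h6_9 : φ 6 9 = 13/3 * φ 6 7 - 5/7 * φ 7 8 := by
    linear_combination (hs 6 8 (by norm_num) (by norm_num) (by norm_num) + (13 + 1) * h6_8) / 7
  have h5_10 : φ 5 10 = 143/10 * φ 5 6 - 13/2 * φ 6 7 + 5/14 * φ 7 8 := by
    linear_combination (hs 5 9 (by norm_num) (by norm_num) (by norm_num) + (13 + 1) * h5_9 - 4 * h6_9) / 8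
  have h4_11 : φ 4 11 = 143/4 * φ 4 5 - 143/6 * φ 5 6 + 13/3 * φ 6 7 - 5/42 * φ 7 8 := by
    linear_combination (hs 4 10 (by norm_num) (by norm_num) (by norm_num) + (13 + 1) * h4_10 - 3 * h5_10) / 9
  have h3_12 : φ 3 12 = 1001/15 * φ 3 4 - 1001/20 * φ 4 5 + 143/10 * φ 5 6 - 13/9 * φ 6 7 + 1/42 * φ 7 8 := by
    linear_combination (hs 3 11 (by norm_num) (by norm_num) (by norm_num) + (13 + 1) * h3_11 - 2 * h4_11) / 10
  have h2_13 : φ 2 13 = -273/5 * φ 3 4 + 91/5 * φ 4 5 - 91/30 * φ 5 6 + 13/66 * φ 6 7 - 1/462 * φ 7 8 := by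
    linear_combination (hs 2 12 (by norm_num) (by norm_num) (by norm_num) + (13 + 1) * h2_12 - 1 * h3_12) / 11
  have j1 := hj 2 3 4 (by norm_num) (by norm_num) (by norm_num) (by norm_num)
  rw [hk 4 5 (by norm_num) (by norm_num) (by norm_num),
    hk 2 7 (by norm_num) (by norm_num) (by norm_num),
    hk 3 6 (by norm_num) (by norm_num) (by norm_num),
    hk 2 4 (by norm_num) (by norm_num) (by norm_num),
    h2_7, h3_6, h23, h2_4] at j1
  have j2 := hj 2 3 6 (by norm_num) (by norm_num) (by norm_num) (by norm_num)
  rw [hk 2 9 (by norm_num) (by norm_num) (by norm_num),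
    hk 3 8 (by norm_num) (by norm_num) (by norm_num),
    hk 2 6 (by norm_num) (by norm_num) (by norm_num),
    h2_9, h3_8, h23, h3_6, h2_6] at j2
  have j4 := hj 2 3 8 (by norm_num) (by norm_num) (by norm_num) (by norm_num)
  rw [hk 2 11 (by norm_num) (by norm_num) (by norm_num),
    hk 3 10 (by norm_num) (by norm_num) (by norm_num),
    hk 2 8 (by norm_num) (by norm_num) (by norm_num),
    h5_8, h2_11, h3_10, h23, h3_8, h2_8] at j4
  have j5 := hj 2 3 10 (by norm_num) (by norm_num) (by norm_num) (by norm_num)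
  rw [hk 2 13 (by norm_num) (by norm_num) (by norm_num),
    hk 3 12 (by norm_num) (by norm_num) (by norm_num),
    hk 2 10 (by norm_num) (by norm_num) (by norm_num),
    h5_10, h2_13, h3_12, h23, h3_10, h2_10] at j5
  have j6 := hj 4 5 6 (by norm_num) (by norm_num) (by norm_num) (by norm_num)
  rw [hk 6 9 (by norm_num) (by norm_num) (by norm_num),
    hk 4 11 (by norm_num) (by norm_num) (by norm_num),
    hk 5 10 (by norm_num) (by norm_num) (by norm_num),
    hk 4 6 (by norm_num) (by norm_num) (by norm_num),
    h6_9, h4_11, h5_10, h4_6] at j6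
  linear_combination (143/5) * j6 + (-1573/20) * j5 + (3707/5) * j4 + (-22738/5) * j2 + (733549/40) * j1

end Coefficients

section Gauge

variable {K : Type*} [Field K] {𝔤 : Type*} [LieRing 𝔤] [LieAlgebra K 𝔤] {n : ℕ}
  {e : Module.Basis (Fin n) K 𝔤} {x x' : ℕ → 𝔤} {w : ℕ} {φ : ℕ → ℕ → K}

lemma mem_flag_of_lt {i j : ℕ} (h : n < i) {y : 𝔤} (hy : y ∈ flag e i) : y ∈ flag e j := by
  rw [eq_zero_of_mem_flag e h hy]
  exact zero_mem _

lemma AdSeq.of_sub_mem (hx : AdSeq e x) (h : ∀ i, x' i - x i ∈ flag e (i + 1))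
    (had : ∀ i, 2 ≤ i → ⁅x' 1, x' i⁆ = ((i : K) - 1) • x' (i + 1)) : AdSeq e x' where
  mem i := by
    have := add_mem (flag_anti e (Nat.le_succ i) (h i)) (hx.mem i)
    simpa using this
  top i hi y hy := by
    obtain ⟨c, hc⟩ := hx.top i hi y hy
    refine ⟨c, ?_⟩
    convert sub_mem hc (Submodule.smul_mem _ c (h i)) using 1
    module
  ad := had

lemma WittSeq.of_sub_mem (hF : LieFlag e) (hx : WittSeq e w x) (hx' : AdSeq e x')
    (h : ∀ i, 2 ≤ i → x' i - x i ∈ flag e (i + w)) : WittSeq e w x' where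
  toAdSeq := hx'
  err i j hi hj := by
    have h1 := hF (i + w) j (by omega) (by omega) _ (h i hi) _ (hx'.mem j)
    have h2 := hF i (j + w) (by omega) (by omega) _ (hx.mem i) _ (h j hj)
    have h3 := Submodule.smul_mem _ ((j : K) - i) (h (i + j) (by omega))
    rw [show i + w + j = i + j + w by ring] at h1
    rw [← add_assoc] at h2
    convert sub_mem (add_mem (add_mem (hx.err i j hi hj) h1) h2) h3 using 1
    simp only [sub_lie, lie_sub]
    module

/-- The deviation from the Witt algebra vanishes in lowest degree, if it does on `x₂, x₃, x₄`. -/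
lemma WittSeq.succ [CharZero K] (hF : LieFlag e) (hx : WittSeq e w x) (hw : 1 ≤ w)
    (hφ : IsSymb e w x φ) (h23 : φ 2 3 = 0) (h34 : φ 3 4 = 0) : WittSeq e (w + 1) x where
  toAdSeq := hx.toAdSeq
  err i j hi hj := by
    rcases lt_or_ge n (i + j + w) with h | h
    · exact mem_flag_of_lt h (hx.err i j hi hj)
    · have h0 : φ i j = 0 := by
        refine eq_zero_of_cocycle (N := n - w) (fun i j => (i : K) + j + w - 1)
          (fun i j hi hj h => hφ.skew hx.toAdSeq hi hj (by omega))
          (fun i j hi hj h => hφ.shift hx.toAdSeq hF hi hj (by omega)) ?_ h23 h34 hi hj (by omega)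
        intro k hk _ hkn low
        have := hφ.jacobi hx.toAdSeq hF hw (i := 2) (j := 3) (k := k) le_rfl (by norm_num)
          (by omega) (by omega)
        rw [h23, low 3 k (by norm_num) (by omega) (by omega),
          low k 2 (by omega) (by omega) (by omega), add_comm 3 k] at this
        push_cast at this
        linear_combination this
      have := hφ i j hi hj
      rw [h0, zero_smul, sub_zero] at this
      exact this

lemma wittSeq_one_of_lead [CharZero K] (hn : 12 ≤ n) (hF : LieFlag e) (hx : AdSeq e x)
    (hφ : IsLead e x φ) (h23 : φ 2 3 = 1) (h34 : φ 3 4 ≠ 0) : WittSeq e 1 x where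
  toAdSeq := hx
  err i j hi hj := by
    rcases lt_or_ge n (i + j) with h | h
    · exact mem_flag_of_lt h (sub_mem (hF i j (by omega) (by omega) _ (hx.mem i) _ (hx.mem j))
        (Submodule.smul_mem _ _ (hx.mem _)))
    · have h34' : φ 3 4 = 1 := lead_coeff (fun i j hi hj h => hφ.skew hx hi hj (by omega))
        (fun i j hi hj h => hφ.shift hx hF hi hj (by omega))
        (fun i j k hi hj hk h => hφ.jacobi hx hF hi hj hk (by omega)) h23 h34
      have h0 : φ i j - ((j : K) - i) = 0 := by
        refine eq_zero_of_cocycle (ψ := fun i j => φ i j - ((j : K) - i)) (N := n)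
          (fun i j => (i : K) + j - 1) ?_ ?_ ?_ ?_ ?_ hi hj h
        · intro i j hi hj h
          rw [hφ.skew hx hi hj h]
          ring
        · intro i j hi hj h
          have := hφ.shift hx hF hi hj h
          push_cast
          linear_combination this
        · intro k hk _ hkn low
          have := hφ.jacobi hx hF (i := 2) (j := 3) (k := k) le_rfl (by norm_num)
            (by omega) (by omega)
          have h1 := low 3 k (by norm_num) (by omega) (by omega)
          have h2 := low k 2 (by omega) (by omega) (by omega)
          rw [add_comm 3 k, h23] at this
          push_cast at this h1 h2 ⊢
          linear_combination this - φ (k + 3) 2 * h1 - φ (k + 2) 3 * h2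
        · rw [h23]; norm_num
        · rw [h34']; norm_num
      have := hφ i j hi hj
      rwa [sub_eq_zero.1 h0] at this

lemma choose_add_shift (w i : ℕ) :
    (i + 1) * (w + i + 1).choose w = (w + i).choose w * (w + i + 1) := by
  have h1 := Nat.add_one_mul_choose_eq (w + i) i
  have h2 : (w + i + 1).choose w = (w + i + 1).choose (i + 1) :=
    Nat.choose_symm_of_eq_add (by omega)
  have h3 : (w + i).choose w = (w + i).choose i := Nat.choose_symm_of_eq_add (by omega)
  rw [h2, h3]
  linarith

lemma WittSeq.exists_gauge [CharZero K] (hF : LieFlag e) (hx : WittSeq e w x) (hw : 2 ≤ w) :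
    ∃ x', WittSeq e w x' ∧ ⁅x' 2, x' 3⁆ - x' 5 ∈ flag e (5 + w + 1) := by
  obtain ⟨φ, hφ⟩ := hx.exists_symb
  set D : K := (w - 1) * (w ^ 2 + w + 6) with hD
  have hD0 : D ≠ 0 := by
    obtain ⟨t, rfl⟩ := Nat.exists_eq_add_of_le hw
    have : D = (((t + 1) * ((2 + t) ^ 2 + (2 + t) + 6) : ℕ) : K) := by rw [hD]; push_cast; ring
    rw [this]
    exact Nat.cast_ne_zero.2 (by positivity)
  set b : K := 6 * φ 2 3 / D with hb
  let x' : ℕ → 𝔤 := fun i =>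
    x i + (if 2 ≤ i then b * ((w + (i - 2)).choose w : K) else 0) • x (i + w)
  have hx1 : x' 1 = x 1 := by simp [x']
  have hxi : ∀ i, x' (i + 2) = x (i + 2) + (b * ((w + i).choose w : K)) • x (i + 2 + w) := by
    intro i; simp [x']
  have had : AdSeq e x' := by
    refine hx.toAdSeq.of_sub_mem (fun i => ?_) fun i hi => ?_
    · simp only [x', add_sub_cancel_left]
      exact Submodule.smul_mem _ _ (hx.mem_of_le (by omega))
    · obtain ⟨i, rfl⟩ := Nat.exists_eq_add_of_le' hi
      rw [hx1, hxi, show i + 2 + 1 = i + 1 + 2 by ring, hxi, lie_add, lie_smul, hx.ad _ (by omega),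
        hx.ad _ (by omega)]
      have := congrArg (Nat.cast (R := K)) (choose_add_shift w i)
      rw [show i + 2 + w + 1 = i + 1 + 2 + w by ring, show i + 2 + 1 = i + 1 + 2 by ring,
        smul_add, smul_smul, smul_smul]
      push_cast at this ⊢
      congr 2
      rw [← add_assoc]
      linear_combination - b * this
  refine ⟨x', hx.of_sub_mem hF had fun i hi => ?_, ?_⟩
  · simp only [x', add_sub_cancel_left]
    exact Submodule.smul_mem _ _ (hx.mem_of_le (by omega))
  · have h2 : x' 2 = x 2 + b • x (2 + w) := by simpa using hxi 0
    have h3 : x' 3 = x 3 + (b * (w + 1)) • x (3 + w) := by simpa using hxi 1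
    have h5 : x' 5 = x 5 + (b * ((w + 3) * (w + 2) * (w + 1) / 6)) • x (5 + w) := by
      have c1 := congrArg (Nat.cast (R := K)) (choose_add_shift w 0)
      have c2 := congrArg (Nat.cast (R := K)) (choose_add_shift w 1)
      have c3 := congrArg (Nat.cast (R := K)) (choose_add_shift w 2)
      have c0 : (w + 0).choose w = 1 := by simp
      rw [c0] at c1
      push_cast at c1 c2 c3
      rw [show w + 0 + 1 = w + 1 by rfl] at c1
      rw [show w + 1 + 1 = w + 2 by rfl] at c2
      rw [show w + 2 + 1 = w + 3 by rfl] at c3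
      have c4 : ((w + 3).choose w : K) = (w + 3) * (w + 2) * (w + 1) / 6 := by
        linear_combination c3 / 3 + (w + 3) / 6 * c2 + (w + 3) * (w + 2) / 6 * c1
      rw [← c4]
      exact hxi 3
    have m23 := hφ.mkQ (i := 2) (j := 3) (m := 5) le_rfl (by norm_num) rfl
    have m1 := flag_anti e (show 5 + w + 1 ≤ 2 + (3 + w) + w by omega)
      (hx.err 2 (3 + w) le_rfl (by omega))
    have m2 := flag_anti e (show 5 + w + 1 ≤ 2 + w + 3 + w by omega)
      (hx.err (2 + w) 3 (by omega) (by norm_num))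
    have m3 := flag_anti e (show 5 + w + 1 ≤ 2 + w + (3 + w) by omega)
      (hF (2 + w) (3 + w) (by omega) (by omega) _ (hx.mem _) _ (hx.mem _))
    rw [← mkQ_eq_iff, map_smul, show 2 + (3 + w) = 5 + w by ring] at m1
    rw [← mkQ_eq_iff, map_smul, show 2 + w + 3 = 5 + w by ring] at m2
    rw [← mkQ_eq_zero_iff] at m3
    push_cast at m1 m2 m23
    rw [← mkQ_eq_iff, h2, h3, h5]
    simp only [add_lie, lie_add, smul_lie, lie_smul, map_add, map_smul, m1, m2, m3, m23]
    have hbD : b * D = 6 * φ 2 3 := by rw [hb, div_mul_cancel₀ _ hD0]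
    match_scalars
    · norm_num
    · rw [hD] at hbD
      linear_combination - hbD / 6

/-- The sequence generated by `x₁ + a x₂` and `x₂`. -/
def shiftSeq (x : ℕ → 𝔤) (a : K) : ℕ → 𝔤
  | 0 => x 0
  | 1 => x 1 + a • x 2
  | 2 => x 2
  | (k + 3) => ((k : K) + 1)⁻¹ • ⁅x 1 + a • x 2, shiftSeq x a (k + 2)⁆

lemma shiftSeq_sub_mem [CharZero K] (hF : LieFlag e) (hx : AdSeq e x) (a : K) :
    ∀ i, shiftSeq x a i - x i ∈ flag e (i + 1)
  | 0 => by simp [shiftSeq]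
  | 1 => by
    simp only [shiftSeq, add_sub_cancel_left]
    exact Submodule.smul_mem _ _ (hx.mem 2)
  | 2 => by simp [shiftSeq]
  | (k + 3) => by
    have ih := shiftSeq_sub_mem hF hx a (k + 2)
    have hk : (k : K) + 1 ≠ 0 := Nat.cast_add_one_ne_zero k
    have h1 := hF 1 _ le_rfl (by omega) _ (hx.mem 1) _ ih
    have h2 := hF 2 (k + 2) (by omega) (by omega) _ (Submodule.smul_mem _ a (hx.mem 2)) _
      (add_mem (flag_anti e (Nat.le_succ _) ih) (hx.mem (k + 2)))
    rw [sub_add_cancel] at h2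
    rw [show 2 + (k + 2) = k + 3 + 1 by ring] at h2
    rw [show 1 + (k + 2 + 1) = k + 3 + 1 by ring, lie_sub, hx.ad _ (by omega)] at h1
    convert Submodule.smul_mem _ ((k : K) + 1)⁻¹ (add_mem h1 h2) using 1
    rw [shiftSeq, add_lie, smul_add, smul_add, smul_sub, smul_smul]
    push_cast
    rw [show (k : K) + 2 - 1 = k + 1 by ring, inv_mul_cancel₀ hk, one_smul]
    abel

lemma shiftSeq_adSeq [CharZero K] (hF : LieFlag e) (hx : AdSeq e x) (a : K) :
    AdSeq e (shiftSeq x a) := by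
  refine hx.of_sub_mem (shiftSeq_sub_mem hF hx a) fun i hi => ?_
  obtain ⟨k, rfl⟩ := Nat.exists_eq_add_of_le' hi
  have hk : (k : K) + 1 ≠ 0 := Nat.cast_add_one_ne_zero k
  rw [shiftSeq.eq_def x a (k + 2 + 1)]
  push_cast
  rw [show (k : K) + 2 - 1 = k + 1 by ring, smul_smul, mul_inv_cancel₀ hk, one_smul]
  rfl

lemma WittSeq.exists_gauge_one [CharZero K] (hF : LieFlag e) (hx : WittSeq e 1 x) :
    ∃ x', WittSeq e 1 x' ∧ ⁅x' 2, x' 3⁆ - x' 5 ∈ flag e (5 + 1 + 1) := by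
  obtain ⟨φ, hφ⟩ := hx.exists_symb
  set a : K := 3 / 4 * φ 2 3 with ha
  refine ⟨shiftSeq x a, hx.of_sub_mem hF (shiftSeq_adSeq hF hx.toAdSeq a)
    fun i _ => shiftSeq_sub_mem hF hx.toAdSeq a i, ?_⟩
  have h2 : shiftSeq x a 2 = x 2 := rfl
  have h3 : shiftSeq x a 3 = x 3 := by
    simp [shiftSeq, hx.ad 2 le_rfl]
    norm_num
  have h4 : shiftSeq x a 4 = x 4 + (a / 2) • ⁅x 2, x 3⁆ := by
    have : shiftSeq x a 4 = ((1 : ℕ) + 1 : K)⁻¹ • ⁅x 1 + a • x 2, shiftSeq x a 3⁆ := rfl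
    rw [this, h3, add_lie, hx.ad 3 (by norm_num), smul_lie]
    push_cast
    module
  have h5 : shiftSeq x a 5 = x 5 + (a / 3) • ⁅x 2, x 4⁆ + (a / 3) • ⁅x 2, x 4⁆
      + (a ^ 2 / 6) • ⁅x 2, ⁅x 2, x 3⁆⁆ := by
    have : shiftSeq x a 5 = ((2 : ℕ) + 1 : K)⁻¹ • ⁅x 1 + a • x 2, shiftSeq x a 4⁆ := rfl
    rw [this, h4, add_lie, lie_add, lie_add, lie_smul, leibniz_lie (x 1), hx.ad 2 (by norm_num),
      hx.ad 3 (by norm_num), hx.ad 4 (by norm_num), smul_lie, smul_lie, lie_smul, smul_lie, lie_smul,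
      lie_self]
    push_cast
    module
  have m23 := hφ.mkQ (i := 2) (j := 3) (m := 5) le_rfl (by norm_num) rfl
  have m1 := hx.err 2 4 (by norm_num) (by norm_num)
  have m2 := hF 2 5 (by norm_num) (by norm_num) _ (hx.mem 2) _
    (hF 2 3 (by norm_num) (by norm_num) _ (hx.mem 2) _ (hx.mem 3))
  rw [show 2 + 4 + 1 = 5 + 1 + 1 by rfl, ← mkQ_eq_iff, map_smul] at m1
  rw [show 2 + 5 = 5 + 1 + 1 by rfl, ← mkQ_eq_zero_iff] at m2
  rw [← mkQ_eq_iff, h2, h3, h5]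
  simp only [map_add, map_smul, m1, m2, m23, ha]
  push_cast
  module

/-- Up to a change of coordinates, a deviation from the Witt algebra occurs only in high degree. -/
lemma WittSeq.exists_of_le [CharZero K] (hn : 16 ≤ n) (hF : LieFlag e) (hx : WittSeq e 1 x) :
    ∀ w, 1 ≤ w → w + 11 ≤ n → ∃ x, WittSeq e w x := by
  intro w hw
  induction w, hw using Nat.le_induction with
  | base => exact fun _ => ⟨x, hx⟩
  | succ w hw ih =>
    intro hwn
    obtain ⟨y, hy⟩ := ih (by omega)
    have : ∃ x', WittSeq e w x' ∧ ⁅x' 2, x' 3⁆ - x' 5 ∈ flag e (5 + w + 1) := by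
      rcases hw.eq_or_lt with rfl | h
      · exact hy.exists_gauge_one hF
      · exact hy.exists_gauge hF h
    obtain ⟨x', hx', h23⟩ := this
    obtain ⟨φ, hφ⟩ := hx'.exists_symb
    have h0 : φ 2 3 = 0 := by
      have m23 := hφ.mkQ (i := 2) (j := 3) (m := 5) le_rfl (by norm_num) rfl
      rw [← mkQ_eq_iff] at h23
      rw [h23] at m23
      apply hx'.toAdSeq.coeff_eq_zero (m := 5 + w) (by omega) (by omega)
      rw [← mkQ_eq_zero_iff, map_smul]
      push_cast at m23
      linear_combination (norm := module) - m23
    refine ⟨x', hx'.succ hF hw hφ h0 ?_⟩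
    rcases hw.eq_or_lt with rfl | h
    · exact symb_coeff_one (w := ((1 : ℕ) : K)) Nat.cast_one
        (fun i j hi hj h => hφ.skew hx'.toAdSeq hi hj (by omega))
        (fun i j hi hj h => hφ.shift hx'.toAdSeq hF hi hj (by omega))
        (fun i j k hi hj hk h => hφ.jacobi hx'.toAdSeq hF le_rfl hi hj hk (by omega)) h0
    · have := symb_coeff (w := (w : K))
        (fun i j hi hj h => hφ.skew hx'.toAdSeq hi hj (by omega))
        (fun i j hi hj h => hφ.shift hx'.toAdSeq hF hi hj (by omega))
        (fun i j k hi hj hk h => hφ.jacobi hx'.toAdSeq hF hw hi hj hk (by omega)) h0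
      refine (mul_eq_zero.1 this).resolve_left ?_
      obtain ⟨t, rfl⟩ := Nat.exists_eq_add_of_le h
      have h1 : (((1 + 1 + t : ℕ) : K) - 1) * (((1 + 1 + t : ℕ) : K) ^ 4
          + 11 * ((1 + 1 + t : ℕ) : K) ^ 3 + 64 * ((1 + 1 + t : ℕ) : K) ^ 2
          + 108 * ((1 + 1 + t : ℕ) : K) + 288) = (((1 + t) * ((1 + 1 + t) ^ 4 + 11 * (1 + 1 + t) ^ 3
          + 64 * (1 + 1 + t) ^ 2 + 108 * (1 + 1 + t) + 288) : ℕ) : K) := by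
        push_cast; ring
      rw [h1]
      exact Nat.cast_ne_zero.2 (by positivity)

end Gauge

section Vanishing

variable {K : Type*} [Field K] {𝔤 : Type*} [LieRing 𝔤] [LieAlgebra K 𝔤] {n : ℕ}
  {e : Module.Basis (Fin n) K 𝔤} {x : ℕ → 𝔤} {W : ℕ}

lemma AdSeq.exists_basis (hx : AdSeq e x) : ∃ e' : Module.Basis (Fin n) K 𝔤,
    (∀ i, 1 ≤ i → vec e' i = x i) ∧ ∀ i, 1 ≤ i → flag e' i = flag e i := by
  have key : ∀ d i, 1 ≤ i → n < i + d → flag e i ≤ Submodule.span K (x '' Set.Icc i n) := by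
    intro d
    induction d with
    | zero => intro i _ h; rw [flag_eq_bot e (by omega)]; exact bot_le
    | succ d ih =>
      intro i hi h y hy
      obtain ⟨c, hc⟩ := hx.top i hi y hy
      have h1 := Submodule.span_mono (Set.image_mono (Set.Icc_subset_Icc (Nat.le_succ i) le_rfl))
        (ih (i + 1) (by omega) (by omega) hc)
      by_cases hin : i ≤ n
      · have h2 : x i ∈ Submodule.span K (x '' Set.Icc i n) :=
          Submodule.subset_span ⟨i, ⟨le_rfl, hin⟩, rfl⟩
        simpa using add_mem h1 (Submodule.smul_mem _ c h2)
      · rw [hx.eq_zero_of_lt (by omega)] at h1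
        simpa using h1
  have htop : ⊤ ≤ Submodule.span K (Set.range fun i : Fin n => x (i + 1)) := by
    rw [← flag_one e]
    refine (key n 1 le_rfl (by omega)).trans (Submodule.span_mono ?_)
    rintro _ ⟨i, ⟨h1, h2⟩, rfl⟩
    exact ⟨⟨i - 1, by omega⟩, by simp [Nat.sub_add_cancel h1]⟩
  let e' := basisOfTopLeSpanOfCardEqFinrank (fun i : Fin n => x (i + 1)) htop
    (by rw [Module.finrank_eq_card_basis e])
  have he' : ∀ i, 1 ≤ i → vec e' i = x i := by
    intro i hi
    by_cases hin : i ≤ n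
    · rw [vec, dif_pos ⟨hi, hin⟩]
      simp [e', Nat.sub_add_cancel hi]
    · rw [vec_eq_zero _ (by omega), hx.eq_zero_of_lt (by omega)]
  refine ⟨e', he', fun i hi => le_antisymm (flag_le_of e' fun j hj => ?_)
    ((key n i hi (by omega)).trans (Submodule.span_le.2 ?_))⟩
  · rw [he' j (by omega)]
    exact hx.mem_of_le hj
  · rintro _ ⟨j, hj, rfl⟩
    rw [← he' j (hi.trans hj.1)]
    exact vec_mem_flag e' hj.1

lemma WittSeq.congr {e' : Module.Basis (Fin n) K 𝔤} (hx : WittSeq e W x)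
    (h : ∀ i, 1 ≤ i → flag e' i = flag e i) (h' : ∀ i, 1 ≤ i → vec e' i = x i) :
    WittSeq e' W (vec e') where
  mem i := vec_mem_flag e' le_rfl
  top i _ y hy := exists_sub_smul_vec_mem e' hy
  ad i hi := by rw [h' 1 le_rfl, h' i (by omega), h' (i + 1) (by omega)]; exact hx.ad i hi
  err i j hi hj := by
    rw [h' i (by omega), h' j (by omega), h' (i + j) (by omega), h _ (by omega)]
    exact hx.err i j hi hj

lemma self_of_skew [CharZero K] {η : 𝔤 →ₗ[K] 𝔤 →ₗ[K] K} (hη : ∀ x y, η x y = - η y x) (x : 𝔤) :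
    η x x = 0 := self_eq_neg.1 (hη x x)

/-- A form which is invariant under `e₁` and closed on the triples `e₂, e₃, e_k`, in all degrees from
`N` on, vanishes in these degrees. -/
lemma form_eq_zero_of_closed [CharZero K] (hx : WittSeq e 1 (vec e))
    {η : 𝔤 →ₗ[K] 𝔤 →ₗ[K] K} (hη : ∀ x y, η x y = - η y x) (h1 : ∀ y, η (vec e 1) y = 0) {N : ℕ}
    (hN : 8 ≤ N) (hd1 : ∀ i j, 2 ≤ i → 2 ≤ j → N ≤ i + j + 1 →
      delta η (vec e 1) (vec e i) (vec e j) = 0)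
    (hd2 : ∀ k, 4 ≤ k → Even k → N ≤ k + 5 → delta η (vec e 2) (vec e 3) (vec e k) = 0)
    {i j : ℕ} (hij : N ≤ i + j) {y z : 𝔤} (hy : y ∈ flag e i) (hz : z ∈ flag e j) :
    η y z = 0 := by
  have h1' : ∀ y, η y (vec e 1) = 0 := fun y => by rw [hη, h1, neg_zero]
  have extend : ∀ M, N ≤ M → (∀ i j, 2 ≤ i → 2 ≤ j → M ≤ i + j → η (vec e i) (vec e j) = 0) →
      ∀ i j, M ≤ i + j → ∀ y ∈ flag e i, ∀ z ∈ flag e j, η y z = 0 := by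
    intro M _ h i j hij y hy z hz
    refine form_eq_zero_of_flag e (N := M) (fun i j hi _ hj _ hij => ?_) hij hy hz
    rcases hi.eq_or_lt with rfl | hi'
    · exact h1 _
    rcases hj.eq_or_lt with rfl | hj'
    · exact h1' _
    exact h i j hi' hj' hij
  suffices H : ∀ d i j, 2 ≤ i → 2 ≤ j → N ≤ i + j → 2 * n < i + j + d →
      η (vec e i) (vec e j) = 0 from
    extend N le_rfl (fun i j hi hj h => H (2 * n) i j hi hj h (by omega)) i j hij y hy z hz
  intro d
  induction d with
  | zero =>
    intro i j _ _ _ h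
    rcases lt_or_ge n i with h' | h'
    · rw [vec_eq_zero e h', map_zero, LinearMap.zero_apply]
    · rw [vec_eq_zero e (show n < j by omega), map_zero]
  | succ d ih =>
    intro i j hi hj hN' hd
    by_cases hlt : 2 * n < i + j + d
    · exact ih i j hi hj hN' hlt
    obtain ⟨M, hM⟩ : ∃ M, M = i + j := ⟨_, rfl⟩
    have high := extend (M + 1) (by omega) fun i j hi hj h => ih i j hi hj (by omega) (by omega)
    have := eq_zero_of_shift_invariant (M := M) (f := fun i => η (vec e i) (vec e (M - i)))
      (i := i) ?_ ?_ ?_ hi (by omega)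
    · simpa [show M - i = j by omega] using this
    · intro p h2 h3
      rw [show M - (M - p) = p by omega]
      exact hη _ _
    · intro p q hp hq hpq
      have := hd1 p q hp hq (by omega)
      rw [delta, h1', hx.ad p hp, ← lie_skew, hx.ad q hq, map_smul, map_neg, map_smul] at this
      simp only [LinearMap.smul_apply, LinearMap.neg_apply, smul_eq_mul] at this
      rw [show M - (p + 1) = q by omega, show M - p = q + 1 by omega]
      rw [hη (vec e p)]
      linear_combination this
    · rcases Nat.even_or_odd M with h | h
      · exact Or.inl h
      · right
        obtain ⟨t, ht⟩ := h
        rcases lt_or_ge (n + 2) M with hn | hn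
        · refine Or.inl ⟨n + 1, by omega, by omega, ?_⟩
          simp [vec_eq_zero e (Nat.lt_succ_self n)]
        · refine Or.inr ⟨M - 5, by omega, ⟨t - 2, by omega⟩, by omega, ?_⟩
          have hev : Even (M - 5) := ⟨t - 2, by omega⟩
          have := hd2 (M - 5) (by omega) hev (by omega)
          obtain ⟨k, hk⟩ : ∃ k, M - 5 = k := ⟨_, rfl⟩
          rw [hk] at this ⊢
          have e1 := high 6 k (by omega) _ (hx.err 2 3 le_rfl (by norm_num)) _ (vec_mem_flag e le_rfl)
          have e2 := high (3 + k + 1) 2 (by omega) _ (hx.err 3 k (by norm_num) (by omega)) _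
            (vec_mem_flag e le_rfl)
          have e3 := high (k + 2 + 1) 3 (by omega) _ (hx.err k 2 (by omega) (by norm_num)) _
            (vec_mem_flag e le_rfl)
          simp only [map_sub, map_smul, LinearMap.sub_apply, LinearMap.smul_apply,
            smul_eq_mul] at e1 e2 e3
          rw [show M - (k + 3) = 2 by omega, show M - (k + 2) = 3 by omega]
          rw [delta] at this
          rw [add_comm 3 k] at e2
          push_cast at e1 e2 e3
          linear_combination this - e1 - e2 - e3

/-- The coboundary of a linear form, up to sign. -/
def cob (f : 𝔤 →ₗ[K] K) : 𝔤 →ₗ[K] 𝔤 →ₗ[K] K :=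
  LinearMap.mk₂ K (fun x y => f ⁅x, y⁆) (by simp) (by simp) (by simp) (by simp)

lemma cob_apply (f : 𝔤 →ₗ[K] K) (x y : 𝔤) : cob f x y = f ⁅x, y⁆ := rfl

lemma cob_skew (f : 𝔤 →ₗ[K] K) (x y : 𝔤) : cob f x y = - cob f y x := by
  rw [cob_apply, cob_apply, ← lie_skew, map_neg]

lemma delta_cob (f : 𝔤 →ₗ[K] K) (x y z : 𝔤) : delta (cob f) x y z = 0 := by
  simp only [delta, cob_apply]
  rw [← map_add, ← map_add, lie_jacobi', map_zero]

/-- A form can be changed by a coboundary so that it vanishes on all `e₁ ∧ e_i`, `i < n`. -/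
lemma exists_cob [CharZero K] (hx : AdSeq e (vec e)) {η : 𝔤 →ₗ[K] 𝔤 →ₗ[K] K}
    (hη : ∀ x y, η x y = - η y x) (hn : η (vec e 1) (vec e n) = 0) :
    ∃ f : 𝔤 →ₗ[K] K, ∀ y, (η - cob f) (vec e 1) y = 0 := by
  let f : 𝔤 →ₗ[K] K := e.constr K fun i => ((i : K) - 1)⁻¹ * η (vec e 1) (vec e i)
  refine ⟨f, fun y => ?_⟩
  suffices h : (η - cob f) (vec e 1) = 0 by rw [h, LinearMap.zero_apply]
  refine e.ext fun i => ?_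
  obtain ⟨i, hi⟩ := i
  rw [← vec_succ, LinearMap.sub_apply, LinearMap.sub_apply, LinearMap.zero_apply, cob_apply]
  rcases Nat.eq_zero_or_pos i with rfl | hi0
  · simp [self_of_skew hη]
  · rw [hx.ad _ (by simpa using Nat.succ_le_of_lt hi0), map_smul]
    rcases (Nat.succ_le_of_lt hi).eq_or_lt with h | h
    · have : i + 1 = n := h
      simp only [this, hn, vec_eq_zero e (Nat.lt_succ_self n)]
      simp
    · have h2 : vec e (i + 1 + 1) = e ⟨i + 1, h⟩ := vec_succ e ⟨i + 1, h⟩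
      have hi1 : (i : K) ≠ 0 := Nat.cast_ne_zero.2 (by omega)
      simp only [h2, f, Module.Basis.constr_basis]
      push_cast
      rw [add_sub_cancel_right, smul_eq_mul, mul_inv_cancel_left₀ hi1, sub_self]

lemma form_zero_of_forall_flag {η : 𝔤 →ₗ[K] 𝔤 →ₗ[K] K} (hF : LieFlag e) {N : ℕ}
    (h : ∀ i j, N ≤ i + j → ∀ y ∈ flag e i, ∀ z ∈ flag e j, η y z = 0)
    {i j k : ℕ} (hi : 1 ≤ i) (hj : 1 ≤ j) (hk : 1 ≤ k) (hijk : N ≤ i + j + k) {x y z : 𝔤}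
    (hx : x ∈ flag e i) (hy : y ∈ flag e j) (hz : z ∈ flag e k) : delta η x y z = 0 := by
  rw [delta, h _ _ hijk _ (hF i j hi hj _ hx _ hy) _ hz,
    h (j + k) i (by omega) _ (hF j k hj hk _ hy _ hz) _ hx,
    h (k + i) j (by omega) _ (hF k i hk hi _ hz _ hx) _ hy, add_zero, add_zero]

/-- The form defining the extension of the truncated Witt algebra by one further dimension. -/
def wittForm (e : Module.Basis (Fin n) K 𝔤) : 𝔤 →ₗ[K] 𝔤 →ₗ[K] K :=
  formOf e fun i j => if i + j = n + 1 then (j : K) - i else 0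

lemma wittForm_skew (e : Module.Basis (Fin n) K 𝔤) (x y : 𝔤) :
    wittForm e x y = - wittForm e y x := by
  refine formOf_skew e (fun i j => ?_) x y
  rw [add_comm j i]
  split_ifs <;> ring

lemma wittForm_vec {i j : ℕ} (hi : 1 ≤ i) (hj : 1 ≤ j) :
    wittForm e (vec e i) (vec e j) = if i + j = n + 1 then (j : K) - i else 0 := by
  rcases lt_or_ge n i with h | h
  · rw [vec_eq_zero e h, map_zero, LinearMap.zero_apply, if_neg (by omega)]
  rcases lt_or_ge n j with h' | h'
  · rw [vec_eq_zero e h', map_zero, if_neg (by omega)]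
  rw [wittForm, formOf_vec e _ hi h hj h']

lemma wittForm_eq_zero {i j : ℕ} (h : n + 1 < i + j) {y z : 𝔤} (hy : y ∈ flag e i)
    (hz : z ∈ flag e j) : wittForm e y z = 0 := by
  refine form_eq_zero_of_flag e (N := n + 2) (fun i j hi _ hj _ h => ?_) h hy hz
  rw [wittForm_vec hi hj, if_neg (by omega)]

lemma delta_wittForm_eq_zero (hx : WittSeq e W (vec e)) {i j k : ℕ}
    (hijk : n + 2 ≤ i + j + k + W) {x y z : 𝔤}
    (hx' : x ∈ flag e i) (hy : y ∈ flag e j) (hz : z ∈ flag e k) :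
    delta (wittForm e) x y z = 0 := by
  have err : ∀ i j, 1 ≤ i → 1 ≤ j →
      ⁅vec e i, vec e j⁆ - ((j : K) - i) • vec e (i + j) ∈ flag e (i + j + W) := by
    intro i j hi hj
    rcases hi.eq_or_lt with rfl | hi'
    · rcases hj.eq_or_lt with rfl | hj'
      · simp
      · rw [hx.ad j hj', add_comm 1 j, Nat.cast_one, sub_self]
        exact zero_mem _
    · rcases hj.eq_or_lt with rfl | hj'
      · rw [← lie_skew, hx.ad i hi', Nat.cast_one, ← neg_smul, neg_sub, sub_self]
        exact zero_mem _
      · exact hx.err i j hi' hj'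
  refine delta_eq_zero_of_flag e (N := n + 2 - W) (fun i j k hi _ hj _ hk _ h => ?_)
    (by omega) hx' hy hz
  have e1 := wittForm_eq_zero (show n + 1 < i + j + W + k by omega) (err i j hi hj)
    (vec_mem_flag e le_rfl)
  have e2 := wittForm_eq_zero (show n + 1 < j + k + W + i by omega) (err j k hj hk)
    (vec_mem_flag e le_rfl)
  have e3 := wittForm_eq_zero (show n + 1 < k + i + W + j by omega) (err k i hk hi)
    (vec_mem_flag e le_rfl)
  simp only [map_sub, map_smul, LinearMap.sub_apply, LinearMap.smul_apply, smul_eq_mul,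
    sub_eq_zero] at e1 e2 e3
  rw [delta, e1, e2, e3, wittForm_vec (by omega) hk, wittForm_vec (by omega) hi,
    wittForm_vec (by omega) hj, show j + k + i = i + j + k by ring, show k + i + j = i + j + k by ring]
  split_ifs
  · push_cast; ring
  · ring

/-- The obstruction against extending the Lie algebra by one dimension lives in low degree. -/
lemma delta_eq_zero_of_wittSeq [CharZero K] (hn : 3 ≤ n) (hF : LieFlag e)
    (hx : WittSeq e 1 (vec e)) {x : ℕ → 𝔤} (hx' : WittSeq e W x) {B : 𝔤 →ₗ[K] 𝔤 →ₗ[K] K}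
    (hB : ∀ x y, B x y = - B y x) (hd1 : ∀ y z, delta B (vec e 1) y z = 0)
    (hd2 : ∀ k, 4 ≤ k → Even k → delta B (vec e 2) (vec e 3) (vec e k) = 0) {N : ℕ} (hN : 8 ≤ N)
    (hNW : n + 2 ≤ N + W) {i j k : ℕ} (hi : 1 ≤ i) (hj : 1 ≤ j) (hk : 1 ≤ k)
    (hijk : N ≤ i + j + k) {x y z : 𝔤} (hx0 : x ∈ flag e i) (hy : y ∈ flag e j)
    (hz : z ∈ flag e k) : delta B x y z = 0 := by
  obtain ⟨e', he', hfl⟩ := hx'.exists_basis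
  have hx'' := hx'.congr hfl he'
  have hdw : ∀ i j k, 1 ≤ i → 1 ≤ j → 1 ≤ k → N ≤ i + j + k → ∀ x ∈ flag e i, ∀ y ∈ flag e j,
      ∀ z ∈ flag e k, delta (wittForm e') x y z = 0 := by
    intro i j k hi hj hk h x hx y hy z hz
    rw [← hfl i hi] at hx
    rw [← hfl j hj] at hy
    rw [← hfl k hk] at hz
    exact delta_wittForm_eq_zero hx'' (by omega) hx hy hz
  set l := wittForm e' (vec e 1) (vec e n) with hl
  have hl0 : l ≠ 0 := by
    obtain ⟨c, hc⟩ := exists_sub_smul_vec_mem e' (mem_flag_one e' (vec e 1))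
    have hen : vec e n ∈ flag e' n := by rw [hfl n (by omega)]; exact vec_mem_flag e le_rfl
    obtain ⟨c', hc'⟩ := exists_sub_smul_vec_mem e' hen
    have h2 := eq_zero_of_mem_flag e' (Nat.lt_succ_self n) hc'
    have h1 := wittForm_eq_zero (show n + 1 < 1 + 1 + n by omega) hc hen
    rw [map_sub, LinearMap.sub_apply, sub_eq_zero, ← hl] at h1
    rw [sub_eq_zero] at h2
    rw [h1, h2, map_smul, map_smul, LinearMap.smul_apply, wittForm_vec le_rfl (by omega),
      if_pos (by ring), smul_eq_mul, smul_eq_mul]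
    refine mul_ne_zero ?_ (mul_ne_zero ?_ ?_)
    · rintro rfl
      rw [zero_smul] at h2
      exact hx.notMem (m := n) (by omega) le_rfl (by rw [h2]; exact zero_mem _)
    · rintro rfl
      rw [zero_smul, sub_zero, hfl _ (by omega)] at hc
      exact hx.notMem (m := 1) le_rfl (by omega) hc
    · obtain ⟨m, rfl⟩ := Nat.exists_eq_add_of_le hn
      have : ((3 + m : ℕ) : K) - (1 : ℕ) = ((2 + m : ℕ) : K) := by push_cast; ring
      rw [this]
      exact Nat.cast_ne_zero.2 (by omega)
  set μ := B (vec e 1) (vec e n) with hμ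
  have hη : ∀ x y, (l • B - μ • wittForm e') x y = - (l • B - μ • wittForm e') y x := by
    intro x y
    simp only [LinearMap.sub_apply, LinearMap.smul_apply, smul_eq_mul]
    rw [hB x, wittForm_skew e' x]
    ring
  obtain ⟨f, hf⟩ := exists_cob hx.toAdSeq hη (by
    simp only [LinearMap.sub_apply, LinearMap.smul_apply, smul_eq_mul, ← hl, ← hμ]
    ring)
  have hη' : ∀ x y, (l • B - μ • wittForm e' - cob f) x y
      = - (l • B - μ • wittForm e' - cob f) y x := by
    intro x y
    rw [LinearMap.sub_apply, LinearMap.sub_apply, hη x, cob_skew f x,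
      LinearMap.sub_apply _ (cob f) y, LinearMap.sub_apply _ (cob f y)]
    ring
  have hdη : ∀ x y z, delta (l • B - μ • wittForm e' - cob f) x y z
      = l * delta B x y z - μ * delta (wittForm e') x y z := by
    intro x y z
    rw [delta_form_sub, delta_form_sub, delta_form_smul, delta_form_smul, delta_cob, sub_zero]
  have hvec : ∀ i, vec e i ∈ flag e i := fun i => vec_mem_flag e le_rfl
  have hzero := fun i j (hij : N ≤ i + j) y (hy : y ∈ flag e i) z (hz : z ∈ flag e j) =>
    form_eq_zero_of_closed hx hη' hf hN
      (fun i j hi hj h => by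
        rw [hdη, hd1, hdw 1 i j le_rfl (by omega) (by omega) (by omega) _ (hvec _) _ (hvec _) _
          (hvec _), mul_zero, mul_zero, sub_zero])
      (fun k hk hke h => by
        rw [hdη, hd2 k hk hke, hdw 2 3 k (by omega) (by omega) (by omega) (by omega) _ (hvec _) _
          (hvec _) _ (hvec _), mul_zero, mul_zero, sub_zero]) hij hy hz
  have h0 := form_zero_of_forall_flag hF hzero hi hj hk hijk hx0 hy hz
  rw [hdη, hdw i j k hi hj hk hijk _ hx0 _ hy _ hz, mul_zero, sub_zero] at h0
  exact (mul_eq_zero.1 h0).resolve_left hl0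

end Vanishing

section LowDegree

variable {K : Type*} [Field K] {𝔤 : Type*} [LieRing 𝔤] [LieAlgebra K 𝔤] {n : ℕ}
  {e : Module.Basis (Fin n) K 𝔤}

lemma delta_eq_zero_of_sorted [CharZero K] {B : 𝔤 →ₗ[K] 𝔤 →ₗ[K] K} {N : ℕ}
    (hd1 : ∀ y z, delta B (vec e 1) y z = 0)
    (h : ∀ i j k, 2 ≤ i → i < j → j < k → N ≤ i + j + k →
      delta B (vec e i) (vec e j) (vec e k) = 0)
    {i j k : ℕ} (hijk : N ≤ i + j + k) {x y z : 𝔤} (hx : x ∈ flag e i) (hy : y ∈ flag e j)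
    (hz : z ∈ flag e k) : delta B x y z = 0 := by
  have h' : ∀ i j k, 1 ≤ i → i < j → j < k → N ≤ i + j + k →
      delta B (vec e i) (vec e j) (vec e k) = 0 := by
    intro i j k hi hij hjk hN
    rcases hi.eq_or_lt with rfl | hi
    · exact hd1 _ _
    · exact h i j k hi hij hjk hN
  have heq : ∀ x y, delta B x x y = 0 := fun x y => self_eq_neg.1 (delta_swap B x x y)
  refine delta_eq_zero_of_flag e (N := N) (fun i j k hi _ hj _ hk _ hN => ?_) hijk hx hy hz
  rcases lt_trichotomy i j with h1 | rfl | h1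
  · rcases lt_trichotomy j k with h2 | rfl | h2
    · exact h' i j k hi h1 h2 hN
    · rw [delta_rotate, heq]
    · rcases lt_trichotomy i k with h3 | rfl | h3
      · rw [delta_swap', h' i k j hi h3 h2 (by omega), neg_zero]
      · rw [← delta_rotate, heq]
      · rw [← delta_rotate, h' k i j hk h3 h1 (by omega)]
  · exact heq _ _
  · rw [delta_swap, neg_eq_zero]
    rcases lt_trichotomy i k with h2 | rfl | h2
    · exact h' j i k hj h1 h2 (by omega)
    · rw [delta_rotate, heq]
    · rcases lt_trichotomy j k with h3 | rfl | h3
      · rw [delta_swap', h' j k i hj h3 h2 (by omega), neg_zero]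
      · rw [← delta_rotate, heq]
      · rw [← delta_rotate, h' k j i hk h3 h1 (by omega)]

/-- `delta B` is invariant under `ad e₁`, if it vanishes on `e₁`. -/
lemma delta_shift (hx : AdSeq e (vec e)) {B : 𝔤 →ₗ[K] 𝔤 →ₗ[K] K} (hB : ∀ x y, B x y = - B y x)
    (hd1 : ∀ y z, delta B (vec e 1) y z = 0) {i j k : ℕ} (hi : 2 ≤ i) (hj : 2 ≤ j) (hk : 2 ≤ k) :
    ((i : K) - 1) * delta B (vec e (i + 1)) (vec e j) (vec e k)
      + (j - 1) * delta B (vec e i) (vec e (j + 1)) (vec e k)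
      + (k - 1) * delta B (vec e i) (vec e j) (vec e (k + 1)) = 0 := by
  have := delta_delta (vec e 1) (vec e i) (vec e j) (vec e k) hB
  have hd : ∀ y z, delta B y (vec e 1) z = 0 := fun y z => by rw [delta_swap, hd1, neg_zero]
  rw [hd, hd, hd, hx.ad i hi, hx.ad j hj, hx.ad k hk, delta_smul₁, delta_smul₁, delta_smul₁,
    delta_swap B (vec e i) (vec e (j + 1)), delta_rotate B (vec e (k + 1))] at this
  linear_combination this

/-- A closed form of degree three of low degree which is invariant under `ad e₁` vanishes, as soon as
it does on some particular triples of basis vectors. -/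
lemma delta_eq_zero_of_low [CharZero K] (hx : WittSeq e 1 (vec e)) {B : 𝔤 →ₗ[K] 𝔤 →ₗ[K] K}
    (hB : ∀ x y, B x y = - B y x) (hd1 : ∀ y z, delta B (vec e 1) y z = 0)
    (hd2 : ∀ k, 4 ≤ k → Even k → delta B (vec e 2) (vec e 3) (vec e k) = 0)
    (h345 : delta B (vec e 3) (vec e 4) (vec e 5) = 0)
    (h456 : delta B (vec e 4) (vec e 5) (vec e 6) = 0)
    (h16 : ∀ i j k, 2 ≤ i → i < j → j < k → 16 ≤ i + j + k →
      delta B (vec e i) (vec e j) (vec e k) = 0) (x y z : 𝔤) : delta B x y z = 0 := by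
  have heq : ∀ x y, delta B x x y = 0 := fun x y => self_eq_neg.1 (delta_swap B x x y)
  have heq' : ∀ x y, delta B y x x = 0 := fun x y => by rw [delta_rotate, heq]
  obtain ⟨J, hJ⟩ : ∃ J : ℕ → ℕ → ℕ → K, ∀ i j k, delta B (vec e i) (vec e j) (vec e k) = J i j k :=
    ⟨_, fun _ _ _ => rfl⟩
  have s : ∀ i j k : ℕ, 2 ≤ i → 2 ≤ j → 2 ≤ k →
      ((i : K) - 1) * J (i + 1) j k + (j - 1) * J i (j + 1) k + (k - 1) * J i j (k + 1) = 0 := by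
    intro i j k hi hj hk
    simpa only [hJ] using delta_shift hx.toAdSeq hB hd1 hi hj hk
  have z1 : ∀ i k, J i i k = 0 := fun i k => by rw [← hJ]; exact heq _ _
  have z2 : ∀ i k, J k i i = 0 := fun i k => by rw [← hJ]; exact heq' _ _
  have even : ∀ k, 4 ≤ k → Even k → J 2 3 k = 0 := fun k h1 h2 => by rw [← hJ]; exact hd2 k h1 h2
  rw [hJ] at h345 h456
  have red : ∀ {a b : K}, b ≠ 0 → b * a = 0 → a = 0 := fun hb h => (mul_eq_zero.1 h).resolve_left hb
  have a0 := even 10 (by norm_num) (by decide)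
  have a1 : J 3 5 7 = 0 := by
    have := s 3 5 6 (by norm_num) (by norm_num) (by norm_num)
    push_cast at this
    linear_combination (this - 2 * h456 - 4 * z2 6 3) / 5
  have a2 : J 2 4 9 = 0 := by
    have := s 2 3 9 (by norm_num) (by norm_num) (by norm_num)
    push_cast at this
    linear_combination (this - z1 3 9 - 8 * a0) / 2
  have a3 : J 3 4 8 = 0 := by
    have := s 3 4 7 (by norm_num) (by norm_num) (by norm_num)
    push_cast at this
    linear_combination (this - 2 * z1 4 7 - 3 * a1) / 6
  have a4 : J 2 5 8 = 0 := by
    have := s 2 4 8 (by norm_num) (by norm_num) (by norm_num)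
    push_cast at this
    linear_combination (this - a3 - 7 * a2) / 3
  have a5 : J 2 6 7 = 0 := by
    have := s 2 5 7 (by norm_num) (by norm_num) (by norm_num)
    push_cast at this
    linear_combination (this - a1 - 6 * a4) / 4
  have h15 : ∀ i j k, 2 ≤ i → i < j → j < k → 15 ≤ i + j + k → J i j k = 0 := by
    intro i j k hi hij hjk h
    rcases h.eq_or_lt with h | h
    · have : i ≤ 4 := by omega
      have : j ≤ 6 := by omega
      obtain rfl : k = 15 - i - j := by omega
      interval_cases i <;> interval_cases j <;> first | assumption | omega
    · rw [← hJ]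
      exact h16 i j k hi hij hjk h
  have d15 : ∀ i j k, 15 ≤ i + j + k → ∀ x ∈ flag e i, ∀ y ∈ flag e j, ∀ z ∈ flag e k,
      delta B x y z = 0 := fun i j k h x hx y hy z hz =>
    delta_eq_zero_of_sorted hd1 (fun i j k h1 h2 h3 h4 => by rw [hJ]; exact h15 i j k h1 h2 h3 h4)
      h hx hy hz
  have b0 : J 3 5 6 = -5 * J 2 5 7 := by
    have := s 2 5 6 (by norm_num) (by norm_num) (by norm_num)
    push_cast at this
    linear_combination this - 4 * z2 6 2
  have b1 : J 3 4 7 = 3 * J 2 5 7 := by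
    have := s 3 4 6 (by norm_num) (by norm_num) (by norm_num)
    push_cast at this
    linear_combination (this - 2 * z1 4 6 - 3 * b0) / 5
  have b2 : J 2 4 8 = - J 2 5 7 := by
    have := s 2 4 7 (by norm_num) (by norm_num) (by norm_num)
    push_cast at this
    linear_combination (this - b1) / 6
  have b3 : J 2 3 9 = 2 / 7 * J 2 5 7 := by
    have := s 2 3 8 (by norm_num) (by norm_num) (by norm_num)
    push_cast at this
    linear_combination (this - z1 3 8 - 2 * b2) / 7
  have b4 : J 2 5 7 = 0 := by
    have lead : ∀ i j k l, 2 ≤ i → 2 ≤ j → i + j + k + l = 14 →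
        delta B ⁅vec e i, vec e j⁆ (vec e k) (vec e l) = ((j : K) - i) * J (i + j) k l := by
      intro i j k l hi hj h
      have := d15 _ k l (by omega) _ (hx.err i j hi hj) _ (vec_mem_flag e le_rfl) _
        (vec_mem_flag e le_rfl)
      rw [delta_sub₁, delta_smul₁, hJ, sub_eq_zero] at this
      exact this
    have := delta_delta (vec e 2) (vec e 3) (vec e 4) (vec e 5) hB
    rw [lead _ _ _ _ (by norm_num) (by norm_num) (by norm_num),
      lead _ _ _ _ (by norm_num) (by norm_num) (by norm_num),
      lead _ _ _ _ (by norm_num) (by norm_num) (by norm_num),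
      lead _ _ _ _ (by norm_num) (by norm_num) (by norm_num),
      lead _ _ _ _ (by norm_num) (by norm_num) (by norm_num),
      lead _ _ _ _ (by norm_num) (by norm_num) (by norm_num)] at this
    have rot : ∀ i j k, J i j k = J j k i := fun i j k => by rw [← hJ, ← hJ, delta_rotate]
    have c1 : J 5 4 5 = 0 := by rw [rot, rot, z1]
    norm_num at this
    rw [c1, rot 6, rot 7, rot 7, rot 8, rot 9, b0, b1, b2, b3] at this
    refine red (b := (156 / 7 : K)) (by norm_num) ?_
    linear_combination this
  have c0 := even 8 (by norm_num) (by decide)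
  have c1 : J 2 4 7 = 0 := by
    have := s 2 3 7 (by norm_num) (by norm_num) (by norm_num)
    push_cast at this
    linear_combination (this - z1 3 7 - 6 * c0) / 2
  have c2 : J 3 4 6 = 0 := by
    have := s 3 4 5 (by norm_num) (by norm_num) (by norm_num)
    push_cast at this
    linear_combination (this - 2 * z1 4 5 - 3 * z2 5 3) / 4
  have c3 : J 2 5 6 = 0 := by
    have := s 2 4 6 (by norm_num) (by norm_num) (by norm_num)
    push_cast at this
    linear_combination (this - c2 - 5 * c1) / 3
  have f1 : J 2 4 6 = 0 := by
    have := s 2 4 5 (by norm_num) (by norm_num) (by norm_num)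
    push_cast at this
    linear_combination (this - h345 - 3 * z2 5 2) / 4
  have f2 : J 2 3 7 = 0 := by
    have := s 2 3 6 (by norm_num) (by norm_num) (by norm_num)
    push_cast at this
    linear_combination (this - z1 3 6 - 2 * f1) / 5
  have g0 := even 6 (by norm_num) (by decide)
  have g1 : J 2 4 5 = 0 := by
    have := s 2 3 5 (by norm_num) (by norm_num) (by norm_num)
    push_cast at this
    linear_combination (this - z1 3 5 - 4 * g0) / 2
  have k0 : J 2 3 5 = 0 := by
    have := s 2 3 4 (by norm_num) (by norm_num) (by norm_num)
    push_cast at this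
    linear_combination (this - z1 3 4 - 2 * z2 4 2) / 3
  have l0 := even 4 (by norm_num) (by decide)
  rw [b4] at b0 b1 b2 b3
  rw [mul_zero] at b0 b1 b3
  rw [neg_zero] at b2
  refine delta_eq_zero_of_sorted (N := 0) hd1 (fun i j k hi hij hjk _ => ?_) (Nat.zero_le (1 + 1 + 1))
    (mem_flag_one e x) (mem_flag_one e y) (mem_flag_one e z)
  rw [hJ]
  by_cases h : 15 ≤ i + j + k
  · exact h15 i j k hi hij hjk h
  · have : i ≤ 3 := by omega
    have : j ≤ 5 := by omega
    have : k ≤ 9 := by omega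
    interval_cases i <;> interval_cases j <;> interval_cases k <;> first | assumption | omega

end LowDegree

section AdaptedBasis

variable {K : Type*} [Field K] {𝔤 : Type*} [LieRing 𝔤] [LieAlgebra K 𝔤] {n : ℕ}
  {e : Module.Basis (Fin n) K 𝔤} {α : index n → K}

lemma mem_index_iff {k s : ℕ} : (k, s) ∈ index n ↔
    (2 ≤ k ∧ k ≤ n / 2 ∧ 2 * k + 1 ≤ s ∧ s ≤ n) ∨ (Even n ∧ k = n / 2 ∧ s = n) := by
  unfold index
  split_ifs with h
  · simp only [Finset.mem_union, Finset.mem_filter, Finset.mem_product, Finset.mem_Icc,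
      Finset.mem_singleton, Prod.mk.injEq]
    constructor
    · rintro (h1 | h1)
      · left; omega
      · exact Or.inr ⟨h, h1⟩
    · rintro (h1 | h1)
      · left; omega
      · exact Or.inr h1.2
  · simp only [Finset.mem_union, Finset.mem_filter, Finset.mem_product, Finset.mem_Icc,
      Finset.notMem_empty, or_false]
    constructor
    · intro h1
      left; omega
    · rintro (h1 | h1)
      · omega
      · exact absurd h1.1 h

lemma IsAdapted.lie_one' (he : IsAdapted e α) {i : ℕ} (hi : 2 ≤ i) :
    ⁅vec e 1, vec e i⁆ = vec e (i + 1) := by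
  rcases le_or_gt i n with h | h
  · exact he.lie_one i hi h
  · rw [vec_eq_zero e h, vec_eq_zero e (show n < i + 1 by omega), lie_zero]

lemma IsAdapted.vec_mem_lcs (he : IsAdapted e α) (i : ℕ) : vec e (i + 2) ∈ lcs K 𝔤 i := by
  induction i with
  | zero => simp [lcs]
  | succ i ih =>
    rw [show i + 1 + 2 = i + 2 + 1 by ring, ← he.lie_one' (by omega)]
    change _ ∈ lowerCentralSeries K 𝔤 𝔤 (i + 1)
    rw [lowerCentralSeries_succ]
    exact LieSubmodule.lie_mem_lie (LieSubmodule.mem_top _) ih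

lemma IsAdapted.flag_le_lcs (he : IsAdapted e α) (i : ℕ) :
    flag e (i + 2) ≤ (lcs K 𝔤 i).toSubmodule := by
  refine flag_le_of e fun j hj => ?_
  obtain ⟨d, rfl⟩ := Nat.exists_eq_add_of_le hj
  have h := he.vec_mem_lcs (i + d)
  rw [show i + d + 2 = i + 2 + d by ring] at h
  exact antitone_lowerCentralSeries K 𝔤 𝔤 (Nat.le_add_right i d) h

/-- The structure constant `α_{n/2,n}` vanishes by property (c). -/
lemma IsAdapted.apply_eq_zero (he : IsAdapted e α) (hc : PropC K 𝔤 n) (hn : 12 ≤ n) (q : index n)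
    (hq : q.1.2 ≤ 2 * q.1.1) : α q = 0 := by
  obtain ⟨⟨k, s⟩, hmem⟩ := q
  rcases mem_index_iff.1 hmem with h | ⟨hev, rfl, hs⟩
  · simp only at hq; omega
  replace hs := hs.symm
  subst hs
  obtain ⟨m, hm⟩ := hev
  have h2 : n / 2 = m := by omega
  have h3 : (n - 4) / 2 = m - 2 := by omega
  have h := hc ⟨m, hm⟩ (vec e m) (by
      have := he.vec_mem_lcs (m - 2)
      rwa [h3, ← show m - 2 + 2 = m by omega]) (vec e (m + 1)) (by
      have := he.vec_mem_lcs (m - 2 + 1)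
      rw [h3]
      rw [show m - 2 + 1 + 2 = m + 1 by omega] at this
      exact antitone_lowerCentralSeries K 𝔤 𝔤 (Nat.le_succ _) this)
  rw [he.lie m (m + 1) (by omega) (by omega) (by omega),
    Finset.sum_eq_single (⟨(n / 2, n), hmem⟩ : index n)] at h
  · rw [psi, if_pos ⟨show m ≤ n / 2 by omega, show n / 2 < m + 1 by omega⟩] at h
    have h4 : m + 1 - n / 2 - 1 = 0 := by omega
    have h5 : n / 2 - m = 0 := by omega
    simp only [h4, h5] at h
    have h6 : vec e n ≠ 0 := by
      rw [vec, dif_pos ⟨by omega, le_rfl⟩]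
      exact e.ne_zero _
    simpa [h6] using h
  · rintro ⟨⟨k, s⟩, hks⟩ _ hne
    rw [psi]
    split_ifs with h7
    · exfalso
      simp only at h7
      rcases mem_index_iff.1 hks with h8 | ⟨_, h8, h9⟩
      · omega
      · exact hne (by simp only [h8, h9])
    · rw [smul_zero]
  · simp

variable (he : IsAdapted e α) (hα : ∀ q : index n, q.1.2 ≤ 2 * q.1.1 → α q = 0)
include hα

lemma smul_psi_mem (q : index n) (i j : ℕ) : α q • psi e q.1.1 q.1.2 i j ∈ flag e (i + j) := by
  by_cases hq : q.1.2 ≤ 2 * q.1.1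
  · rw [hα q hq, zero_smul]
    exact zero_mem _
  refine Submodule.smul_mem _ _ ?_
  rw [psi]
  split_ifs with h
  · rcases lt_or_ge (j - q.1.1 - 1) (q.1.1 - i) with h1 | h1
    · rw [Nat.choose_eq_zero_of_lt h1, Nat.cast_zero, mul_zero, zero_smul]
      exact zero_mem _
    · exact Submodule.smul_mem _ _ (vec_mem_flag e (by omega))
  · exact zero_mem _

include he

lemma IsAdapted.lie_vec_mem {i j : ℕ} (hi : 1 ≤ i) (hj : 1 ≤ j) :
    ⁅vec e i, vec e j⁆ ∈ flag e (i + j) := by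
  wlog hij : i ≤ j generalizing i j with H
  · rw [← lie_skew, add_comm]
    exact neg_mem (H hj hi (by omega))
  rcases hij.eq_or_lt with rfl | hij
  · rw [lie_self]; exact zero_mem _
  rcases lt_or_ge n j with hn | hn
  · rw [vec_eq_zero e hn, lie_zero]; exact zero_mem _
  rcases hi.eq_or_lt with rfl | hi
  · rw [he.lie_one' hij, add_comm]; exact vec_mem_flag e le_rfl
  rw [he.lie i j hi hij hn]
  exact sum_mem fun q _ => smul_psi_mem hα q i j

lemma IsAdapted.lieFlag : LieFlag e := by
  intro i j hi hj x hx y hy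
  have h1 : ∀ p, i ≤ p → ⁅vec e p, y⁆ ∈ flag e (i + j) := by
    intro p hp
    refine (flag_le_of e (S := (flag e (i + j)).comap (LieAlgebra.ad K 𝔤 (vec e p)))
      fun q hq => ?_) hy
    exact flag_anti e (by omega) (he.lie_vec_mem hα (show 1 ≤ p by omega) (show 1 ≤ q by omega))
  have h2 : ⁅y, x⁆ ∈ flag e (i + j) := by
    refine (flag_le_of e (S := (flag e (i + j)).comap (LieAlgebra.ad K 𝔤 y)) fun p hp => ?_) hx
    change ⁅y, vec e p⁆ ∈ flag e (i + j)
    rw [← lie_skew]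
    exact neg_mem (h1 p hp)
  rw [← lie_skew]
  exact neg_mem h2

lemma IsAdapted.lie_succ_sub_mem {k : ℕ} (hk : 2 ≤ k) (hkn : 2 * k + 1 ≤ n)
    (hmem : (k, 2 * k + 1) ∈ index n) :
    ⁅vec e k, vec e (k + 1)⁆ - α ⟨(k, 2 * k + 1), hmem⟩ • vec e (2 * k + 1)
      ∈ flag e (2 * k + 1 + 1) := by
  rw [he.lie k (k + 1) hk (by omega) (by omega),
    ← Finset.add_sum_erase _ _ (Finset.mem_univ (⟨(k, 2 * k + 1), hmem⟩ : index n))]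
  have h1 : psi e k (2 * k + 1) k (k + 1) = vec e (2 * k + 1) := by
    simp [psi]
  rw [h1, add_sub_cancel_left]
  refine sum_mem fun q hq => ?_
  obtain ⟨⟨k', s⟩, hks⟩ := q
  by_cases hs : s ≤ 2 * k'
  · rw [hα _ hs, zero_smul]
    exact zero_mem _
  refine Submodule.smul_mem _ _ ?_
  rw [psi]
  split_ifs with h
  · refine Submodule.smul_mem _ _ (vec_mem_flag e ?_)
    have hkk : k' = k := by simp only at h; omega
    subst hkk
    have : s ≠ 2 * k' + 1 := by
      rintro rfl
      exact (Finset.mem_erase.1 hq).1 rfl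
    simp only
    omega
  · exact zero_mem _

lemma IsAdapted.lcs_one_le : (lcs K 𝔤 1).toSubmodule ≤ flag e 3 := by
  have hF := he.lieFlag hα
  have : ∀ x y : 𝔤, ⁅x, y⁆ ∈ flag e 3 := by
    intro x y
    obtain ⟨c, hc⟩ := exists_sub_smul_vec_mem e (mem_flag_one e x)
    obtain ⟨d, hd⟩ := exists_sub_smul_vec_mem e (mem_flag_one e y)
    have h1 := hF 2 1 (by norm_num) le_rfl _ hc _ (mem_flag_one e y)
    have h2 := hF 1 2 le_rfl (by norm_num) _ (Submodule.smul_mem _ c (vec_mem_flag e le_rfl)) _ hd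
    have := add_mem h1 h2
    simpa [sub_lie, lie_sub] using this
  change (lowerCentralSeries K 𝔤 𝔤 (0 + 1)).toSubmodule ≤ _
  rw [lowerCentralSeries_succ, LieSubmodule.lieIdeal_oper_eq_linear_span', Submodule.span_le]
  rintro _ ⟨x, _, y, _, rfl⟩
  exact this x y

omit hα he in
lemma finrank_quotient_flag_two (hn : 1 ≤ n) : Module.finrank K (𝔤 ⧸ flag e 2) = 1 := by
  have hker : flag e 2 = LinearMap.ker (coord e 1) := by
    refine le_antisymm (fun y hy => coord_eq_zero_of_mem_flag e (by norm_num) hy) fun y hy => ?_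
    obtain ⟨c, hc⟩ := exists_sub_smul_vec_mem e (mem_flag_one e y)
    have h := coord_eq_zero_of_mem_flag e (show 1 < 2 by norm_num) hc
    rw [map_sub, map_smul, coord_vec e le_rfl hn, if_pos rfl, LinearMap.mem_ker.1 hy] at h
    have hc0 : c = 0 := by simpa using h
    simpa [hc0] using hc
  have hsurj : Function.Surjective (coord e 1) := fun c =>
    ⟨c • vec e 1, by rw [map_smul, coord_vec e le_rfl hn, if_pos rfl, smul_eq_mul, mul_one]⟩
  rw [hker, ((coord e 1).quotKerEquivOfSurjective hsurj).finrank_eq, Module.finrank_self]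

lemma IsAdapted.alpha_two_ne_zero (hn : 12 ≤ n) (hb : PropB K 𝔤) (hmem : (2, 5) ∈ index n) :
    α ⟨(2, 5), hmem⟩ ≠ 0 := by
  intro h0
  have hF := he.lieFlag hα
  have h23 := he.lie_succ_sub_mem hα (k := 2) le_rfl (by omega) hmem
  rw [h0, zero_smul, sub_zero] at h23
  refine hb ⟨flag e 2, finrank_quotient_flag_two (by omega),
    (he.lcs_one_le hα).trans (flag_anti e (by norm_num)), fun x hx y hy =>
      he.flag_le_lcs 4 ?_⟩
  replace hy := he.lcs_one_le hα hy
  obtain ⟨c, hc⟩ := exists_sub_smul_vec_mem e hx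
  obtain ⟨d, hd⟩ := exists_sub_smul_vec_mem e hy
  have h1 := hF 3 3 (by norm_num) (by norm_num) _ hc _ hy
  have h2 := hF 2 4 (by norm_num) (by norm_num) _ (Submodule.smul_mem _ c (vec_mem_flag e le_rfl))
    _ hd
  have h3 := Submodule.smul_mem _ (c * d) h23
  convert add_mem (add_mem h1 h2) h3 using 1
  simp only [sub_lie, lie_sub, smul_lie, lie_smul]
  module

lemma IsAdapted.alpha_three_ne_zero (hn : 12 ≤ n) (hd : ¬ PropD K 𝔤) (hmem : (3, 7) ∈ index n) :
    α ⟨(3, 7), hmem⟩ ≠ 0 := by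
  intro h0
  have hF := he.lieFlag hα
  have h34 := he.lie_succ_sub_mem hα (k := 3) (by norm_num) (by omega) hmem
  rw [h0, zero_smul, sub_zero] at h34
  have key : ∀ y ∈ flag e 4, ⁅vec e 3, y⁆ ∈ flag e 8 := by
    intro y hy
    obtain ⟨c, hc⟩ := exists_sub_smul_vec_mem e hy
    have h1 := hF 3 5 (by norm_num) (by norm_num) _ (vec_mem_flag e le_rfl) _ hc
    have := add_mem h1 (Submodule.smul_mem _ c h34)
    simpa [lie_sub] using this
  refine hd fun x hx y hy => he.flag_le_lcs 6 ?_
  replace hx := he.lcs_one_le hα hx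
  replace hy := he.lcs_one_le hα hy
  obtain ⟨c, hc⟩ := exists_sub_smul_vec_mem e hx
  obtain ⟨d, hd⟩ := exists_sub_smul_vec_mem e hy
  have h1 := hF 4 4 (by norm_num) (by norm_num) _ hc _ hd
  have h2 := Submodule.smul_mem _ c (key _ hd)
  have h3 := Submodule.smul_mem _ d (key _ hc)
  convert sub_mem (add_mem h1 h2) h3 using 1
  simp only [sub_lie, lie_sub, smul_lie, lie_smul, lie_self]
  rw [← lie_skew x (vec e 3)]
  module

omit hα he

/-- The basis vectors normalised as in the Witt algebra. -/
def normSeq (e : Module.Basis (Fin n) K 𝔤) (a : K) (i : ℕ) : 𝔤 :=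
  (if i = 1 then 1 else (6 * a * ((i - 2).factorial : K))⁻¹) • vec e i

lemma normSeq_one (a : K) : normSeq e a 1 = vec e 1 := by simp [normSeq]

lemma normSeq_add_two (a : K) (i : ℕ) :
    normSeq e a (i + 2) = (6 * a * (i.factorial : K))⁻¹ • vec e (i + 2) := by simp [normSeq]

variable [CharZero K]

lemma norm_ne_zero {a : K} (ha : a ≠ 0) (i : ℕ) : 6 * a * (i.factorial : K) ≠ 0 :=
  mul_ne_zero (mul_ne_zero (by norm_num) ha) (Nat.cast_ne_zero.2 i.factorial_ne_zero)

lemma vec_add_two {a : K} (ha : a ≠ 0) (i : ℕ) :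
    vec e (i + 2) = (6 * a * (i.factorial : K)) • normSeq e a (i + 2) := by
  rw [normSeq_add_two, smul_smul, mul_inv_cancel₀ (norm_ne_zero ha i), one_smul]

lemma IsAdapted.adSeq (he : IsAdapted e α) {a : K} (ha : a ≠ 0) : AdSeq e (normSeq e a) where
  mem i := Submodule.smul_mem _ _ (vec_mem_flag e le_rfl)
  top i hi y hy := by
    obtain ⟨c, hc⟩ := exists_sub_smul_vec_mem e hy
    rcases hi.eq_or_lt with rfl | hi
    · exact ⟨c, by rwa [normSeq_one]⟩
    · obtain ⟨i, rfl⟩ := Nat.exists_eq_add_of_le' hi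
      refine ⟨c * (6 * a * (i.factorial : K)), ?_⟩
      rwa [← smul_smul, ← vec_add_two ha]
  ad i hi := by
    obtain ⟨i, rfl⟩ := Nat.exists_eq_add_of_le' hi
    rw [normSeq_one, normSeq_add_two, show i + 2 + 1 = i + 1 + 2 by ring, normSeq_add_two, lie_smul,
      he.lie_one' (by omega), smul_smul, Nat.factorial_succ]
    congr 1
    have := norm_ne_zero ha i
    have h1 : (i : K) + 1 ≠ 0 := Nat.cast_add_one_ne_zero i
    have h2 : (i.factorial : K) ≠ 0 := Nat.cast_ne_zero.2 i.factorial_ne_zero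
    push_cast
    field_simp
    ring

lemma IsAdapted.wittSeq (he : IsAdapted e α) (hα : ∀ q : index n, q.1.2 ≤ 2 * q.1.1 → α q = 0)
    (hn : 12 ≤ n) (h25 : (2, 5) ∈ index n) (h37 : (3, 7) ∈ index n)
    (ha : α ⟨(2, 5), h25⟩ ≠ 0) (hb : α ⟨(3, 7), h37⟩ ≠ 0) :
    WittSeq e 1 (normSeq e (α ⟨(2, 5), h25⟩)) := by
  have hF := he.lieFlag hα
  have hx := he.adSeq ha
  have h23 := he.lie_succ_sub_mem hα (k := 2) le_rfl (by omega) h25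
  have h34 := he.lie_succ_sub_mem hα (k := 3) (by norm_num) (by omega) h37
  obtain ⟨φ, hφ⟩ := hx.exists_lead hF
  generalize α ⟨(2, 5), h25⟩ = a at *
  generalize α ⟨(3, 7), h37⟩ = b at *
  have v2 : vec e 2 = (6 * a) • normSeq e a 2 := by simpa using vec_add_two (e := e) ha 0
  have v3 : vec e 3 = (6 * a) • normSeq e a 3 := by simpa using vec_add_two (e := e) ha 1
  have v4 : vec e 4 = (12 * a) • normSeq e a 4 := by
    rw [show (12 : K) * a = 6 * a * ((2).factorial : K) by norm_num [Nat.factorial]; ring]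
    exact vec_add_two ha 2
  have v5 : vec e 5 = (36 * a) • normSeq e a 5 := by
    rw [show (36 : K) * a = 6 * a * ((3).factorial : K) by norm_num [Nat.factorial]; ring]
    exact vec_add_two ha 3
  have m23 := hφ.mkQ (i := 2) (j := 3) (m := 5) le_rfl (by norm_num) rfl
  have m34 := hφ.mkQ (i := 3) (j := 4) (m := 7) (by norm_num) (by norm_num) rfl
  have c23 : (36 * a ^ 2) * (φ 2 3 - 1) = 0 := by
    apply hx.coeff_eq_zero (m := 5) (by norm_num) (by omega)
    rw [← mkQ_eq_zero_iff, map_smul]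
    change ⁅vec e 2, vec e 3⁆ - a • vec e 5 ∈ flag e (5 + 1) at h23
    rw [← mkQ_eq_iff, map_smul, v2, v3, v5] at h23
    simp only [smul_lie, lie_smul, map_smul] at h23
    rw [m23] at h23
    linear_combination (norm := module) h23
  have c34 : φ 3 4 ≠ 0 := by
    intro h0
    change ⁅vec e 3, vec e 4⁆ - b • vec e 7 ∈ flag e (7 + 1) at h34
    rw [h0, zero_smul] at m34
    rw [← mkQ_eq_iff, v3, v4] at h34
    simp only [smul_lie, lie_smul, map_smul] at h34
    rw [m34, smul_zero, smul_zero] at h34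
    have h7 : b • vec e 7 ∈ flag e (7 + 1) := by
      rw [← mkQ_eq_zero_iff, map_smul, ← h34]
    have := coord_eq_zero_of_mem_flag e (show 7 < 7 + 1 by norm_num) h7
    rw [map_smul, coord_vec e (by norm_num) (by omega), if_pos rfl, smul_eq_mul, mul_one] at this
    exact hb this
  refine wittSeq_one_of_lead hn hF hx hφ ?_ c34
  have := (mul_eq_zero.1 c23).resolve_left (by simp [ha])
  linear_combination this

lemma ClassA2.wittSeq (hg : ClassA2 K 𝔤 n) (he : IsAdapted e α) (h25 : (2, 5) ∈ index n) :
    α ⟨(2, 5), h25⟩ ≠ 0 ∧ LieFlag e ∧ WittSeq e 1 (normSeq e (α ⟨(2, 5), h25⟩)) := by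
  have hn := hg.le
  have hα := he.apply_eq_zero hg.propC hn
  have h37 : (3, 7) ∈ index n := mem_index_iff.2 (Or.inl (by omega))
  have ha := he.alpha_two_ne_zero hα hn hg.propB h25
  exact ⟨ha, he.lieFlag hα, he.wittSeq hα hn h25 h37 ha
    (he.alpha_three_ne_zero hα hn hg.not_propD h37)⟩

end AdaptedBasis

section Regular

variable {K : Type*} [Field K] {σ : Type*} (q₀ : σ)

/-- Functions of the variables `α` which are polynomials up to a power of `α q₀` in the
denominator. -/
def IsRegular (f : (σ → K) → K) : Prop :=
  ∃ (N : ℕ) (p : MvPolynomial σ K), ∀ α : σ → K, α q₀ ≠ 0 → MvPolynomial.eval α p = α q₀ ^ N * f α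

variable {q₀} {f g : (σ → K) → K}

lemma isRegular_const (c : K) : IsRegular q₀ fun _ => c := ⟨0, MvPolynomial.C c, by simp⟩

lemma isRegular_apply (q : σ) : IsRegular q₀ fun α : σ → K => α q :=
  ⟨0, MvPolynomial.X q, by simp⟩

lemma isRegular_inv : IsRegular q₀ fun α : σ → K => (α q₀)⁻¹ :=
  ⟨1, MvPolynomial.C 1, fun α h => by simp [h]⟩

namespace IsRegular

lemma mul (hf : IsRegular q₀ f) (hg : IsRegular q₀ g) : IsRegular q₀ fun α => f α * g α := by
  obtain ⟨N, p, hp⟩ := hf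
  obtain ⟨M, r, hr⟩ := hg
  refine ⟨N + M, p * r, fun α h => ?_⟩
  rw [map_mul, hp α h, hr α h, pow_add]
  ring

lemma add (hf : IsRegular q₀ f) (hg : IsRegular q₀ g) : IsRegular q₀ fun α => f α + g α := by
  obtain ⟨N, p, hp⟩ := hf
  obtain ⟨M, r, hr⟩ := hg
  refine ⟨N + M, MvPolynomial.X q₀ ^ M * p + MvPolynomial.X q₀ ^ N * r, fun α h => ?_⟩
  simp only [map_add, map_mul, map_pow, MvPolynomial.eval_X]
  rw [hp α h, hr α h, pow_add]
  ring

lemma neg (hf : IsRegular q₀ f) : IsRegular q₀ fun α => - f α := by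
  simpa using (isRegular_const (q₀ := q₀) (-1)).mul hf

lemma sub (hf : IsRegular q₀ f) (hg : IsRegular q₀ g) : IsRegular q₀ fun α => f α - g α := by
  simpa [sub_eq_add_neg] using hf.add hg.neg

lemma sum {ι : Type*} (s : Finset ι) {f : ι → (σ → K) → K} (hf : ∀ i ∈ s, IsRegular q₀ (f i)) :
    IsRegular q₀ fun α => ∑ i ∈ s, f i α := by
  classical
  induction s using Finset.induction_on with
  | empty => simpa using isRegular_const (q₀ := q₀) (0 : K)
  | insert a s ha ih =>
    simp only [Finset.sum_insert ha]
    exact (hf a (Finset.mem_insert_self a s)).add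
      (ih fun i hi => hf i (Finset.mem_insert_of_mem hi))

end IsRegular

end Regular

section StructureConstants

variable {K : Type*} [Field K] {n : ℕ}

/-- The coefficient of `e_t` in `ψ_{k,s}(e_i ∧ e_j)`. -/
def psiCoeff (K : Type*) [Field K] (k s i j t : ℕ) : K :=
  if i ≤ k ∧ k < j then
    if s + ((j - k - 1) - (k - i)) = t then
      (-1 : K) ^ (k - i) * ((j - k - 1).choose (k - i) : K) else 0
  else 0

/-- The coefficient of `e_t` in `[e_i, e_j]`, as a function of the structure constants. -/
def lieCoeff (α : index n → K) (i j t : ℕ) : K :=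
  if i < j then ∑ q : index n, α q * psiCoeff K q.1.1 q.1.2 i j t
  else if j < i then - ∑ q : index n, α q * psiCoeff K q.1.1 q.1.2 j i t
  else 0

lemma lieCoeff_skew (α : index n → K) (i j t : ℕ) : lieCoeff α i j t = - lieCoeff α j i t := by
  unfold lieCoeff
  rcases lt_trichotomy i j with h | rfl | h
  · simp [h, h.not_gt]
  · simp
  · simp [h, h.not_gt]

lemma isRegular_lieCoeff (q₀ : index n) (i j t : ℕ) :
    IsRegular q₀ fun α : index n → K => lieCoeff α i j t := by
  unfold lieCoeff
  split_ifs
  · exact .sum _ fun q _ => (isRegular_apply q).mul (isRegular_const _)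
  · exact (IsRegular.sum _ fun q _ => (isRegular_apply q).mul (isRegular_const _)).neg
  · exact isRegular_const 0

/-- The value of `delta` on basis vectors, as a function of the structure constants. -/
def deltaCoeff (α : index n → K) (b : ℕ → ℕ → K) (i j k : ℕ) : K :=
  ∑ s ∈ Finset.Icc 1 n,
    (lieCoeff α i j s * b s k + lieCoeff α j k s * b s i + lieCoeff α k i s * b s j)

lemma isRegular_deltaCoeff {q₀ : index n} {b : (index n → K) → ℕ → ℕ → K}
    (hb : ∀ i j, IsRegular q₀ fun α => b α i j) (i j k : ℕ) :
    IsRegular q₀ fun α => deltaCoeff α (b α) i j k :=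
  .sum _ fun s _ => (((isRegular_lieCoeff q₀ i j s).mul (hb s k)).add
    ((isRegular_lieCoeff q₀ j k s).mul (hb s i))).add ((isRegular_lieCoeff q₀ k i s).mul (hb s j))

variable {𝔤 : Type*} [LieRing 𝔤] [LieAlgebra K 𝔤] {e : Module.Basis (Fin n) K 𝔤} {α : index n → K}

lemma IsAdapted.coord_lie (he : IsAdapted e α) {i j t : ℕ} (hi : 2 ≤ i) (hin : i ≤ n) (hj : 2 ≤ j)
    (hjn : j ≤ n) (ht : 1 ≤ t) (htn : t ≤ n) :
    coord e t ⁅vec e i, vec e j⁆ = lieCoeff α i j t := by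
  wlog hij : i ≤ j generalizing i j with H
  · rw [← lie_skew, map_neg, H hj hjn hi hin (by omega), ← lieCoeff_skew]
  rcases hij.eq_or_lt with rfl | hij
  · simp [lieCoeff]
  rw [he.lie i j hi hij hjn, map_sum, lieCoeff, if_pos hij]
  refine Finset.sum_congr rfl fun q _ => ?_
  rw [map_smul, psi, psiCoeff, smul_eq_mul]
  split_ifs with h1 h2
  · rw [map_smul, coord_vec e ht htn, if_pos h2, smul_eq_mul, mul_one]
  · rw [map_smul, coord_vec e ht htn, if_neg h2, smul_zero]
  · rw [map_zero]

lemma IsAdapted.delta_formOf (he : IsAdapted e α) (b : ℕ → ℕ → K) {i j k : ℕ} (hi : 2 ≤ i)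
    (hin : i ≤ n) (hj : 2 ≤ j) (hjn : j ≤ n) (hk : 2 ≤ k) (hkn : k ≤ n) :
    delta (formOf e b) (vec e i) (vec e j) (vec e k) = deltaCoeff α b i j k := by
  have key : ∀ i j k, 2 ≤ i → i ≤ n → 2 ≤ j → j ≤ n → 2 ≤ k → k ≤ n →
      formOf e b ⁅vec e i, vec e j⁆ (vec e k) = ∑ s ∈ Finset.Icc 1 n, lieCoeff α i j s * b s k := by
    intro i j k hi hin hj hjn hk hkn
    conv_lhs => rw [eq_sum_coord e ⁅vec e i, vec e j⁆]
    rw [map_sum, LinearMap.sum_apply]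
    refine Finset.sum_congr rfl fun s hs => ?_
    rw [Finset.mem_Icc] at hs
    rw [map_smul, LinearMap.smul_apply, smul_eq_mul, he.coord_lie hi hin hj hjn hs.1 hs.2,
      formOf_vec e b hs.1 hs.2 (by omega) hkn]
  rw [delta, key i j k hi hin hj hjn hk hkn, key j k i hj hjn hk hkn hi hin,
    key k i j hk hkn hi hin hj hjn, deltaCoeff, Finset.sum_add_distrib, Finset.sum_add_distrib]

end StructureConstants

section UniversalForm

variable {K : Type*} [Field K] {n : ℕ}
  {𝔤 : Type*} [LieRing 𝔤] [LieAlgebra K 𝔤] {e : Module.Basis (Fin n) K 𝔤} {α : index n → K}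

/-- A skew form `B` with `B(e₁, ·) = e_n^*` and such that `d B` vanishes on `e₁`. -/
structure IsNormalized (e : Module.Basis (Fin n) K 𝔤) (B : 𝔤 →ₗ[K] 𝔤 →ₗ[K] K) : Prop where
  skew : ∀ x y, B x y = - B y x
  one : ∀ y, B (vec e 1) y = coord e n y
  closed : ∀ y z, delta B (vec e 1) y z = 0

lemma delta_one_eq_zero [CharZero K] {B : 𝔤 →ₗ[K] 𝔤 →ₗ[K] K}
    (h : ∀ i j, 2 ≤ i → i ≤ n → 2 ≤ j → j ≤ n → delta B (vec e 1) (vec e i) (vec e j) = 0)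
    (y z : 𝔤) : delta B (vec e 1) y z = 0 := by
  have heq : ∀ x y, delta B x x y = 0 := fun x y => self_eq_neg.1 (delta_swap B x x y)
  have h0 : ∀ i j, 1 ≤ i → 1 ≤ j → delta B (vec e 1) (vec e i) (vec e j) = 0 := by
    intro i j hi hj
    rcases hi.eq_or_lt with rfl | hi
    · exact heq _ _
    rcases hj.eq_or_lt with rfl | hj
    · rw [← delta_rotate, heq]
    rcases lt_or_ge n i with hn | hn
    · rw [vec_eq_zero e hn, delta_zero₂]
    rcases lt_or_ge n j with hn' | hn'
    · rw [vec_eq_zero e hn', delta_zero₃]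
    exact h i j hi hn hj hn'
  have h1 : ∀ j, 1 ≤ j → delta B (vec e 1) y (vec e j) = 0 := by
    intro j hj
    rw [delta_rotate]
    refine (flag_le_of e (S := LinearMap.ker (deltaLin B (vec e j) (vec e 1))) fun i hi => ?_)
      (mem_flag_one e y)
    change delta B _ _ _ = 0
    rw [← delta_rotate]
    exact h0 i j hi hj
  rw [← delta_rotate]
  refine (flag_le_of e (S := LinearMap.ker (deltaLin B (vec e 1) y)) fun j hj => ?_)
    (mem_flag_one e z)
  change delta B _ _ _ = 0
  rw [delta_rotate]
  exact h1 j hj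

/-- For `B(e₁, ·) = c e_n^*`, the value of `d B` on `e₁ ∧ e_i ∧ e_j`. -/
lemma IsAdapted.delta_one (he : IsAdapted e α) {B : 𝔤 →ₗ[K] 𝔤 →ₗ[K] K}
    (hB : ∀ x y, B x y = - B y x) {c : K} (h1 : ∀ y, B (vec e 1) y = c * coord e n y) {i j : ℕ}
    (hi : 2 ≤ i) (hj : 2 ≤ j) : delta B (vec e 1) (vec e i) (vec e j)
      = B (vec e (i + 1)) (vec e j) + B (vec e i) (vec e (j + 1))
        - c * coord e n ⁅vec e i, vec e j⁆ := by
  rw [delta, he.lie_one' hi, ← lie_skew (vec e j), he.lie_one' hj, hB ⁅vec e i, vec e j⁆, h1,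
    map_neg, LinearMap.neg_apply, ← hB (vec e i)]
  ring

/-- A solution of `b (i+1) j + b i (j+1) = [e_i, e_j]_n`. -/
def initialTable (α : index n → K) (i j : ℕ) : K :=
  if i = 1 then (if j = n then 1 else 0) else if j = 1 then (if i = n then -1 else 0) else
    ∑ t ∈ Finset.range ((j - i) / 2), (-1) ^ t * lieCoeff α (i + t) (j - 1 - t) n -
    ∑ t ∈ Finset.range ((i - j) / 2), (-1) ^ t * lieCoeff α (j + t) (i - 1 - t) n

lemma isRegular_initialTable (q₀ : index n) (i j : ℕ) :
    IsRegular q₀ fun α : index n → K => initialTable α i j := by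
  unfold initialTable
  split_ifs
  · exact isRegular_const _
  · exact isRegular_const _
  · exact isRegular_const _
  · exact isRegular_const _
  · exact (IsRegular.sum _ fun t _ => (isRegular_const _).mul (isRegular_lieCoeff q₀ _ _ _)).sub
      (IsRegular.sum _ fun t _ => (isRegular_const _).mul (isRegular_lieCoeff q₀ _ _ _))

lemma initialTable_skew (hn : 2 ≤ n) (α : index n → K) (i j : ℕ) :
    initialTable α i j = - initialTable α j i := by
  unfold initialTable
  by_cases hi : i = 1
  · by_cases hj : j = 1
    · simp [hi, hj, show 1 ≠ n by omega]
    · simp only [hi, hj, if_true, if_false]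
      split_ifs <;> simp
  · by_cases hj : j = 1
    · simp only [hi, hj, if_true, if_false]
      split_ifs <;> simp
    · simp only [hi, hj, if_false]
      ring

lemma initialTable_shift (α : index n → K) {i j : ℕ} (hi : 2 ≤ i) (hij : i < j) :
    initialTable α (i + 1) j + initialTable α i (j + 1) = lieCoeff α i j n := by
  unfold initialTable
  rw [if_neg (by omega), if_neg (by omega), if_neg (by omega), if_neg (by omega),
    show (i + 1 - j) / 2 = 0 by omega, show (i - (j + 1)) / 2 = 0 by omega,
    show (j + 1 - i) / 2 = (j - (i + 1)) / 2 + 1 by omega, Finset.sum_range_succ']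
  simp only [Finset.range_zero, Finset.sum_empty, sub_zero, pow_zero, one_mul, add_zero,
    add_tsub_cancel_right, pow_succ]
  rw [← add_assoc, ← Finset.sum_add_distrib, Finset.sum_eq_zero, zero_add]
  · rfl
  intro t _
  rw [show i + 1 + t = i + (t + 1) by ring, show j - 1 - t = j - (t + 1) by omega]
  ring

lemma IsAdapted.initialTable_eq_zero (he : IsAdapted e α) (hF : LieFlag e) {i j : ℕ}
    (hi : 2 ≤ i) (hin : i ≤ n) (hj : 2 ≤ j) (hjn : j ≤ n) (hij : n + 2 ≤ i + j) :
    initialTable α i j = 0 := by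
  have key : ∀ i j, 2 ≤ i → i ≤ n → 2 ≤ j → j ≤ n → n < i + j → lieCoeff α i j n = 0 := by
    intro i j hi hin hj hjn hij
    rw [← he.coord_lie hi hin hj hjn (by omega) le_rfl]
    exact coord_eq_zero_of_mem_flag e hij (hF i j (by omega) (by omega) _ (vec_mem_flag e le_rfl) _
      (vec_mem_flag e le_rfl))
  unfold initialTable
  rw [if_neg (by omega), if_neg (by omega), Finset.sum_eq_zero, Finset.sum_eq_zero, sub_zero]
  · intro t ht
    rw [Finset.mem_range] at ht
    rw [key _ _ (by omega) (by omega) (by omega) (by omega) (by omega), mul_zero]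
  · intro t ht
    rw [Finset.mem_range] at ht
    rw [key _ _ (by omega) (by omega) (by omega) (by omega) (by omega), mul_zero]

lemma IsAdapted.initial_high (he : IsAdapted e α) (hF : LieFlag e) {i j : ℕ}
    (hi : 2 ≤ i) (hj : 2 ≤ j) (hij : n + 2 ≤ i + j) :
    formOf e (initialTable α) (vec e i) (vec e j) = 0 := by
  rcases lt_or_ge n i with h | h
  · rw [vec_eq_zero e h, map_zero, LinearMap.zero_apply]
  rcases lt_or_ge n j with h' | h'
  · rw [vec_eq_zero e h', map_zero]
  rw [formOf_vec e _ (by omega) h (by omega) h', he.initialTable_eq_zero hF hi h hj h' hij]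

lemma IsAdapted.isNormalized_initial [CharZero K] (he : IsAdapted e α) (hF : LieFlag e)
    (hn : 2 ≤ n) : IsNormalized e (formOf e (initialTable α)) := by
  have hsk := formOf_skew e (initialTable_skew hn α)
  have hone : ∀ y, formOf e (initialTable α) (vec e 1) y = coord e n y := by
    intro y
    suffices h : formOf e (initialTable α) (vec e 1) = coord e n by rw [h]
    refine e.ext fun i => ?_
    have := i.2
    rw [← vec_succ, formOf_vec e _ le_rfl (by omega) (by omega) (by omega),
      coord_vec e (by omega) le_rfl]
    simp [initialTable]
  refine ⟨hsk, hone, delta_one_eq_zero fun i j hi hin hj hjn => ?_⟩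
  rw [he.delta_one hsk (c := 1) (fun y => by rw [hone, one_mul]) hi hj, one_mul]
  rcases lt_or_ge n (i + j) with h | h
  · rw [he.initial_high hF (by omega) hj (by omega), he.initial_high hF hi (by omega) (by omega),
      coord_eq_zero_of_mem_flag e h (hF i j (by omega) (by omega) _ (vec_mem_flag e le_rfl) _
        (vec_mem_flag e le_rfl)), add_zero, sub_zero]
  · rw [formOf_vec e _ (by omega) (by omega) (by omega) (by omega),
      formOf_vec e _ (by omega) (by omega) (by omega) (by omega),
      he.coord_lie hi hin hj hjn (by omega) le_rfl, sub_eq_zero]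
    rcases lt_trichotomy i j with h1 | rfl | h1
    · exact initialTable_shift α hi h1
    · rw [initialTable_skew hn α (i + 1) i, neg_add_cancel, lieCoeff, if_neg (lt_irrefl _),
        if_neg (lt_irrefl _)]
    · rw [lieCoeff_skew, ← initialTable_shift α hj h1, initialTable_skew hn α (i + 1) j,
        initialTable_skew hn α i (j + 1)]
      ring

/-- The matrix of the forms `ω_ℓ`, `m = 2ℓ + 3`. -/
def omegaTable (K : Type*) [Field K] (m i j : ℕ) : K :=
  if 2 ≤ i ∧ 2 ≤ j ∧ i + j = m then (-1) ^ i else 0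

lemma omegaTable_skew {m : ℕ} (hm : Odd m) (i j : ℕ) :
    omegaTable K m i j = - omegaTable K m j i := by
  unfold omegaTable
  by_cases h : 2 ≤ i ∧ 2 ≤ j ∧ i + j = m
  · rw [if_pos h, if_pos ⟨h.2.1, h.1, by omega⟩]
    obtain ⟨_, _, rfl⟩ := h
    have h1 : (-1 : K) ^ (i + j) = -1 := hm.neg_one_pow
    rw [pow_add] at h1
    have h2 : (-1 : K) ^ j * (-1) ^ j = 1 := by rw [← pow_add, ← two_mul, pow_mul]; simp
    linear_combination (-1 : K) ^ j * h1 - (-1 : K) ^ i * h2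
  · rw [if_neg h, if_neg fun h' => h ⟨h'.2.1, h'.1, by omega⟩, neg_zero]

end UniversalForm

section OmegaForm

variable {K : Type*} [Field K] {n m : ℕ}
  {𝔤 : Type*} [LieRing 𝔤] [LieAlgebra K 𝔤] {e : Module.Basis (Fin n) K 𝔤} {α : index n → K}

lemma omegaForm_vec (hm : m ≤ n + 2) {i j : ℕ} (hi : 1 ≤ i) (hj : 1 ≤ j) :
    formOf e (omegaTable K m) (vec e i) (vec e j) = omegaTable K m i j := by
  rcases lt_or_ge n i with h | h
  · rw [vec_eq_zero e h, map_zero, LinearMap.zero_apply, omegaTable, if_neg (by omega)]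
  rcases lt_or_ge n j with h' | h'
  · rw [vec_eq_zero e h', map_zero, omegaTable, if_neg (by omega)]
  rw [formOf_vec e _ hi h hj h']

lemma omegaForm_eq_zero {i j : ℕ} (h : m < i + j) {y z : 𝔤} (hy : y ∈ flag e i)
    (hz : z ∈ flag e j) : formOf e (omegaTable K m) y z = 0 := by
  refine form_eq_zero_of_flag e (N := m + 1) (fun i j hi hi' hj hj' h => ?_) h hy hz
  rw [formOf_vec e _ hi hi' hj hj', omegaTable, if_neg (by omega)]

lemma omegaForm_one (y : 𝔤) : formOf e (omegaTable K m) (vec e 1) y = 0 := by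
  suffices h : formOf e (omegaTable K m) (vec e 1) = 0 by rw [h, LinearMap.zero_apply]
  refine e.ext fun i => ?_
  have := i.2
  rw [← vec_succ, formOf_vec e _ le_rfl (by omega) (by omega) (by omega), omegaTable,
    if_neg (by omega), LinearMap.zero_apply]

lemma IsAdapted.delta_omegaForm_one [CharZero K] (he : IsAdapted e α) (hm : Odd m)
    (hmn : m ≤ n + 1) (y z : 𝔤) : delta (formOf e (omegaTable K m)) (vec e 1) y z = 0 := by
  refine delta_one_eq_zero (fun i j hi _ hj _ => ?_) y z
  rw [he.delta_one (formOf_skew e (omegaTable_skew hm)) (c := 0)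
    (fun y => by rw [omegaForm_one, zero_mul]) hi hj, zero_mul, sub_zero,
    omegaForm_vec (by omega) (by omega) (by omega), omegaForm_vec (by omega) (by omega) (by omega),
    omegaTable, omegaTable]
  by_cases h : i + j + 1 = m
  · rw [if_pos (by omega), if_pos (by omega), pow_succ]
    ring
  · rw [if_neg (by omega), if_neg (by omega), add_zero]

lemma delta_omegaForm_eq_zero (hF : LieFlag e) {i j k : ℕ} (hi : 1 ≤ i) (hj : 1 ≤ j) (hk : 1 ≤ k)
    (h : m < i + j + k) :
    delta (formOf e (omegaTable K m)) (vec e i) (vec e j) (vec e k) = 0 :=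
  form_zero_of_forall_flag hF (N := m + 1)
    (fun _ _ h _ hy _ hz => omegaForm_eq_zero h hy hz) hi hj hk h
    (vec_mem_flag e le_rfl) (vec_mem_flag e le_rfl) (vec_mem_flag e le_rfl)

variable [CharZero K]

lemma lie_vec_add_two_sub_mem {a : K} (ha : a ≠ 0) (hx : WittSeq e 1 (normSeq e a)) (i j : ℕ) :
    ⁅vec e (i + 2), vec e (j + 2)⁆ - (6 * a * (i.factorial * j.factorial * ((j : K) - i)
      / (i + j + 2).factorial)) • vec e (i + j + 4) ∈ flag e (i + j + 5) := by
  have h := Submodule.smul_mem _ ((6 * a * (i.factorial : K)) * (6 * a * (j.factorial : K)))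
    (hx.err (i + 2) (j + 2) (by omega) (by omega))
  rw [show i + 2 + (j + 2) = i + j + 4 by ring] at h
  convert h using 1
  rw [vec_add_two ha i, vec_add_two ha j, show i + j + 4 = i + j + 2 + 2 by ring,
    vec_add_two ha (i + j + 2), smul_lie, lie_smul, smul_sub, smul_smul, smul_smul, smul_smul]
  congr 2
  have : ((i + j + 2).factorial : K) ≠ 0 := Nat.cast_ne_zero.2 (Nat.factorial_ne_zero _)
  field_simp
  push_cast
  ring

/-- The coefficient of `d ω_ℓ` at `e₂ ∧ e₃ ∧ e_{k}`, `k = l + 2 = 2ℓ - 2`, up to normalisation. -/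
def kappa (K : Type*) [Field K] (l : ℕ) : K :=
  1 + 6 * (l.factorial * ((l : K) - 1) / (l + 3).factorial)
    + 6 * (l.factorial * (l : K) / (l + 2).factorial)

lemma kappa_ne_zero {l : ℕ} (hl : 1 ≤ l) : kappa K l ≠ 0 := by
  obtain ⟨l, rfl⟩ := Nat.exists_eq_add_of_le' hl
  have h1 : ((l + 1 + 3).factorial : K) ≠ 0 := Nat.cast_ne_zero.2 (Nat.factorial_ne_zero _)
  have h2 : ((l + 1 + 2).factorial : K) ≠ 0 := Nat.cast_ne_zero.2 (Nat.factorial_ne_zero _)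
  have key : kappa K (l + 1) * (l + 1 + 3).factorial = (((l + 1 + 3).factorial
      + 6 * ((l + 1).factorial * l) + 6 * ((l + 1).factorial * (l + 1) * (l + 4)) : ℕ) : K) := by
    have h3 : ((l + 1 + 3).factorial : K) = (l + 4) * (l + 1 + 2).factorial := by
      rw [Nat.factorial_succ]; push_cast; ring
    have h4 : (l : K) + 4 ≠ 0 := by exact_mod_cast Nat.succ_ne_zero (l + 3)
    rw [kappa]
    push_cast
    rw [h3]
    field_simp
    ring
  intro h0
  rw [h0, zero_mul] at key
  have := Nat.cast_ne_zero (R := K).2 (show (l + 1 + 3).factorial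
      + 6 * ((l + 1).factorial * l) + 6 * ((l + 1).factorial * (l + 1) * (l + 4)) ≠ 0 by
    have := Nat.factorial_pos (l + 1 + 3); omega)
  exact this key.symm

lemma delta_omegaForm_two_three {a : K} (ha : a ≠ 0) (hx : WittSeq e 1 (normSeq e a)) {l : ℕ}
    (hl : Even l) (hl2 : 2 ≤ l) (hln : l + 7 ≤ n + 1) :
    delta (formOf e (omegaTable K (l + 7))) (vec e 2) (vec e 3) (vec e (l + 2))
      = - (a * kappa K l) := by
  have key : ∀ i j p, 1 ≤ p → i + j + p = l + 3 →
      formOf e (omegaTable K (l + 7)) ⁅vec e (i + 2), vec e (j + 2)⁆ (vec e p)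
        = (6 * a * (i.factorial * j.factorial * ((j : K) - i) / (i + j + 2).factorial))
          * omegaTable K (l + 7) (i + j + 4) p := by
    intro i j p hp h
    have := omegaForm_eq_zero (m := l + 7) (j := p) (by omega)
      (lie_vec_add_two_sub_mem ha hx i j) (vec_mem_flag e le_rfl)
    rw [map_sub, LinearMap.sub_apply, map_smul, LinearMap.smul_apply, smul_eq_mul,
      omegaForm_vec (by omega) (by omega) hp, sub_eq_zero] at this
    exact this
  have k1 := key 0 1 (l + 2) (by omega) (by omega)
  have k2 := key 1 l 2 (by omega) (by omega)
  have k3 := key l 0 3 (by omega) (by omega)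
  have hl' : (-1 : K) ^ l = 1 := hl.neg_one_pow
  rw [omegaTable, if_pos (by omega)] at k1 k2 k3
  simp only [pow_add, hl', zero_add, add_zero] at k1 k2 k3
  rw [delta]
  change formOf e (omegaTable K (l + 7)) ⁅vec e 2, vec e 3⁆ (vec e (l + 2)) = _ at k1
  change formOf e (omegaTable K (l + 7)) ⁅vec e 3, vec e (l + 2)⁆ (vec e 2) = _ at k2
  change formOf e (omegaTable K (l + 7)) ⁅vec e (l + 2), vec e 2⁆ (vec e 3) = _ at k3
  rw [k1, k2, k3, kappa, show 1 + l + 2 = l + 3 by ring]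
  have h6 : ((1 + 2).factorial : K) = 6 := by norm_num [Nat.factorial]
  rw [h6]
  simp only [Nat.factorial_zero, Nat.factorial_one, Nat.cast_one, Nat.cast_zero]
  ring

end OmegaForm

section Correction

universe u v

variable {K : Type u} [Field K] [CharZero K] {n : ℕ}

lemma IsNormalized.add_smul_omegaForm {𝔤 : Type v} [LieRing 𝔤] [LieAlgebra K 𝔤]
    {e : Module.Basis (Fin n) K 𝔤} {α : index n → K} (he : IsAdapted e α)
    {B : 𝔤 →ₗ[K] 𝔤 →ₗ[K] K} (hB : IsNormalized e B) {m : ℕ} (hm : Odd m) (hmn : m ≤ n + 1)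
    (c : K) : IsNormalized e (B + c • formOf e (omegaTable K m)) where
  skew x y := by
    rw [LinearMap.add_apply, LinearMap.add_apply, LinearMap.add_apply, LinearMap.add_apply,
      LinearMap.smul_apply, LinearMap.smul_apply, LinearMap.smul_apply, LinearMap.smul_apply,
      hB.skew x y, formOf_skew e (omegaTable_skew hm) x y, smul_neg, neg_add]
  one y := by
    rw [LinearMap.add_apply, LinearMap.add_apply, LinearMap.smul_apply, LinearMap.smul_apply,
      omegaForm_one, smul_zero, add_zero, hB.one]
  closed y z := by
    rw [delta_form_add, delta_form_smul, hB.closed, he.delta_omegaForm_one hm hmn, mul_zero,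
      add_zero]

/-- There is a normalised form, depending rationally on the structure constants, which is closed on
the triples `e₂, e₃, e_k` for even `k`. -/
theorem exists_regular_table (hn : 12 ≤ n) (h25 : (2, 5) ∈ index n) :
    ∃ b : (index n → K) → ℕ → ℕ → K,
      (∀ i j, IsRegular ⟨(2, 5), h25⟩ fun α => b α i j) ∧
      ∀ (𝔤 : Type v) [LieRing 𝔤] [LieAlgebra K 𝔤] (e : Module.Basis (Fin n) K 𝔤)
        (α : index n → K), ClassA2 K 𝔤 n → IsAdapted e α →
        IsNormalized e (formOf e (b α)) ∧ ∀ k, 4 ≤ k → Even k →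
          delta (formOf e (b α)) (vec e 2) (vec e 3) (vec e k) = 0 := by
  suffices h : ∀ d, ∃ b : (index n → K) → ℕ → ℕ → K,
      (∀ i j, IsRegular ⟨(2, 5), h25⟩ fun α => b α i j) ∧
      ∀ (𝔤 : Type v) [LieRing 𝔤] [LieAlgebra K 𝔤] (e : Module.Basis (Fin n) K 𝔤)
        (α : index n → K), ClassA2 K 𝔤 n → IsAdapted e α →
        IsNormalized e (formOf e (b α)) ∧ ∀ k, 4 ≤ k → Even k → n < k + d + 4 →
          delta (formOf e (b α)) (vec e 2) (vec e 3) (vec e k) = 0 by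
    obtain ⟨b, hb, h⟩ := h n
    exact ⟨b, hb, fun 𝔤 _ _ e α hg he =>
      ⟨(h 𝔤 e α hg he).1, fun k hk hk' => (h 𝔤 e α hg he).2 k hk hk' (by omega)⟩⟩
  intro d
  induction d with
  | zero =>
    refine ⟨initialTable, isRegular_initialTable _, fun 𝔤 _ _ e α hg he => ?_⟩
    obtain ⟨-, hF, -⟩ := hg.wittSeq he h25
    refine ⟨he.isNormalized_initial hF (by omega), fun k hk _ hkn => ?_⟩
    have hz : ∀ i j, n + 2 ≤ i + j → 2 ≤ i → 2 ≤ j → ∀ y ∈ flag e i, ∀ z ∈ flag e j,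
        formOf e (initialTable α) y z = 0 := by
      intro i j hij hi hj y hy z hz
      have h2 : ∀ p, i ≤ p → formOf e (initialTable α) (vec e p) z = 0 := fun p hp =>
        (flag_le_of e (S := LinearMap.ker (formOf e (initialTable α) (vec e p))) fun q hq =>
          he.initial_high hF (by omega) (by omega) (by omega)) hz
      exact (flag_le_of e (S := LinearMap.ker ((formOf e (initialTable α)).flip z)) h2) hy
    have hv : ∀ i, vec e i ∈ flag e i := fun i => vec_mem_flag e le_rfl
    rw [delta,
      hz (2 + 3) k (by omega) (by omega) (by omega) _ (hF _ _ (by omega) (by omega) _ (hv _) _ (hv _))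
        _ (hv _),
      hz (3 + k) 2 (by omega) (by omega) (by omega) _ (hF _ _ (by omega) (by omega) _ (hv _) _ (hv _))
        _ (hv _),
      hz (k + 2) 3 (by omega) (by omega) (by omega) _ (hF _ _ (by omega) (by omega) _ (hv _) _ (hv _))
        _ (hv _), add_zero, add_zero]
  | succ d ih =>
    obtain ⟨b, hb, h⟩ := ih
    by_cases hd : ∃ l, 2 ≤ l ∧ Even l ∧ n = l + 2 + d + 4
    · obtain ⟨l, hl2, hl, hln⟩ := hd
      refine ⟨fun α i j => b α i j + (deltaCoeff α (b α) 2 3 (l + 2) *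
        ((α ⟨(2, 5), h25⟩)⁻¹ * (kappa K l)⁻¹)) * omegaTable K (l + 7) i j,
        fun i j => (hb i j).add (((isRegular_deltaCoeff hb _ _ _).mul
          (isRegular_inv.mul (isRegular_const _))).mul (isRegular_const _)),
        fun 𝔤 _ _ e α hg he => ?_⟩
      obtain ⟨ha, hF, hx⟩ := hg.wittSeq he h25
      obtain ⟨h1, h2⟩ := h 𝔤 e α hg he
      rw [formOf_add_smul]
      refine ⟨h1.add_smul_omegaForm he (hl.add_odd (by decide)) (by omega) _,
        fun k hk hk' hkn => ?_⟩
      rw [delta_form_add, delta_form_smul]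
      rcases lt_or_ge (l + 2) k with hlt | hge
      · rw [h2 k hk hk' (by omega), delta_omegaForm_eq_zero hF (by omega) (by omega) (by omega)
          (by omega), mul_zero, add_zero]
      · obtain rfl : k = l + 2 := by omega
        rw [delta_omegaForm_two_three ha hx hl hl2 (by omega),
          he.delta_formOf _ (by omega) (by omega) (by omega) (by omega) (by omega) (by omega)]
        have := kappa_ne_zero (K := K) (l := l) (by omega)
        field_simp
        ring
    · refine ⟨b, hb, fun 𝔤 _ _ e α hg he => ⟨(h 𝔤 e α hg he).1, fun k hk hk' hkn =>
        (h 𝔤 e α hg he).2 k hk hk' ?_⟩⟩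
      by_contra hc
      obtain ⟨l, rfl⟩ := Nat.exists_eq_add_of_le' (show 2 ≤ k by omega)
      exact hd ⟨l, by omega, (Nat.even_add.1 hk').2 (by decide), by omega⟩

end Correction

section Cocycles

variable {K : Type*} [Field K] [CharZero K] {n : ℕ}
  {𝔤 : Type*} [LieRing 𝔤] [LieAlgebra K 𝔤] {e : Module.Basis (Fin n) K 𝔤} {α : index n → K}

/-- A rescaling of an adapted basis in which the leading brackets are those of the Witt algebra. -/
lemma ClassA2.exists_basis (hg : ClassA2 K 𝔤 n) (he : IsAdapted e α) :
    ∃ e' : Module.Basis (Fin n) K 𝔤, vec e' 1 = vec e 1 ∧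
      (∀ i, 2 ≤ i → ∃ c : K, vec e' i = c • vec e i) ∧
      (∀ i, 2 ≤ i → ∃ c : K, vec e i = c • vec e' i) ∧
      (∀ i, 1 ≤ i → flag e' i = flag e i) ∧ LieFlag e' ∧ WittSeq e' 1 (vec e') := by
  have hn := hg.le
  have h25 : (2, 5) ∈ index n := mem_index_iff.2 (Or.inl (by omega))
  obtain ⟨ha, hF, hx⟩ := hg.wittSeq he h25
  obtain ⟨e', h1, h2⟩ := hx.toAdSeq.exists_basis
  refine ⟨e', by rw [h1 1 le_rfl, normSeq_one], fun i hi => ⟨_, by rw [h1 i (by omega), normSeq]⟩,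
    fun i hi => ?_, h2, fun i j hi hj => ?_, hx.congr h2 h1⟩
  · obtain ⟨i, rfl⟩ := Nat.exists_eq_add_of_le' hi
    exact ⟨_, by rw [vec_add_two ha, h1 (i + 2) (by omega)]⟩
  · rw [h2 i hi, h2 j hj, h2 (i + j) (by omega)]
    exact hF i j hi hj

variable {η B : 𝔤 →ₗ[K] 𝔤 →ₗ[K] K}

omit [CharZero K] in
lemma sub_skew (hη : ∀ x y, η x y = - η y x) (hB : ∀ x y, B x y = - B y x) (x y : 𝔤) :
    (η - B) x y = - (η - B) y x := by
  have h : ∀ x y, (η - B) x y = η x y - B x y := fun _ _ => rfl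
  rw [h, h, hη x y, hB x y]
  ring

lemma ClassA2.form_eq_zero (hg : ClassA2 K 𝔤 n) (he : IsAdapted e α)
    (hη : ∀ x y, η x y = - η y x) (h1 : ∀ y, η (vec e 1) y = 0)
    (hd1 : ∀ y z, delta η (vec e 1) y z = 0)
    (hd2 : ∀ k, 4 ≤ k → Even k → delta η (vec e 2) (vec e 3) (vec e k) = 0) {i j : ℕ}
    (hi : 1 ≤ i) (hj : 1 ≤ j) (hij : 8 ≤ i + j) {y z : 𝔤} (hy : y ∈ flag e i)
    (hz : z ∈ flag e j) : η y z = 0 := by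
  obtain ⟨e', h1', hc, -, hfl, -, hx⟩ := hg.exists_basis he
  refine form_eq_zero_of_closed hx hη (fun y => by rw [h1', h1]) (N := 8) le_rfl
    (fun i j _ _ _ => by rw [h1', hd1]) (fun k hk hk' _ => ?_) hij (by rwa [hfl i hi])
    (by rwa [hfl j hj])
  obtain ⟨c2, h2⟩ := hc 2 le_rfl
  obtain ⟨c3, h3⟩ := hc 3 (by norm_num)
  obtain ⟨ck, hk2⟩ := hc k (by omega)
  rw [h2, h3, hk2, delta_smul₁, delta_smul₂, delta_smul₃, hd2 k hk hk', mul_zero, mul_zero, mul_zero]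

lemma ClassA2.exists_cob (hg : ClassA2 K 𝔤 n) (he : IsAdapted e α)
    (hη : ∀ x y, η x y = - η y x) (hn : η (vec e 1) (vec e n) = 0) :
    ∃ f : 𝔤 →ₗ[K] K, ∀ y, (η - cob f) (vec e 1) y = 0 := by
  have := hg.le
  obtain ⟨e', h1', hc, -, -, -, hx⟩ := hg.exists_basis he
  obtain ⟨c, hc⟩ := hc n (by omega)
  obtain ⟨f, hf⟩ := FiliformH2.exists_cob hx.toAdSeq hη (by rw [h1', hc, map_smul, hn, smul_zero])
  exact ⟨f, fun y => by rw [← h1', hf]⟩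

lemma ClassA2.delta_eq_zero (hg : ClassA2 K 𝔤 n) (he : IsAdapted e α) (hn : 13 ≤ n)
    (hB : ∀ x y, B x y = - B y x) (hd1 : ∀ y z, delta B (vec e 1) y z = 0)
    (hd2 : ∀ k, 4 ≤ k → Even k → delta B (vec e 2) (vec e 3) (vec e k) = 0)
    (h345 : delta B (vec e 3) (vec e 4) (vec e 5) = 0)
    (h456 : n = 15 → delta B (vec e 4) (vec e 5) (vec e 6) = 0) (x y z : 𝔤) :
    delta B x y z = 0 := by
  obtain ⟨e', h1', hc, -, -, hF, hx⟩ := hg.exists_basis he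
  have key : ∀ i j k, 2 ≤ i → 2 ≤ j → 2 ≤ k → delta B (vec e i) (vec e j) (vec e k) = 0 →
      delta B (vec e' i) (vec e' j) (vec e' k) = 0 := by
    intro i j k hi hj hk h
    obtain ⟨c1, h1⟩ := hc i hi
    obtain ⟨c2, h2⟩ := hc j hj
    obtain ⟨c3, h3⟩ := hc k hk
    rw [h1, h2, h3, delta_smul₁, delta_smul₂, delta_smul₃, h, mul_zero, mul_zero, mul_zero]
  have hd1' : ∀ y z, delta B (vec e' 1) y z = 0 := fun y z => by rw [h1', hd1]
  have hd2' : ∀ k, 4 ≤ k → Even k → delta B (vec e' 2) (vec e' 3) (vec e' k) = 0 := fun k hk hk' =>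
    key 2 3 k le_rfl (by norm_num) (by omega) (hd2 k hk hk')
  have high : ∀ i j k, 2 ≤ i → 2 ≤ j → 2 ≤ k → 15 ≤ i + j + k → (n = 15 → 16 ≤ i + j + k) →
      delta B (vec e' i) (vec e' j) (vec e' k) = 0 := by
    intro i j k hi hj hk h h15
    have hv : ∀ i, vec e' i ∈ flag e' i := fun i => vec_mem_flag e' le_rfl
    rcases lt_or_ge n 16 with h16 | h16
    · exact delta_eq_zero_of_wittSeq (by omega) hF hx hx hB hd1' hd2' (N := n + 1) (by omega)
        le_rfl (by omega) (by omega) (by omega) (by omega) (hv i) (hv j) (hv k)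
    · obtain ⟨x, hx'⟩ := WittSeq.exists_of_le h16 hF hx (n - 11) (by omega) (by omega)
      exact delta_eq_zero_of_wittSeq (by omega) hF hx hx' hB hd1' hd2' (N := 13) (by omega)
        (by omega) (by omega) (by omega) (by omega) (by omega) (hv i) (hv j) (hv k)
  refine delta_eq_zero_of_low hx hB hd1' hd2' (key 3 4 5 (by omega) (by omega) (by omega) h345) ?_
    (fun i j k hi hj hk h => high i j k hi (by omega) (by omega) (by omega) fun _ => h) x y z
  by_cases h15 : n = 15
  · exact key 4 5 6 (by omega) (by omega) (by omega) (h456 h15)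
  · exact high 4 5 6 (by omega) (by omega) (by omega) le_rfl fun h => absurd h h15

/-- A closed form with `η(e₁, e_n) = 0` is a combination of `ω₁`, `ω₂` and a coboundary. -/
lemma ClassA2.exists_eq_omegaForm (hg : ClassA2 K 𝔤 n) (he : IsAdapted e α)
    (hη : ∀ x y, η x y = - η y x) (hd : ∀ x y z, delta η x y z = 0)
    (hn : η (vec e 1) (vec e n) = 0) : ∃ (c d : K) (f : 𝔤 →ₗ[K] K),
      η = c • formOf e (omegaTable K 5) + d • formOf e (omegaTable K 7) + cob f := by
  have h12 := hg.le
  obtain ⟨f, hf⟩ := hg.exists_cob he hη hn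
  obtain ⟨θ, hθ⟩ : ∃ θ, θ = η - cob f := ⟨_, rfl⟩
  rw [← hθ] at hf
  have hsk : ∀ x y, θ x y = - θ y x := hθ ▸ sub_skew hη (cob_skew f)
  have hdθ : ∀ x y z, delta θ x y z = 0 := fun x y z => by
    rw [hθ, delta_form_sub, hd, delta_cob, sub_zero]
  refine ⟨θ (vec e 2) (vec e 3), θ (vec e 2) (vec e 5), f, ?_⟩
  suffices h : θ = θ (vec e 2) (vec e 3) • formOf e (omegaTable K 5)
      + θ (vec e 2) (vec e 5) • formOf e (omegaTable K 7) by
    rw [← h, hθ]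
    ext x y
    simp
  have hz : ∀ i j, 1 ≤ i → 1 ≤ j → 8 ≤ i + j → θ (vec e i) (vec e j) = 0 := fun i j hi hj hij =>
    hg.form_eq_zero he hsk hf (hdθ _) (fun _ _ _ => hdθ _ _ _) hi hj hij (vec_mem_flag e le_rfl)
      (vec_mem_flag e le_rfl)
  have hrec : ∀ i j, 2 ≤ i → 2 ≤ j →
      θ (vec e (i + 1)) (vec e j) + θ (vec e i) (vec e (j + 1)) = 0 := by
    intro i j hi hj
    have := he.delta_one hsk (c := 0) (fun y => by rw [hf, zero_mul]) hi hj
    rw [hdθ, zero_mul, sub_zero] at this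
    exact this.symm
  have h33 := self_of_skew hsk (vec e 3)
  have h24 := hrec 2 3 le_rfl (by norm_num)
  have h25 := hrec 2 4 le_rfl (by norm_num)
  change θ (vec e 3) (vec e 3) + θ (vec e 2) (vec e 4) = 0 at h24
  change θ (vec e 3) (vec e 4) + θ (vec e 2) (vec e 5) = 0 at h25
  rw [h33, zero_add] at h24
  have low : ∀ i j, 2 ≤ i → i < j → θ (vec e i) (vec e j) = θ (vec e 2) (vec e 3) *
      omegaTable K 5 i j + θ (vec e 2) (vec e 5) * omegaTable K 7 i j := by
    intro i j hi hij
    rcases le_or_gt 8 (i + j) with h | h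
    · rw [hz i j (by omega) (by omega) h, omegaTable, omegaTable, if_neg (by omega),
        if_neg (by omega)]
      ring
    · have : i ≤ 3 := by omega
      have : j ≤ 5 := by omega
      interval_cases i <;> interval_cases j <;> first | omega | simp [omegaTable]
      · exact h24
      · linear_combination h25
  refine form_ext e fun i j hi hin hj hjn => ?_
  simp only [LinearMap.add_apply, LinearMap.smul_apply, smul_eq_mul]
  rcases hi.eq_or_lt with rfl | hi2
  · rw [hf, omegaForm_one, omegaForm_one]; ring
  rcases hj.eq_or_lt with rfl | hj2
  · rw [hsk, hf, formOf_skew e (omegaTable_skew (by decide)), omegaForm_one,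
      formOf_skew e (omegaTable_skew (by decide)), omegaForm_one]; ring
  rw [omegaForm_vec (by omega) hi hj, omegaForm_vec (by omega) hi hj]
  rcases lt_trichotomy i j with h | rfl | h
  · exact low i j hi2 h
  · rw [self_of_skew hsk, omegaTable, omegaTable, if_neg (by omega), if_neg (by omega)]; ring
  · rw [hsk, low j i hj2 h, omegaTable_skew (by decide) i j, omegaTable_skew (by decide) i j]; ring

/-- A closed form with `η(e₁, e_n) ≠ 0` forces the normalised form to be closed in high degree. -/
lemma ClassA2.delta_eq_zero_of_closed (hg : ClassA2 K 𝔤 n) (he : IsAdapted e α)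
    (hη : ∀ x y, η x y = - η y x) (hd : ∀ x y z, delta η x y z = 0)
    (hn : η (vec e 1) (vec e n) ≠ 0) (hB : IsNormalized e B)
    (hd2 : ∀ k, 4 ≤ k → Even k → delta B (vec e 2) (vec e 3) (vec e k) = 0) {i j k : ℕ}
    (hi : 2 ≤ i) (hj : 2 ≤ j) (hk : 2 ≤ k) (hijk : 9 ≤ i + j + k) :
    delta B (vec e i) (vec e j) (vec e k) = 0 := by
  have h12 := hg.le
  have h25 : (2, 5) ∈ index n := mem_index_iff.2 (Or.inl (by omega))
  obtain ⟨-, hF, -⟩ := hg.wittSeq he h25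
  obtain ⟨c, hc⟩ : ∃ c, c = (η (vec e 1) (vec e n))⁻¹ := ⟨_, rfl⟩
  have hsk0 : ∀ x y, (c • η - B) x y = - (c • η - B) y x :=
    sub_skew (fun x y => by
      simp only [LinearMap.smul_apply]; rw [hη x y, smul_neg]) hB.skew
  obtain ⟨f, hf⟩ := hg.exists_cob he hsk0 (by
    simp only [LinearMap.sub_apply, LinearMap.smul_apply, smul_eq_mul]
    rw [hB.one, coord_vec e (by omega) le_rfl, if_pos rfl, hc, inv_mul_cancel₀ hn, sub_self])
  have hdθ : ∀ x y z, delta (c • η - B - cob f) x y z = - delta B x y z := fun x y z => by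
    rw [delta_form_sub, delta_form_sub, delta_form_smul, hd, delta_cob]; ring
  have hz : ∀ i j, 1 ≤ i → 1 ≤ j → 8 ≤ i + j → ∀ y ∈ flag e i, ∀ z ∈ flag e j,
      (c • η - B - cob f) y z = 0 := fun i j hi hj hij y hy z hz =>
    hg.form_eq_zero he (sub_skew hsk0 (cob_skew f)) hf
      (fun y z => by rw [hdθ, hB.closed, neg_zero])
      (fun k hk hk' => by rw [hdθ, hd2 k hk hk', neg_zero]) hi hj hij hy hz
  have hv : ∀ i, vec e i ∈ flag e i := fun i => vec_mem_flag e le_rfl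
  rw [← neg_eq_zero, ← hdθ, delta,
    hz (i + j) k (by omega) (by omega) (by omega) _ (hF i j (by omega) (by omega) _ (hv _) _ (hv _))
      _ (hv _),
    hz (j + k) i (by omega) (by omega) (by omega) _ (hF j k (by omega) (by omega) _ (hv _) _ (hv _))
      _ (hv _),
    hz (k + i) j (by omega) (by omega) (by omega) _ (hF k i (by omega) (by omega) _ (hv _) _ (hv _))
      _ (hv _), add_zero, add_zero]

/-- `ω₁` and `ω₂` are closed. -/
lemma IsAdapted.delta_omegaForm {m : ℕ} (he : IsAdapted e α) (hF : LieFlag e) (hm : Odd m) (hm8 : m < 9)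
    (hmn : m ≤ n + 1) (x y z : 𝔤) : delta (formOf e (omegaTable K m)) x y z = 0 := by
  have h1 := he.delta_omegaForm_one hm hmn
  have heq : ∀ x y, delta (formOf e (omegaTable K m)) x x y = 0 :=
    fun x y => self_eq_neg.1 (delta_swap _ x x y)
  refine delta_eq_zero_of_flag e (N := 3) (i := 1) (j := 1) (k := 1)
    (fun i j k hi _ hj _ hk _ _ => ?_) le_rfl (mem_flag_one e x) (mem_flag_one e y)
      (mem_flag_one e z)
  rcases hi.eq_or_lt with rfl | hi2
  · exact h1 _ _
  rcases hj.eq_or_lt with rfl | hj2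
  · rw [delta_rotate]; exact h1 _ _
  rcases hk.eq_or_lt with rfl | hk2
  · rw [← delta_rotate]; exact h1 _ _
  rcases eq_or_ne i j with rfl | hij
  · exact heq _ _
  rcases eq_or_ne j k with rfl | hjk
  · rw [delta_rotate]; exact heq _ _
  rcases eq_or_ne k i with rfl | hki
  · rw [← delta_rotate]; exact heq _ _
  exact delta_omegaForm_eq_zero hF hi hj hk (by omega)

omit [CharZero K] in
/-- `ω₁` and `ω₂` are linearly independent modulo coboundaries. -/
lemma IsAdapted.eq_zero_of_omegaForm_eq_cob (he : IsAdapted e α) (hF : LieFlag e) (hn : 6 ≤ n)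
    {c d : K} {f : 𝔤 →ₗ[K] K}
    (h : c • formOf e (omegaTable K 5) + d • formOf e (omegaTable K 7) = cob f) :
    c = 0 ∧ d = 0 := by
  have hval : ∀ x y, f ⁅x, y⁆ = c * formOf e (omegaTable K 5) x y
      + d * formOf e (omegaTable K 7) x y := fun x y => by
    rw [← cob_apply, ← h]; simp
  have hf : flag e 3 ≤ LinearMap.ker f := flag_le_of e fun i hi => by
    obtain ⟨i, rfl⟩ := Nat.exists_eq_add_of_le' (show 1 ≤ i by omega)
    rw [LinearMap.mem_ker, ← he.lie_one' (by omega), hval, omegaForm_one, omegaForm_one]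
    ring
  have hz : ∀ i j, 2 ≤ i → 2 ≤ j → c * omegaTable K 5 i j + d * omegaTable K 7 i j = 0 := by
    intro i j hi hj
    have := hval (vec e i) (vec e j)
    rw [omegaForm_vec (by omega) (by omega) (by omega),
      omegaForm_vec (by omega) (by omega) (by omega)] at this
    rw [← this]
    exact hf (flag_anti e (by omega) (hF i j (by omega) (by omega) _ (vec_mem_flag e le_rfl) _
      (vec_mem_flag e le_rfl)))
  exact ⟨by simpa [omegaTable] using hz 2 3 (by norm_num) (by norm_num),
    by simpa [omegaTable] using hz 2 5 (by norm_num) (by norm_num)⟩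

end Cocycles

section Cohomology

variable {K : Type*} [Field K] {𝔤 : Type*} [LieRing 𝔤] [LieAlgebra K 𝔤]

/-- Regard a `K`-valued bilinear form as one with values in the trivial Lie module `K`. -/
def toBil : (𝔤 →ₗ[K] 𝔤 →ₗ[K] K) ≃ₗ[K] Bil K 𝔤 :=
  LinearEquiv.congrRight (LinearEquiv.congrRight (TrivialLieModule.equiv K 𝔤 K).symm)

lemma toBil_mem_Z2_iff [CharZero K] {B : 𝔤 →ₗ[K] 𝔤 →ₗ[K] K} :
    toBil B ∈ Z2 K 𝔤 ↔ (∀ x y, B x y = - B y x) ∧ ∀ x y z, delta B x y z = 0 := by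
  have cocycle : ∀ (hB : ∀ x y, B x y = - B y x) (x y z : 𝔤), delta B x y z = 0 ↔
      B x ⁅y, z⁆ = B ⁅x, y⁆ z + B y ⁅x, z⁆ := by
    intro hB x y z
    rw [delta, ← lie_skew z x, map_neg, LinearMap.neg_apply, hB x ⁅y, z⁆, hB y ⁅x, z⁆]
    constructor <;> intro h <;> linear_combination -h
  constructor
  · rintro ⟨⟨a, ha⟩, hmem, haB⟩
    change a = toBil B at haB
    subst haB
    have hB : ∀ x y, B x y = - B y x := by
      have h0 : ∀ x, B x x = 0 := ha
      intro x y
      have := h0 (x + y)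
      simp only [map_add, LinearMap.add_apply, h0] at this
      linear_combination this
    exact ⟨hB, fun x y z => (cocycle hB x y z).2
      ((mem_twoCocycle_iff_of_trivial K 𝔤 (TrivialLieModule K 𝔤 K) _).1 hmem x y z)⟩
  · rintro ⟨hB, hd⟩
    have hself := self_of_skew hB
    have h0 : toBil B ∈ twoCochain K 𝔤 (TrivialLieModule K 𝔤 K) := fun x => hself x
    refine ⟨⟨toBil B, h0⟩, ?_, rfl⟩
    exact (mem_twoCocycle_iff_of_trivial K 𝔤 (TrivialLieModule K 𝔤 K) ⟨toBil B, h0⟩).2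
      fun x y z => (cocycle hB x y z).1 (hd x y z)

lemma toBil_mem_B2_iff {B : 𝔤 →ₗ[K] 𝔤 →ₗ[K] K} :
    toBil B ∈ B2 K 𝔤 ↔ ∃ f : 𝔤 →ₗ[K] K, B = cob f := by
  constructor
  · rintro ⟨_, ⟨f, rfl⟩, h⟩
    refine ⟨- (TrivialLieModule.equiv K 𝔤 K).toLinearMap ∘ₗ f, toBil.injective ?_⟩
    rw [← h]
    ext x y
    exact d₁₂_apply_apply_ofTrivial K 𝔤 (TrivialLieModule K 𝔤 K) f x y
  · rintro ⟨f, rfl⟩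
    refine ⟨_, ⟨- (TrivialLieModule.equiv K 𝔤 K).symm.toLinearMap ∘ₗ f, rfl⟩, ?_⟩
    ext x y
    refine (d₁₂_apply_apply_ofTrivial K 𝔤 (TrivialLieModule K 𝔤 K) _ x y).trans ?_
    exact neg_neg _

lemma cls_eq_iff {ω ω' : Z2 K 𝔤} : cls ω = cls ω' ↔ ω.1 - ω'.1 ∈ B2 K 𝔤 :=
  Submodule.Quotient.eq _

lemma cls_add (ω ω' : Z2 K 𝔤) : cls (ω + ω') = cls ω + cls ω' := rfl

lemma cls_smul (c : K) (ω : Z2 K 𝔤) : cls (c • ω) = c • cls ω := rfl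

lemma exists_cls_eq (c : H2 K 𝔤) : ∃ ω : Z2 K 𝔤, cls ω = c := Submodule.Quotient.mk_surjective _ c

variable {n : ℕ} {e : Module.Basis (Fin n) K 𝔤}

lemma omega_eq (e : Module.Basis (Fin n) K 𝔤) {l : ℕ} (hln : 2 * l + 1 ≤ n) :
    omega e l = toBil (formOf e (omegaTable K (2 * l + 3))) := by
  rw [omega]
  change toBil _ = _
  congr 1
  refine form_ext e fun i j hi hin hj hjn => ?_
  rw [formOf_vec e _ hi hin hj hjn, LinearMap.sum_apply, LinearMap.sum_apply]
  have hk : ∀ k ∈ Finset.Icc 2 ((2 * l + 3) / 2), ((-1 : K) ^ k •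
      ((LinearMap.mul K K).compl₁₂ (coord e k) (coord e (2 * l + 3 - k)) -
      (LinearMap.mul K K).compl₁₂ (coord e (2 * l + 3 - k)) (coord e k))) (vec e i) (vec e j)
      = (if i = k then (if i + j = 2 * l + 3 then (-1) ^ i else 0) else 0)
        + if j = k then (if i + j = 2 * l + 3 then (-1) ^ i else 0) else 0 := by
    intro k hk
    rw [Finset.mem_Icc] at hk
    simp only [LinearMap.smul_apply, LinearMap.sub_apply, LinearMap.compl₁₂_apply,
      LinearMap.mul_apply', coord_vec e (show 1 ≤ k by omega) (show k ≤ n by omega),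
      coord_vec e (show 1 ≤ 2 * l + 3 - k by omega) (show 2 * l + 3 - k ≤ n by omega)]
    by_cases hik : i = k
    · subst hik
      have h1 : j = 2 * l + 3 - i ↔ i + j = 2 * l + 3 := by omega
      have h2 : i ≠ 2 * l + 3 - i := by omega
      by_cases hij : i + j = 2 * l + 3
      · simp [h1, h2, hij, show j ≠ i by omega]
      · simp [h1, h2, hij]
    · by_cases hjk : j = k
      · subst hjk
        have h1 : i = 2 * l + 3 - j ↔ i + j = 2 * l + 3 := by omega
        by_cases hij : i + j = 2 * l + 3
        · have hs : (-1 : K) ^ i = - (-1) ^ j := by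
            have hs : i + j = 2 * (l + 1) + 1 := by omega
            have h3 : (-1 : K) ^ (i + j) = -1 := by rw [hs, pow_succ, pow_mul]; simp
            have h4 : (-1 : K) ^ j * (-1) ^ j = 1 := by rw [← pow_add, ← two_mul, pow_mul]; simp
            rw [pow_add] at h3
            linear_combination (-1 : K) ^ j * h3 - (-1 : K) ^ i * h4
          simp [h1, hik, hij, hs]
        · simp [h1, hik, hij]
      · simp [hik, hjk]
  rw [Finset.sum_congr rfl hk, Finset.sum_add_distrib, Finset.sum_ite_eq, Finset.sum_ite_eq,
    omegaTable]
  simp only [Finset.mem_Icc]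
  by_cases hij : i + j = 2 * l + 3
  · by_cases h2 : 2 ≤ i ∧ 2 ≤ j
    · rcases lt_or_ge i j with h | h
      · rw [if_pos (show 2 ≤ i ∧ i ≤ (2 * l + 3) / 2 by omega),
          if_neg (show ¬ (2 ≤ j ∧ j ≤ (2 * l + 3) / 2) by omega), if_pos hij, if_pos ⟨h2.1, h2.2, hij⟩,
          add_zero]
      · rw [if_neg (show ¬ (2 ≤ i ∧ i ≤ (2 * l + 3) / 2) by omega),
          if_pos (show 2 ≤ j ∧ j ≤ (2 * l + 3) / 2 by omega), if_pos hij, if_pos ⟨h2.1, h2.2, hij⟩,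
          zero_add]
    · rw [if_neg (show ¬ (2 ≤ i ∧ i ≤ (2 * l + 3) / 2) by omega),
        if_neg (show ¬ (2 ≤ j ∧ j ≤ (2 * l + 3) / 2) by omega), if_neg (by tauto), add_zero]
  · simp [hij]

end Cohomology

section Main

variable {K : Type*} [Field K] [CharZero K] {𝔤 : Type*} [LieRing 𝔤] [LieAlgebra K 𝔤] {n : ℕ}
  {e : Module.Basis (Fin n) K 𝔤} {α : index n → K}

lemma ClassA2.omega_mem (hg : ClassA2 K 𝔤 n) (he : IsAdapted e α) {l : ℕ} (hl : l ≤ 2) :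
    omega e l ∈ Z2 K 𝔤 := by
  have hn := hg.le
  obtain ⟨-, hF, -⟩ := hg.wittSeq he (mem_index_iff.2 (Or.inl (by omega)))
  have hm : Odd (2 * l + 3) := ⟨l + 1, by ring⟩
  rw [omega_eq e (by omega), toBil_mem_Z2_iff]
  exact ⟨formOf_skew e (omegaTable_skew hm), he.delta_omegaForm hF hm (by omega) (by omega)⟩

/-- A cocycle with `ω(e₁, e_n) = 0` represents a combination of `[ω₁]` and `[ω₂]`. -/
lemma ClassA2.cls_mem_span (hg : ClassA2 K 𝔤 n) (he : IsAdapted e α) (h₁ : omega e 1 ∈ Z2 K 𝔤)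
    (h₂ : omega e 2 ∈ Z2 K 𝔤) {η : 𝔤 →ₗ[K] 𝔤 →ₗ[K] K} (hη : toBil η ∈ Z2 K 𝔤)
    (hn : η (vec e 1) (vec e n) = 0) :
    cls ⟨toBil η, hη⟩ ∈ Submodule.span K {cls ⟨omega e 1, h₁⟩, cls ⟨omega e 2, h₂⟩} := by
  have h12 := hg.le
  obtain ⟨hsk, hd⟩ := toBil_mem_Z2_iff.1 hη
  obtain ⟨c, d, f, h⟩ := hg.exists_eq_omegaForm he hsk hd hn
  rw [Submodule.mem_span_pair]
  refine ⟨c, d, ?_⟩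
  rw [← cls_smul, ← cls_smul, ← cls_add, eq_comm, cls_eq_iff]
  change toBil η - (c • omega e 1 + d • omega e 2) ∈ _
  rw [omega_eq e (by omega), omega_eq e (by omega), ← map_smul, ← map_smul, ← map_add, ← map_sub,
    toBil_mem_B2_iff]
  refine ⟨f, ?_⟩
  rw [h]
  ext x y
  simp

lemma ClassA2.b2_eq_two (hg : ClassA2 K 𝔤 n) (he : IsAdapted e α) (h₁ : omega e 1 ∈ Z2 K 𝔤)
    (h₂ : omega e 2 ∈ Z2 K 𝔤)
    (h : Submodule.span K {cls ⟨omega e 1, h₁⟩, cls ⟨omega e 2, h₂⟩} = ⊤) : b2 K 𝔤 = 2 := by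
  have hn := hg.le
  obtain ⟨-, hF, -⟩ := hg.wittSeq he (mem_index_iff.2 (Or.inl (by omega)))
  have hli : LinearIndependent K ![cls ⟨omega e 1, h₁⟩, cls ⟨omega e 2, h₂⟩] := by
    rw [LinearIndependent.pair_iff]
    intro c d hcd
    have h0 : (0 : H2 K 𝔤) = cls 0 := rfl
    rw [← cls_smul, ← cls_smul, ← cls_add, h0, cls_eq_iff] at hcd
    change c • omega e 1 + d • omega e 2 - 0 ∈ _ at hcd
    rw [omega_eq e (by omega), omega_eq e (by omega), sub_zero, ← map_smul, ← map_smul, ← map_add,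
      toBil_mem_B2_iff] at hcd
    obtain ⟨f, hf⟩ := hcd
    exact he.eq_zero_of_omegaForm_eq_cob hF (by omega) hf
  have h2 := finrank_span_eq_card hli
  rw [Matrix.range_cons, Matrix.range_cons, Matrix.range_empty, Set.union_empty,
    Set.singleton_union, h, finrank_top] at h2
  exact h2

/-- If the normalised form is closed, its class is affine and spans `H²` together with `[ω₁]` and
`[ω₂]`. -/
lemma ClassA2.exists_affine (hg : ClassA2 K 𝔤 n) (he : IsAdapted e α) (h₁ : omega e 1 ∈ Z2 K 𝔤)
    (h₂ : omega e 2 ∈ Z2 K 𝔤) {B : 𝔤 →ₗ[K] 𝔤 →ₗ[K] K} (hB : IsNormalized e B)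
    (hd : ∀ x y z, delta B x y z = 0) : ∃ ω : Z2 K 𝔤, IsAffineClass (cls ω) ∧
      Submodule.span K {cls ⟨omega e 1, h₁⟩, cls ⟨omega e 2, h₂⟩, cls ω} = ⊤ := by
  have hn := hg.le
  obtain ⟨-, hF, -⟩ := hg.wittSeq he (mem_index_iff.2 (Or.inl (by omega)))
  have hBZ : toBil B ∈ Z2 K 𝔤 := toBil_mem_Z2_iff.2 ⟨hB.skew, hd⟩
  have hcen : ∀ x : 𝔤, ⁅x, vec e n⁆ = 0 := fun x =>
    eq_zero_of_mem_flag e (show n < 1 + n by omega) (hF 1 n le_rfl (by omega) _ (mem_flag_one e x) _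
      (vec_mem_flag e le_rfl))
  have hBn : B (vec e 1) (vec e n) = 1 := by
    rw [hB.one, coord_vec e (by omega) le_rfl, if_pos rfl]
  refine ⟨⟨toBil B, hBZ⟩, fun ω hω => ?_, ?_⟩
  · obtain ⟨ω, hωZ⟩ := ω
    obtain ⟨η, rfl⟩ := toBil.surjective ω
    rw [cls_eq_iff] at hω
    change toBil η - toBil B ∈ _ at hω
    rw [← map_sub, toBil_mem_B2_iff] at hω
    obtain ⟨f, hf⟩ := hω
    refine ⟨vec e n, (LieModule.mem_maxTrivSubmodule _ _ _ _).2 hcen, vec e 1, fun h => ?_⟩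
    change η (vec e n) (vec e 1) = 0 at h
    have h3 : η (vec e n) (vec e 1) - B (vec e n) (vec e 1) = f ⁅vec e n, vec e 1⁆ := by
      rw [← cob_apply, ← hf]; rfl
    rw [h, hB.skew, hBn, ← lie_skew, hcen, neg_zero, map_zero] at h3
    norm_num at h3
  · rw [eq_top_iff]
    rintro c -
    obtain ⟨⟨ω, hω⟩, rfl⟩ := exists_cls_eq c
    obtain ⟨η, rfl⟩ := toBil.surjective ω
    have hsub : ∀ c : K, toBil (η - c • B) = toBil η - c • toBil B := fun c => rfl
    have hmem : toBil (η - η (vec e 1) (vec e n) • B) ∈ Z2 K 𝔤 := by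
      rw [hsub]
      exact sub_mem hω (Submodule.smul_mem _ _ hBZ)
    have h3 := hg.cls_mem_span he h₁ h₂ hmem (by
      rw [LinearMap.sub_apply, LinearMap.sub_apply, LinearMap.smul_apply, LinearMap.smul_apply, hBn,
        smul_eq_mul, mul_one, sub_self])
    have h4 : cls ⟨toBil η, hω⟩ = cls ⟨_, hmem⟩ + η (vec e 1) (vec e n) • cls ⟨toBil B, hBZ⟩ := by
      rw [← cls_smul, ← cls_add]
      congr 1
      refine Subtype.ext ?_
      change toBil η = toBil (η - η (vec e 1) (vec e n) • B) + η (vec e 1) (vec e n) • toBil B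
      rw [hsub, sub_add_cancel]
    rw [h4]
    refine add_mem (Submodule.span_mono ?_ h3)
      (Submodule.smul_mem _ _ (Submodule.subset_span (by simp)))
    intro x hx
    rcases hx with rfl | rfl <;> simp

/-- If all cocycles vanish on `e₁ ∧ e_n`, then `H²` is spanned by `[ω₁]` and `[ω₂]`. -/
lemma ClassA2.span_eq_top (hg : ClassA2 K 𝔤 n) (he : IsAdapted e α) (h₁ : omega e 1 ∈ Z2 K 𝔤)
    (h₂ : omega e 2 ∈ Z2 K 𝔤) (h : ∀ η : 𝔤 →ₗ[K] 𝔤 →ₗ[K] K, (∀ x y, η x y = - η y x) →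
      (∀ x y z, delta η x y z = 0) → η (vec e 1) (vec e n) = 0) :
    Submodule.span K {cls ⟨omega e 1, h₁⟩, cls ⟨omega e 2, h₂⟩} = ⊤ := by
  rw [eq_top_iff]
  rintro c -
  obtain ⟨⟨ω, hω⟩, rfl⟩ := exists_cls_eq c
  obtain ⟨η, rfl⟩ := toBil.surjective ω
  obtain ⟨hsk, hd⟩ := toBil_mem_Z2_iff.1 hω
  exact hg.cls_mem_span he h₁ h₂ hω (h η hsk hd)

end Main

end FiliformH2

end

theorem mainTheorem7 (K : Type*) [Field K] [IsAlgClosed K] [CharZero K] (n : ℕ) (hn : 13 ≤ n) :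
    ∃ P : Fin (if n = 15 then 2 else 1) → MvPolynomial (FiliformH2.index n) K,
      ∀ (𝔤 : Type*) [LieRing 𝔤] [LieAlgebra K 𝔤], FiliformH2.ClassA2 K 𝔤 n →
        ∀ (e : Module.Basis (Fin n) K 𝔤) (α : FiliformH2.index n → K), FiliformH2.IsAdapted e α →
          ∃ (h₁ : FiliformH2.omega e 1 ∈ FiliformH2.Z2 K 𝔤)
            (h₂ : FiliformH2.omega e 2 ∈ FiliformH2.Z2 K 𝔤),
            ((∀ i, MvPolynomial.eval α (P i) = 0) →
              ∃ ω : FiliformH2.Z2 K 𝔤, FiliformH2.IsAffineClass (FiliformH2.cls ω) ∧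
                Submodule.span K {FiliformH2.cls ⟨FiliformH2.omega e 1, h₁⟩,
                  FiliformH2.cls ⟨FiliformH2.omega e 2, h₂⟩, FiliformH2.cls ω} = ⊤) ∧
            ((¬ ∀ i, MvPolynomial.eval α (P i) = 0) →
              Submodule.span K {FiliformH2.cls ⟨FiliformH2.omega e 1, h₁⟩,
                  FiliformH2.cls ⟨FiliformH2.omega e 2, h₂⟩} = ⊤ ∧
                FiliformH2.b2 K 𝔤 = 2) := by
  have h25 : (2, 5) ∈ FiliformH2.index n := FiliformH2.mem_index_iff.2 (Or.inl (by omega))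
  obtain ⟨b, hb, hreg⟩ := FiliformH2.exists_regular_table (K := K) (by omega) h25
  obtain ⟨N₀, P₀, hP₀⟩ := FiliformH2.isRegular_deltaCoeff hb 3 4 5
  obtain ⟨N₁, P₁, hP₁⟩ := FiliformH2.isRegular_deltaCoeff hb 4 5 6
  refine ⟨fun i => if i.val = 0 then P₀ else P₁, fun 𝔤 _ _ hg e α he => ?_⟩
  obtain ⟨ha, -, -⟩ := hg.wittSeq he h25
  obtain ⟨hB, hd2⟩ := hreg 𝔤 e α hg he
  have h₁ := hg.omega_mem he (l := 1) (by norm_num)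
  have h₂ := hg.omega_mem he (l := 2) le_rfl
  have e₀ : MvPolynomial.eval α P₀ = 0 ↔ FiliformH2.delta (FiliformH2.formOf e (b α))
      (FiliformH2.vec e 3) (FiliformH2.vec e 4) (FiliformH2.vec e 5) = 0 := by
    rw [hP₀ α ha, mul_eq_zero, or_iff_right (pow_ne_zero _ ha), he.delta_formOf (b α) (by omega)
      (by omega) (by omega) (by omega) (by omega) (by omega)]
  have e₁ : MvPolynomial.eval α P₁ = 0 ↔ FiliformH2.delta (FiliformH2.formOf e (b α))
      (FiliformH2.vec e 4) (FiliformH2.vec e 5) (FiliformH2.vec e 6) = 0 := by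
    rw [hP₁ α ha, mul_eq_zero, or_iff_right (pow_ne_zero _ ha), he.delta_formOf (b α) (by omega)
      (by omega) (by omega) (by omega) (by omega) (by omega)]
  refine ⟨h₁, h₂, fun h => ?_, fun h => ?_⟩
  · have pos : 0 < if n = 15 then 2 else 1 := by split_ifs <;> norm_num
    refine hg.exists_affine he h₁ h₂ hB (hg.delta_eq_zero he hn hB.skew hB.closed hd2 ?_ ?_)
    · exact e₀.1 (by simpa using h ⟨0, pos⟩)
    · intro h15
      exact e₁.1 (by simpa using h ⟨1, by rw [if_pos h15]; norm_num⟩)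
  · have hspan := hg.span_eq_top he h₁ h₂ fun η hsk hd => by
      by_contra hne
      refine h fun i => ?_
      have key := fun {i j k : ℕ} => hg.delta_eq_zero_of_closed (i := i) (j := j) (k := k) he hsk hd
        hne hB hd2
      change MvPolynomial.eval α (if i.val = 0 then P₀ else P₁) = 0
      by_cases hi : i.val = 0
      · rw [if_pos hi]
        exact e₀.2 (key (by omega) (by omega) (by omega) (by omega))
      · rw [if_neg hi]
        exact e₁.2 (key (by omega) (by omega) (by omega) (by omega))
    exact ⟨hspan, hg.b2_eq_two he h₁ h₂ hspan⟩
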